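/- Let $\mathcal X$ be a separable metric space with Borel $\sigma$-field $\mathcal B$, and let $(\Omega,\mathcal A,P)$ be a probability space. A random measure is a map $M$ from $\Omega$ into the finite measures on $\mathcal B$ such that $M(B)$ is measurable for each $B\in\mathcal B$; random measures are regarded as random variables with respect to the $\sigma$-field generated by the evaluations $\mu\mapsto\mu(B)$, $B\in\mathcal B$. A Poisson random measure with finite intensity $\nu$ is a random measure whose values on pairwise disjoint sets are independent and such that $M(B)\sim\mathrm{Poi}(\nu(B))$ for each $B\in\mathcal B$. For a finite measure $\nu$ with $\nu=\nu_c+\sum_j\gamma_j\delta_{x_j}$, where $\nu_c\{x\}=0$ for all $x$, the $x_j$ are distinct and $0\le\gamma_j\le 1$, let $\mathrm{BeP}(\nu)$ be the law of $M'+\sum_jV_j\delta_{x_j}$, where $M'$ is a Poisson random measure with intensity $\nu_c$, the $V_j$ are independent indicators with $P(V_j=1)=\gamma_j$, and the two summands are independent random measures. Let $m$ be a probability measure on $\mathcal B$ with $m\{x\}=0$ for all $x\in\mathcal X$, and let $\alpha>0$, $\beta\in[0,1)$ and $c>-\beta$. Let $(M_n)_{n\ge1}$ be random measures and $(R_n)_{n\ge1}$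 real random variables on $(\Omega,\mathcal A,P)$ such that - for each $n\ge 1$, $R_n$ is independent of $(M_1,\dots,M_n,R_1,\dots,R_{n-1})$, and, for some constant $u>\max(\beta,0)$, $R_n\ge u$ a.s. for all $n\ge 1$; - $M_{n+1}\mid\mathcal F_n\sim \mathrm{BeP}(\nu_n)$ for all $n\ge0$, i.e. $P(M_{n+1}\in A\mid\mathcal F_n)=\mathrm{BeP}(\nu_n)(A)$ a.s. for each measurable set $A$ of measures, where $\mathcal F_n=\sigma(M_1,\dots,M_n,R_1,\dots,R_n)$ (so $\mathcal F_0$ is trivial), $S_n=\{x\in\mathcal X: M_i\{x\}=1\text{ for some }i=1,\dots,n\}$ (so $S_0=\varnothing$), and $$\nu_n=\sum_{x\in S_n}\frac{\sum_{i=1}^nR_iM_i\{x\}-\beta}{\sum_{i=1}^nR_i+c}\,\delta_x+\alpha\,\frac{\Gamma(c+1)\,\Gamma\left(c+\beta+\sum_{i=1}^nR_i\right)}{\Gamma(c+\beta)\,\Gamma\left(c+1+\sum_{i=1}^nR_i\right)}\,m$$ (so $\nu_0=\alpha m$). For $B\in\mathcal B$ let $L_n(B)=\operatorname{card}(B\cap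 S_n)$ be the number of dishes in $B$ tried by the first $n$ customers, and let $\overline R_n=\frac1n\sum_{i=1}^nR_i$. Let $a_n(0)=\log n$, and $a_n(\beta)=n^\beta$ if $\beta\in(0,1)$. For a constant $r$, let $\lambda(0)=\alpha c/r$, and $\lambda(\beta)=\frac{\alpha\,\Gamma(c+1)}{\Gamma(c+\beta)}\,\frac1{\beta r^{1-\beta}}$ if $\beta\in(0,1)$. Then, for every $B\in\mathcal B$ and every constant $r$: (a) If $\overline R_n\to r$ a.s., then $$\frac{L_n(B)}{a_n(\beta)}\longrightarrow m(B)\lambda(\beta)\quad\text{a.s.}$$ (b) If $\overline R_n\to r$ a.s. and $$\frac{\sum_{j=1}^nj^{\beta-1}E|\overline R_j-r|}{\sqrt{a_n(\beta)}}\longrightarrow0,$$ then $$Y_n:=\sqrt{a_n(\beta)}\left\{\frac{L_n(B)}{a_n(\beta)}-m(B)\lambda(\beta)\right\}\longrightarrow\mathcal N\bigl(0,m(B)\lambda(\beta)\bigr)\quad\text{stably},$$ i.e. $E\{f(Y_n)\mid H\}\to\int f\,d\mathcal N(0,m(B)\lambda(\beta))$ for all $H\in\mathcal A$ with $P(H)>0$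 and all bounded continuous $f:\mathbb R\to\mathbb R$, where $\mathcal N(0,0)=\delta_0$. -/

import Mathlib

open MeasureTheory ProbabilityTheory Filter Topology
open scoped BoundedContinuousFunction ENNReal

universe u v

namespace WeightedIBP

noncomputable section

section RandomMeasures

variable {Ω : Type v} [MeasurableSpace Ω] {X : Type u} [MeasurableSpace X]

/-- A random measure: a map into the finite measures on `X`, measurable for the `σ`-field generated
by the evaluations `μ ↦ μ B`, `B` measurable (this is Mathlib's `σ`-field on `Measure X`). -/
structure IsRandomMeasure (M : Ω → Measure X) : Prop where
  measurable : Measurable M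
  finite : ∀ ω, IsFiniteMeasure (M ω)

/-- A completely random measure: its values on pairwise disjoint measurable sets are
independent. -/
structure IsCompletelyRM (P : Measure Ω) (M : Ω → Measure X) : Prop extends
    IsRandomMeasure M where
  indep : ∀ (k : ℕ) (B : Fin k → Set X), (∀ i, MeasurableSet (B i)) →
    Pairwise (Function.onFun Disjoint B) → iIndepFun (fun i ω => M ω (B i)) P

/-- A Poisson random measure with (finite) intensity `ν`: a completely random measure such that
`M(B)` has the Poisson law with mean `ν(B)` for every measurable `B`. -/
structure IsPoissonRM (P : Measure Ω) (M : Ω → Measure X) (ν : Measure X) : Prop extends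
    IsCompletelyRM P M where
  law : ∀ B : Set X, MeasurableSet B →
    P.map (fun ω => M ω B) = (poissonMeasure (ν B).toNNReal).map (fun n : ℕ => (n : ℝ≥0∞))

/-- The diffuse part of a finite measure. -/
def diffusePart (ν : Measure X) : Measure X := ν.restrict {x | ν {x} = 0}

/-- A Bernoulli random measure with hazard measure `ν`: the sum of two independent random measures
`M₁` and `M₂`, where `M₁` is a Poisson random measure whose intensity is the diffuse part of `ν`
and `M₂ = ∑ 1_{V x} δ_x`, the sum being over the atoms `x` of `ν`, with independent events `V x` of
probabilities `ν {x}`. -/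
def IsBernoulliRM (P : Measure Ω) (M : Ω → Measure X) (ν : Measure X) : Prop :=
  ∃ (M₁ M₂ : Ω → Measure X) (V : {x : X // ν {x} ≠ 0} → Set Ω),
    IsPoissonRM P M₁ (diffusePart ν) ∧
    IsRandomMeasure M₂ ∧
    (∀ x, MeasurableSet (V x)) ∧ iIndepSet V P ∧ (∀ x, P (V x) = ν {x.1}) ∧
    (∀ ω, M₂ ω = Measure.sum fun x => (V x).indicator (fun _ => Measure.dirac x.1) ω) ∧
    IndepFun M₁ M₂ P ∧
    ∀ ω, M ω = M₁ ω + M₂ ω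

/-- `Q` is the law `BeP(ν)`, that is, the law of a Bernoulli random measure with hazard
measure `ν`. -/
def IsBernoulliLaw (ν : Measure X) (Q : Measure (Measure X)) : Prop :=
  ∃ (Ω' : Type u) (_ : MeasurableSpace Ω') (P' : Measure Ω') (M : Ω' → Measure X),
    IsProbabilityMeasure P' ∧ IsBernoulliRM P' M ν ∧ P'.map M = Q

/-- `M ∣ 𝒢 ∼ BeP(ν)` for a random hazard measure `ν`: for each measurable set `A` of measures,
`P(M ∈ A ∣ 𝒢) = BeP(ν)(A)` almost surely. -/
def CondBernoulli (P : Measure Ω) (𝒢 : MeasurableSpace Ω) (M ν : Ω → Measure X) : Prop :=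
  ∃ κ : Ω → Measure (Measure X),
    (∀ᵐ ω ∂P, IsBernoulliLaw (ν ω) (κ ω)) ∧
    ∀ A : Set (Measure X), MeasurableSet A →
      P[(M ⁻¹' A).indicator (fun _ => (1 : ℝ)) | 𝒢] =ᵐ[P] fun ω => (κ ω).real A

end RandomMeasures

section Model

variable {Ω : Type v} {X : Type u} [MeasurableSpace X]

/-- `σ(M₁, …, Mₙ, R₁, …, Rₙ)`. The customers are numbered from `1`. -/
abbrev history (M : ℕ → Ω → Measure X) (R : ℕ → Ω → ℝ) (n : ℕ) : MeasurableSpace Ω :=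
  ⨆ i ∈ Finset.Icc 1 n,
    (MeasurableSpace.comap (M i) inferInstance ⊔ MeasurableSpace.comap (R i) inferInstance)

/-- The set of the dishes tried by the first `n` customers. -/
def dishes (M : ℕ → Ω → Measure X) (n : ℕ) (ω : Ω) : Set X :=
  {x | ∃ i ∈ Finset.Icc 1 n, M i ω {x} = 1}

/-- The number of the dishes in `B` tried by the first `n` customers. -/
def dishCount (M : ℕ → Ω → Measure X) (B : Set X) (n : ℕ) (ω : Ω) : ℕ :=
  (B ∩ dishes M n ω).ncard

/-- The total weight `R₁ + ⋯ + Rₙ`. -/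
def totalWeight (R : ℕ → Ω → ℝ) (n : ℕ) (ω : Ω) : ℝ := ∑ i ∈ Finset.Icc 1 n, R i ω

/-- The mean weight `(R₁ + ⋯ + Rₙ) / n`. -/
def meanWeight (R : ℕ → Ω → ℝ) (n : ℕ) (ω : Ω) : ℝ := totalWeight R n ω / n

/-- The mean number of new dishes of customer `n + 1`. -/
def newDishRate (R : ℕ → Ω → ℝ) (α β c : ℝ) (n : ℕ) (ω : Ω) : ℝ :=
  α * (Real.Gamma (c + 1) * Real.Gamma (c + β + totalWeight R n ω) /
    (Real.Gamma (c + β) * Real.Gamma (c + 1 + totalWeight R n ω)))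

theorem newDishRate_zero (R : ℕ → Ω → ℝ) {α β c : ℝ} (hβ : β < 1) (hc : -β < c) (ω : Ω) :
    newDishRate R α β c 0 ω = α := by
  have h₁ : Real.Gamma (c + 1) ≠ 0 := (Real.Gamma_pos_of_pos (by linarith)).ne'
  have h₂ : Real.Gamma (c + β) ≠ 0 := (Real.Gamma_pos_of_pos (by linarith)).ne'
  simp only [newDishRate, totalWeight]
  simp
  field_simp

/-- The probability that customer `n + 1` tries the old dish `x`. -/
def inclusionProb (M : ℕ → Ω → Measure X) (R : ℕ → Ω → ℝ) (β c : ℝ) (n : ℕ) (ω : Ω) (x : X) : ℝ :=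
  ((∑ i ∈ Finset.Icc 1 n, R i ω * (M i ω).real {x}) - β) / (totalWeight R n ω + c)

/-- The random hazard measure of customer `n + 1`. By `newDishRate_zero` it is `α m` for
`n = 0`. -/
def hazard (M : ℕ → Ω → Measure X) (R : ℕ → Ω → ℝ) (m : Measure X) (α β c : ℝ) (n : ℕ) (ω : Ω) :
    Measure X :=
  (Measure.sum fun x : dishes M n ω =>
      ENNReal.ofReal (inclusionProb M R β c n ω x.1) • Measure.dirac x.1) +
    ENNReal.ofReal (newDishRate R α β c n ω) • m

/-- The weighted Indian buffet process `((Mₙ, Rₙ) : n ≥ 1)` with parameters `m, α, β, c`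
(the entries with index `0` play no role). -/
structure IsWeightedIBP [MeasurableSpace Ω] (P : Measure Ω) (M : ℕ → Ω → Measure X) (R : ℕ → Ω → ℝ) (m : Measure X)
    (α β c : ℝ) : Prop where
  randomMeasure : ∀ n, 1 ≤ n → IsRandomMeasure (M n)
  measurable_weight : ∀ n, 1 ≤ n → Measurable (R n)
  /-- `Rₙ₊₁` is independent of `(M₁, …, Mₙ₊₁, R₁, …, Rₙ)`. -/
  indep : ∀ n, Indep (MeasurableSpace.comap (R (n + 1)) inferInstance)
    (history M R n ⊔ MeasurableSpace.comap (M (n + 1)) inferInstance) P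
  weight_bound : ∃ u : ℝ, max β 0 < u ∧ ∀ n, 1 ≤ n → ∀ᵐ ω ∂P, u ≤ R n ω
  condLaw : ∀ n, CondBernoulli P (history M R n) (M (n + 1)) (hazard M R m α β c n)

end Model

section Limits

/-- The norming sequence: `log n` if `β = 0` and `n ^ β` otherwise. -/
def normSeq (β : ℝ) (n : ℕ) : ℝ := if β = 0 then Real.log n else (n : ℝ) ^ β

/-- The limiting constant `λ(β)`. -/
def limitConst (α β c r : ℝ) : ℝ :=
  if β = 0 then α * c / r
  else α * Real.Gamma (c + 1) / Real.Gamma (c + β) * (1 / (β * r ^ (1 - β)))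

variable {Ω : Type v} [MeasurableSpace Ω]

/-- `R̄ₙ → r` almost surely. -/
def MeanWeightTendsto (P : Measure Ω) (R : ℕ → Ω → ℝ) (r : ℝ) : Prop :=
  ∀ᵐ ω ∂P, Tendsto (fun n => meanWeight R n ω) atTop (𝓝 r)

/-- `(∑_{j ≤ n} j ^ (β - 1) E|R̄ⱼ - r|) / √aₙ(β) → 0`. The expectations of these nonnegative
variables are in `[0, ∞]`. -/
def MeanWeightRate (P : Measure Ω) (R : ℕ → Ω → ℝ) (β r : ℝ) : Prop :=
  Tendsto (fun n : ℕ =>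
    (∑ j ∈ Finset.Icc 1 n, ENNReal.ofReal ((j : ℝ) ^ (β - 1)) *
        ∫⁻ ω, ENNReal.ofReal |meanWeight R j ω - r| ∂P) /
      ENNReal.ofReal (Real.sqrt (normSeq β n)))
    atTop (𝓝 0)

/-- Stable convergence of the random variables `Y n` to the random probability measure `K`:
`E(f(Yₙ) ∣ H) → E(K(f) ∣ H)` for all events `H` of positive probability and all bounded continuous
functions `f`. -/
def StablyConverges {E : Type*} [TopologicalSpace E] [MeasurableSpace E] (P : Measure Ω)
    (Y : ℕ → Ω → E) (K : Kernel Ω E) : Prop :=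
  (∀ n, AEMeasurable (Y n) P) ∧
  ∀ H : Set Ω, MeasurableSet H → 0 < P H → ∀ f : E →ᵇ ℝ,
    Tendsto (fun n => ∫ ω, f (Y n ω) ∂(ProbabilityTheory.cond P H)) atTop
      (𝓝 (∫ ω, (∫ y, f y ∂(K ω)) ∂(ProbabilityTheory.cond P H)))

end Limits

end

end WeightedIBP

open WeightedIBP

/-! Dishes new to customer n + 1 lie off the finite set S_n, where the hazard has no atoms and
equals a multiple of m. Hence, given the history, the number K_n of new dishes in B is Poisson with
mean Λ_n = m(B) `weightRate`(R_1 + ⋯ + R_n), and L_n(B) = K_0 + ⋯ + K_{n-1} almost surely. The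
theorem follows from these conditional laws and the growth of Λ_n.

Growth of the rates. By Wendel's inequalities Γ(c + β + T) / Γ(c + 1 + T) is T^(β-1) up to a
relative error O(1/T). With T = j R̄_j and R̄_j ≥ u > 0, the sum of Λ_j over j < n differs from m(B)
λ(β) a_n by O(1 + ∑_{j ≤ n} j^(β-1) |R̄_j - r|) with a non-random constant
(`exists_abs_sum_weightRate_sub_le`). Moreover Λ_j ≤ w_j = C (j + 1)^(β-1), and the sums of w_j are
of order a_n.

Part (a). The martingale ∑ (K_j - Λ_j) / (1 + w_0 + ⋯ + w_j) is bounded in L², hence converges;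
Kronecker's lemma gives ∑ (K_j - Λ_j) = o(a_n), and ∑ Λ_j / a_n tends to m(B) λ(β) by a Cesàro
argument.

Part (b). The variables exp(∑ (i s K_j - Λ_j (e^{is} - 1))) form a martingale. For s = t / √a_n it
is exp(i s ∑ (K_j - Λ_j)) times a bounded factor tending to the constant exp(m(B) λ(β) t² / 2),
which identifies the Gaussian characteristic function against every test variable of a finite
history, then against every event. The rate assumption allows ∑ Λ_j to be replaced by m(B) λ(β) a_n.

The conditional Poisson law itself (`IsWeightedIBP.isCondPoisson`) needs care, since S_n may take
uncountably many values. Its complement is exhausted by unions of cells of finite, finer and finer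
partitions that received no mass so far. Such a union takes finitely many values, so the conditional
law of M_{n+1} can be applied to deterministic sets, and a limit over the partitions concludes. The
limit uses that a Poisson random measure with diffuse intensity is almost surely a finite sum of
unit masses at distinct points. -/

namespace WeightedIBP

open scoped NNReal Nat

/-! ### Moments and tails of the Poisson law -/

section PoissonMoments

/-- Each moment below is reduced by this recursion to a lower one, after a shift of the summation
index. -/
theorem poissonMeasure_real_succ_mul (r : ℝ≥0) (k : ℕ) :
    (poissonMeasure r).real {k + 1} * ((k : ℝ) + 1) = r * (poissonMeasure r).real {k} := by
  rw [poissonMeasure_real_singleton, poissonMeasure_real_singleton, Nat.factorial_succ, pow_succ]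
  push_cast
  have : (k : ℝ) + 1 ≠ 0 := by positivity
  field_simp

theorem hasSum_poissonMeasure_real (r : ℝ≥0) :
    HasSum (fun k : ℕ => (poissonMeasure r).real {k}) 1 := by
  simpa only [poissonMeasure_real_singleton] using hasSum_one_poissonMeasure r

theorem hasSum_poissonMeasure_real_mul (r : ℝ≥0) :
    HasSum (fun k : ℕ => (poissonMeasure r).real {k} * (k : ℝ)) r := by
  rw [← hasSum_nat_add_iff' 1]
  have h := (hasSum_poissonMeasure_real r).mul_left (r : ℝ)
  simp only [← poissonMeasure_real_succ_mul] at h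
  simpa using h

theorem hasSum_poissonMeasure_real_mul_sq (r : ℝ≥0) :
    HasSum (fun k : ℕ => (poissonMeasure r).real {k} * (k : ℝ) ^ 2) ((r : ℝ) ^ 2 + r) := by
  rw [← hasSum_nat_add_iff' 1]
  have h := ((hasSum_poissonMeasure_real_mul r).add (hasSum_poissonMeasure_real r)).mul_left (r : ℝ)
  have e : (r : ℝ) ^ 2 + r - ∑ i ∈ Finset.range 1, (poissonMeasure r).real {i} * (i : ℝ) ^ 2
      = r * (r + 1) := by
    simp; ring
  rw [e]
  refine h.congr_fun fun k => ?_
  push_cast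
  linear_combination ((k : ℝ) + 1) * (poissonMeasure_real_succ_mul r k)

/-- One step of the second moment of a martingale: x is the past value, y the weight of the new
centred increment, and the cross term vanishes. -/
theorem hasSum_poissonMeasure_real_mul_quadratic (r : ℝ≥0) (x y : ℝ) :
    HasSum (fun k : ℕ => (poissonMeasure r).real {k} * (x + ((k : ℝ) - r) * y) ^ 2)
      (x ^ 2 + r * y ^ 2) := by
  have h := (((hasSum_poissonMeasure_real r).mul_left ((x - r * y) ^ 2)).add
    ((hasSum_poissonMeasure_real_mul r).mul_left (2 * y * (x - r * y)))).add
    ((hasSum_poissonMeasure_real_mul_sq r).mul_left (y ^ 2))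
  have e : (x - r * y) ^ 2 * 1 + 2 * y * (x - r * y) * r + y ^ 2 * ((r : ℝ) ^ 2 + r) =
      x ^ 2 + r * y ^ 2 := by ring
  rw [e] at h
  refine h.congr_fun fun k => ?_
  ring

theorem lintegral_poissonMeasure_ofReal (r : ℝ≥0) {f : ℕ → ℝ} {a : ℝ} (hf : ∀ k, 0 ≤ f k)
    (h : HasSum (fun k : ℕ => (poissonMeasure r).real {k} * f k) a) :
    ∫⁻ k, ENNReal.ofReal (f k) ∂(poissonMeasure r) = ENNReal.ofReal a := by
  rw [lintegral_countable', ← h.tsum_eq, ENNReal.ofReal_tsum_of_nonneg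
    (fun k => mul_nonneg measureReal_nonneg (hf k)) h.summable]
  refine tsum_congr fun k => ?_
  rw [mul_comm, ENNReal.ofReal_mul measureReal_nonneg, ofReal_measureReal]

theorem lintegral_poissonMeasure_quadratic (r : ℝ≥0) (x y : ℝ) :
    ∫⁻ k, ENNReal.ofReal ((x + ((k : ℝ) - r) * y) ^ 2) ∂(poissonMeasure r) =
      ENNReal.ofReal (x ^ 2 + r * y ^ 2) :=
  lintegral_poissonMeasure_ofReal r (fun _ => sq_nonneg _)
    (hasSum_poissonMeasure_real_mul_quadratic r x y)

theorem integral_sub_poissonMeasure (r : ℝ≥0) :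
    ∫ k, ((k : ℝ) - r) ∂(poissonMeasure r) = 0 := by
  have h := (hasSum_poissonMeasure_real_mul r).sub ((hasSum_poissonMeasure_real r).mul_right (r : ℝ))
  rw [one_mul, sub_self] at h
  rw [integral_poissonMeasure]
  simp only [smul_eq_mul, ← poissonMeasure_real_singleton]
  rw [← h.tsum_eq]
  exact tsum_congr fun k => by ring

theorem lintegral_enorm_sub_poissonMeasure_le (r : ℝ≥0) :
    ∫⁻ k, ‖(k : ℝ) - r‖ₑ ∂(poissonMeasure r) ≤ 2 * r := by
  have h : ∫⁻ k : ℕ, ENNReal.ofReal (k : ℝ) ∂(poissonMeasure r) = ENNReal.ofReal r :=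
    lintegral_poissonMeasure_ofReal r (fun k => Nat.cast_nonneg k) (hasSum_poissonMeasure_real_mul r)
  calc ∫⁻ k, ‖(k : ℝ) - r‖ₑ ∂(poissonMeasure r)
      ≤ ∫⁻ k : ℕ, (ENNReal.ofReal (k : ℝ) + r) ∂(poissonMeasure r) := by
        refine lintegral_mono fun k => ?_
        refine (enorm_sub_le).trans ?_
        gcongr
        · rw [Real.enorm_eq_ofReal (Nat.cast_nonneg k)]
        · simp
    _ = 2 * r := by
        rw [lintegral_add_right _ measurable_const, h]
        simp [two_mul]

theorem integral_cexp_poissonMeasure (r : ℝ≥0) (s : ℝ) :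
    ∫ k, Complex.exp (s * (k : ℝ) * Complex.I) ∂(poissonMeasure r) =
      Complex.exp (r * (Complex.exp (s * Complex.I) - 1)) := by
  rw [← charFun_map_cast_poissonMeasure, charFun_apply_real,
    integral_map (by fun_prop) (by fun_prop)]

theorem measurable_poissonMeasure_singleton (j : ℕ) :
    Measurable fun r : ℝ≥0 => poissonMeasure r {j} := by
  simp only [poissonMeasure_singleton]
  fun_prop

theorem continuous_poissonMeasure_singleton (j : ℕ) :
    Continuous fun r : ℝ≥0 => poissonMeasure r {j} := by
  simp only [poissonMeasure_singleton]
  exact ENNReal.continuous_ofReal.comp (by fun_prop)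

/-- From e^{-r} ≥ 1 - r, the probability 1 - e^{-r}(1 + r) is at most 1 - (1 - r)(1 + r). The
quadratic order rules out multiple points in small cells. -/
theorem poissonMeasure_two_le (r : ℝ≥0) : poissonMeasure r {k | 2 ≤ k} ≤ (r : ℝ≥0∞) ^ 2 := by
  have hc : {k : ℕ | 2 ≤ k} = ({0} ∪ {1} : Set ℕ)ᶜ := by
    ext k
    simp
    omega
  have h1 : (poissonMeasure r).real {k | 2 ≤ k} = 1 - (Real.exp (-r) + Real.exp (-r) * r) := by
    rw [hc, measureReal_compl (by measurability), measureReal_union (by simp) (by measurability),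
      poissonMeasure_real_singleton, poissonMeasure_real_singleton]
    simp
  have h2 : (poissonMeasure r).real {k | 2 ≤ k} ≤ (r : ℝ) ^ 2 := by
    rw [h1]
    nlinarith [Real.one_sub_le_exp_neg (r : ℝ), r.coe_nonneg]
  rw [← ofReal_measureReal]
  calc ENNReal.ofReal ((poissonMeasure r).real {k | 2 ≤ k}) ≤ ENNReal.ofReal ((r : ℝ) ^ 2) :=
        ENNReal.ofReal_le_ofReal h2
    _ = (r : ℝ≥0∞) ^ 2 := by
        rw [ENNReal.ofReal_pow r.coe_nonneg, ENNReal.ofReal_coe_nnreal]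

end PoissonMoments

/-! ### Conditionally Poisson variables and their integrals -/

section CondPoisson

variable {Ω : Type v}

/-- The conditional law of `K` given `𝒢` is the Poisson law with the random mean `Λ`. -/
structure IsCondPoisson (𝒢 : MeasurableSpace Ω) {mΩ : MeasurableSpace Ω} (P : Measure Ω) (K : Ω → ℕ) (Λ : Ω → ℝ≥0) :
    Prop where
  measurable : Measurable K
  measurable_rate : Measurable[𝒢] Λ
  law : ∀ A : Set Ω, MeasurableSet[𝒢] A → ∀ j : ℕ,
    P (A ∩ K ⁻¹' {j}) = ∫⁻ ω in A, poissonMeasure (Λ ω) {j} ∂P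

variable {𝒢 mΩ : MeasurableSpace Ω} {P : Measure Ω} {K : Ω → ℕ}
  {Λ : Ω → ℝ≥0}

namespace IsCondPoisson

/-- The conditional law read as an equality of measures on 𝒢, so that it applies to all 𝒢-measurable
integrands at once. -/
theorem trim_restrict (h : IsCondPoisson 𝒢 P K Λ) (h𝒢 : 𝒢 ≤ mΩ) (j : ℕ) :
    (P.restrict (K ⁻¹' {j})).trim h𝒢 =
      (P.withDensity fun ω => poissonMeasure (Λ ω) {j}).trim h𝒢 := by
  refine @Measure.ext Ω 𝒢 _ _ fun A hA => ?_
  rw [trim_measurableSet_eq h𝒢 hA, trim_measurableSet_eq h𝒢 hA, Measure.restrict_apply (h𝒢 A hA),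
    h.law A hA j, withDensity_apply _ (h𝒢 A hA)]

theorem measurable_density (h : IsCondPoisson 𝒢 P K Λ) (h𝒢 : 𝒢 ≤ mΩ) (j : ℕ) :
    Measurable fun ω => poissonMeasure (Λ ω) {j} :=
  (measurable_poissonMeasure_singleton j).comp (h.measurable_rate.mono h𝒢 le_rfl)

/-- On {K = j} the integrand coincides with the 𝒢-measurable f(·, j), whose integral over this event
is given by the density; it remains to sum over j. -/
theorem lintegral_eq (h : IsCondPoisson 𝒢 P K Λ) (h𝒢 : 𝒢 ≤ mΩ) {f : Ω → ℕ → ℝ≥0∞}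
    (hf : ∀ k, Measurable[𝒢] fun ω => f ω k) :
    ∫⁻ ω, f ω (K ω) ∂P = ∫⁻ ω, ∫⁻ k, f ω k ∂(poissonMeasure (Λ ω)) ∂P := by
  have hK : ∀ j, MeasurableSet (K ⁻¹' {j}) := fun j => h.measurable (measurableSet_singleton j)
  have hU : (⋃ j, K ⁻¹' {j}) = Set.univ := by ext; simp
  have hd : Pairwise (Function.onFun Disjoint fun j => K ⁻¹' {j}) := fun i j hij =>
    Disjoint.preimage _ (by simpa using hij)
  rw [← setLIntegral_univ, ← hU, lintegral_iUnion hK hd]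
  simp only [lintegral_countable']
  rw [lintegral_tsum (f := fun k ω => f ω k * poissonMeasure (Λ ω) {k}) fun k => (((hf k).mono h𝒢 le_rfl).mul (h.measurable_density h𝒢 k)).aemeasurable]
  refine tsum_congr fun j => ?_
  calc ∫⁻ ω in K ⁻¹' {j}, f ω (K ω) ∂P = ∫⁻ ω in K ⁻¹' {j}, f ω j ∂P :=
        setLIntegral_congr_fun (hK j) fun ω hω => by
          rw [Set.mem_preimage, Set.mem_singleton_iff] at hω
          simp only [hω]
    _ = ∫⁻ ω, f ω j * poissonMeasure (Λ ω) {j} ∂P := by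
        rw [← lintegral_trim h𝒢 (hf j), h.trim_restrict h𝒢, lintegral_trim h𝒢 (hf j),
          lintegral_withDensity_eq_lintegral_mul _ (h.measurable_density h𝒢 j)
            ((hf j).mono h𝒢 le_rfl)]
        exact lintegral_congr fun ω => mul_comm _ _

variable {E : Type*} [NormedAddCommGroup E] [NormedSpace ℝ E] [FiniteDimensional ℝ E]

theorem aestronglyMeasurable_comp (h : IsCondPoisson 𝒢 P K Λ) (h𝒢 : 𝒢 ≤ mΩ) {f : Ω → ℕ → E}
    (hf : ∀ k, StronglyMeasurable[𝒢] fun ω => f ω k) :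
    AEStronglyMeasurable (fun ω => f ω (K ω)) P := by
  borelize E
  have : Measurable (Function.uncurry f) :=
    measurable_from_prod_countable_left fun k => ((hf k).measurable).mono h𝒢 le_rfl
  exact (this.comp (measurable_id.prodMk h.measurable)).aestronglyMeasurable

theorem integrable_comp (h : IsCondPoisson 𝒢 P K Λ) (h𝒢 : 𝒢 ≤ mΩ) {f : Ω → ℕ → E}
    (hf : ∀ k, StronglyMeasurable[𝒢] fun ω => f ω k)
    (hfin : ∫⁻ ω, ∫⁻ k, ‖f ω k‖ₑ ∂(poissonMeasure (Λ ω)) ∂P ≠ ∞) :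
    Integrable (fun ω => f ω (K ω)) P := by
  refine ⟨h.aestronglyMeasurable_comp h𝒢 hf, ?_⟩
  rw [hasFiniteIntegral_iff_enorm,
    h.lintegral_eq h𝒢 (f := fun ω k => ‖f ω k‖ₑ) fun k => (hf k).enorm]
  exact hfin.lt_top

theorem integral_eq (h : IsCondPoisson 𝒢 P K Λ) (h𝒢 : 𝒢 ≤ mΩ) {f : Ω → ℕ → E}
    (hf : ∀ k, StronglyMeasurable[𝒢] fun ω => f ω k)
    (hfin : ∫⁻ ω, ∫⁻ k, ‖f ω k‖ₑ ∂(poissonMeasure (Λ ω)) ∂P ≠ ∞) :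
    ∫ ω, f ω (K ω) ∂P = ∫ ω, ∫ k, f ω k ∂(poissonMeasure (Λ ω)) ∂P := by
  have hK : ∀ j, MeasurableSet (K ⁻¹' {j}) := fun j => h.measurable (measurableSet_singleton j)
  have hU : (⋃ j, K ⁻¹' {j}) = Set.univ := by ext; simp
  have hd : Pairwise (Function.onFun Disjoint fun j => K ⁻¹' {j}) := fun i j hij =>
    Disjoint.preimage _ (by simpa using hij)
  have hint := h.integrable_comp h𝒢 hf hfin
  rw [← setIntegral_univ, ← hU, integral_iUnion hK hd hint.integrableOn]
  have hmeas : ∀ k, AEStronglyMeasurable (fun ω => (poissonMeasure (Λ ω)).real {k} • f ω k) P :=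
    fun k => (h.measurable_density h𝒢 k).ennreal_toReal.aestronglyMeasurable.smul
      ((hf k).mono h𝒢).aestronglyMeasurable
  have hsum : ∑' k, ∫⁻ ω, ‖(poissonMeasure (Λ ω)).real {k} • f ω k‖ₑ ∂P ≠ ∞ := by
    rw [← lintegral_tsum fun k => (hmeas k).enorm]
    convert hfin using 3 with ω
    rw [lintegral_countable']
    refine tsum_congr fun k => ?_
    rw [enorm_smul, Real.enorm_eq_ofReal measureReal_nonneg, ofReal_measureReal, mul_comm]
  simp only [integral_poissonMeasure, ← poissonMeasure_real_singleton]
  rw [integral_tsum hmeas hsum]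
  refine tsum_congr fun j => ?_
  calc ∫ ω in K ⁻¹' {j}, f ω (K ω) ∂P = ∫ ω in K ⁻¹' {j}, f ω j ∂P :=
        setIntegral_congr_fun (hK j) fun ω hω => by
          rw [Set.mem_preimage, Set.mem_singleton_iff] at hω
          simp only [hω]
    _ = ∫ ω, (poissonMeasure (Λ ω)).real {j} • f ω j ∂P := by
        rw [integral_trim h𝒢 (hf j), h.trim_restrict h𝒢, ← integral_trim h𝒢 (hf j),
          integral_withDensity_eq_integral_toReal_smul (h.measurable_density h𝒢 j)
            (ae_of_all _ fun ω => measure_lt_top _ _)]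
        rfl

end IsCondPoisson

end CondPoisson

/-! ### Kronecker's lemma -/

section Kronecker

open Finset Asymptotics

/-- Kronecker's lemma, for norming sequences given by their increments. -/
theorem isLittleO_sum_of_tendsto_sum_div {x w : ℕ → ℝ} {s : ℝ} (hw : 0 ≤ w)
    (hw' : Tendsto (fun n => ∑ i ∈ range n, w i) atTop atTop)
    (hs : Tendsto (fun n => ∑ i ∈ range n, x i / (1 + ∑ j ∈ range (i + 1), w j)) atTop (𝓝 s)) :
    (fun n => ∑ i ∈ range n, x i) =o[atTop] fun n => ∑ i ∈ range n, w i := by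
  set b : ℕ → ℝ := fun n => 1 + ∑ j ∈ range n, w j with hb
  set S : ℕ → ℝ := fun n => ∑ i ∈ range n, x i / b (i + 1) with hS
  have hbpos : ∀ n, 0 < b n := fun n => by
    have : 0 ≤ ∑ j ∈ range n, w j := sum_nonneg fun i _ => hw i
    simp only [hb]
    linarith
  -- Summation by parts, b having increments w. Centring S at its limit makes the weighted terms
  -- small; the lone s comes from b 0 = 1.
  have key : ∀ n, ∑ i ∈ range n, x i = b n * (S n - s) + s - ∑ i ∈ range n, w i * (S i - s) := by
    intro n
    induction n with
    | zero => simp [hb, hS]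
    | succ n ih =>
      have h1 : S (n + 1) = S n + x n / b (n + 1) := by simp only [hS, sum_range_succ]
      have h2 : b (n + 1) = b n + w n := by simp only [hb, sum_range_succ]; ring
      have h3 : b (n + 1) * (x n / b (n + 1)) = x n := mul_div_cancel₀ _ (hbpos _).ne'
      rw [sum_range_succ, ih, sum_range_succ, h1]
      rw [h2] at h3 ⊢
      linear_combination -h3
  have hs0 : Tendsto (fun n => S n - s) atTop (𝓝 0) := by
    simpa using hs.sub_const s
  have hone : (fun _ : ℕ => (1 : ℝ)) =o[atTop] fun n => ∑ i ∈ range n, w i := by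
    rw [isLittleO_const_left]
    exact Or.inr (tendsto_norm_atTop_atTop.comp hw')
  have hbO : b =O[atTop] fun n => ∑ i ∈ range n, w i := hone.isBigO.add (isBigO_refl _ _)
  have h1 : (fun n => b n * (S n - s)) =o[atTop] fun n => ∑ i ∈ range n, w i := by
    simpa using hbO.mul_isLittleO ((isLittleO_one_iff ℝ).2 hs0)
  have h2 : (fun _ : ℕ => s) =o[atTop] fun n => ∑ i ∈ range n, w i := by
    simpa using hone.const_mul_left s
  have h3 : (fun n => ∑ i ∈ range n, w i * (S i - s)) =o[atTop] fun n => ∑ i ∈ range n, w i := by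
    refine IsLittleO.sum_range ?_ hw hw'
    simpa using (isBigO_refl w atTop).mul_isLittleO ((isLittleO_one_iff ℝ).2 hs0)
  exact ((h1.add h2).sub h3).congr_left fun n => (key n).symm

/-- Each term is at most 1 / b n - 1 / b (n + 1), and the sum telescopes. This is the L² bound for
the martingale fed into Kronecker's lemma. -/
theorem sum_div_sq_le_one {w : ℕ → ℝ} (hw : 0 ≤ w) (n : ℕ) :
    ∑ i ∈ range n, w i * (1 / (1 + ∑ j ∈ range (i + 1), w j)) ^ 2 ≤ 1 := by
  set b : ℕ → ℝ := fun n => 1 + ∑ j ∈ range n, w j with hb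
  have hbpos : ∀ n, 0 < b n := fun n => by
    have : 0 ≤ ∑ j ∈ range n, w j := sum_nonneg fun i _ => hw i
    simp only [hb]
    linarith
  suffices h : ∑ i ∈ range n, w i * (1 / b (i + 1)) ^ 2 ≤ 1 - 1 / b n by
    exact h.trans (sub_le_self _ (one_div_pos.2 (hbpos n)).le)
  induction n with
  | zero => simp [hb]
  | succ n ih =>
    have h2 : w n = b (n + 1) - b n := by simp only [hb, sum_range_succ]; ring
    have hle : b n ≤ b (n + 1) := by linarith [hw n, h2, show (0 : ℕ → ℝ) n = 0 from rfl]
    have h3 : w n * (1 / b (n + 1)) ^ 2 ≤ 1 / b n - 1 / b (n + 1) := by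
      have e : 1 / b n - 1 / b (n + 1) - w n * (1 / b (n + 1)) ^ 2 =
          (b (n + 1) - b n) ^ 2 / (b n * b (n + 1) ^ 2) := by
        rw [h2]
        field_simp [(hbpos n).ne', (hbpos (n + 1)).ne']
      have : 0 ≤ (b (n + 1) - b n) ^ 2 / (b n * b (n + 1) ^ 2) :=
        div_nonneg (sq_nonneg _) (mul_nonneg (hbpos n).le (sq_nonneg _))
      linarith
    rw [sum_range_succ]
    linarith

end Kronecker

/-! ### A strong law for conditionally Poisson variables -/

section LawOfLargeNumbers

open Finset

variable {Ω : Type v} {mΩ : MeasurableSpace Ω} {P : Measure Ω}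
  {𝓕 : Filtration ℕ mΩ} {K : ℕ → Ω → ℕ} {Λ : ℕ → Ω → ℝ≥0} {w : ℕ → ℝ≥0}

theorem measurable_sum_mul (hK : ∀ n, Measurable[𝓕 (n + 1)] (K n))
    (h : ∀ n, IsCondPoisson (𝓕 n) P (K n) (Λ n)) (y : ℕ → ℝ) (n : ℕ) :
    Measurable[𝓕 n] fun ω => ∑ j ∈ range n, ((K j ω : ℝ) - Λ j ω) * y j := by
  refine Finset.measurable_fun_sum _ fun j hj => ?_
  have hj' : j + 1 ≤ n := Finset.mem_range.1 hj
  have h1 : Measurable[𝓕 n] (K j) := (hK j).mono (𝓕.mono hj') le_rfl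
  have h2 : Measurable[𝓕 n] (Λ j) :=
    (h j).measurable_rate.mono (𝓕.mono ((Nat.le_succ j).trans hj')) le_rfl
  exact ((measurable_from_nat.comp h1).sub h2.coe_nnreal_real).mul_const _

variable [IsProbabilityMeasure P]

/-- The martingale difference property, tested on the events A of 𝒢; the bound on the rate serves
for integrability. -/
theorem IsCondPoisson.integrable_sub {𝒢 : MeasurableSpace Ω} (h𝒢 : 𝒢 ≤ mΩ) {K : Ω → ℕ}
    {Λ : Ω → ℝ≥0} (h : IsCondPoisson 𝒢 P K Λ) {w : ℝ≥0} (hw : ∀ᵐ ω ∂P, Λ ω ≤ w) {A : Set Ω}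
    (hA : MeasurableSet[𝒢] A) :
    Integrable (A.indicator fun ω => (K ω : ℝ) - Λ ω) P ∧
      ∫ ω, A.indicator (fun ω => (K ω : ℝ) - Λ ω) ω ∂P = 0 := by
  set f : Ω → ℕ → ℝ := fun ω k => A.indicator (fun ω => (k : ℝ) - Λ ω) ω with hf
  have hfm : ∀ k, StronglyMeasurable[𝒢] fun ω => f ω k := fun k =>
    StronglyMeasurable.indicator
      (stronglyMeasurable_const.sub h.measurable_rate.coe_nnreal_real.stronglyMeasurable) hA
  have hfin : ∫⁻ ω, ∫⁻ k, ‖f ω k‖ₑ ∂(poissonMeasure (Λ ω)) ∂P ≠ ∞ := by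
    refine ne_top_of_le_ne_top (b := ∫⁻ _, 2 * (w : ℝ≥0∞) ∂P)
      (by simp [ENNReal.mul_eq_top]) (lintegral_mono_ae ?_)
    filter_upwards [hw] with ω hω
    calc ∫⁻ k, ‖f ω k‖ₑ ∂(poissonMeasure (Λ ω))
        ≤ ∫⁻ k, ‖(k : ℝ) - Λ ω‖ₑ ∂(poissonMeasure (Λ ω)) := by
          refine lintegral_mono fun k => ?_
          by_cases hωA : ω ∈ A <;> simp [hf, hωA]
      _ ≤ 2 * Λ ω := lintegral_enorm_sub_poissonMeasure_le _
      _ ≤ 2 * w := by gcongr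
  refine ⟨h.integrable_comp h𝒢 hfm hfin, (h.integral_eq h𝒢 hfm hfin).trans ?_⟩
  refine integral_eq_zero_of_ae (ae_of_all _ fun ω => ?_)
  by_cases hωA : ω ∈ A
  · simpa [hf, hωA] using integral_sub_poissonMeasure (Λ ω)
  · simp [hf, hωA]

theorem martingale_sum_mul (hK : ∀ n, Measurable[𝓕 (n + 1)] (K n))
    (h : ∀ n, IsCondPoisson (𝓕 n) P (K n) (Λ n)) (hw : ∀ n, ∀ᵐ ω ∂P, Λ n ω ≤ w n)
    (y : ℕ → ℝ) :
    Martingale (fun n ω => ∑ j ∈ range n, ((K j ω : ℝ) - Λ j ω) * y j) 𝓕 P := by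
  have hint : ∀ j, Integrable (fun ω => ((K j ω : ℝ) - Λ j ω) * y j) P := fun j => by
    have := ((h j).integrable_sub (𝓕.le j) (hw j) MeasurableSet.univ).1
    rw [Set.indicator_univ] at this
    exact this.mul_const _
  refine martingale_of_setIntegral_eq_succ
    (fun n => (measurable_sum_mul hK h y n).stronglyMeasurable)
    (fun n => integrable_finsetSum _ fun j _ => hint j) fun n A hA => ?_
  simp only [sum_range_succ]
  rw [integral_add (integrable_finsetSum _ fun j _ => hint j).integrableOn (hint n).integrableOn,
    integral_mul_const, ← integral_indicator (𝓕.le n A hA),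
    ← integral_indicator (𝓕.le n A hA), ((h n).integrable_sub (𝓕.le n) (hw n) hA).2, zero_mul,
    add_zero]

/-- Orthogonality of increments: conditioning the last one on the past adds its conditional variance
and no cross term. Lower integrals avoid any prior square integrability. -/
theorem lintegral_sum_mul_sq_le (hK : ∀ n, Measurable[𝓕 (n + 1)] (K n))
    (h : ∀ n, IsCondPoisson (𝓕 n) P (K n) (Λ n)) (hw : ∀ n, ∀ᵐ ω ∂P, Λ n ω ≤ w n)
    (y : ℕ → ℝ) (n : ℕ) :
    ∫⁻ ω, ENNReal.ofReal ((∑ j ∈ range n, ((K j ω : ℝ) - Λ j ω) * y j) ^ 2) ∂P ≤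
      ENNReal.ofReal (∑ j ∈ range n, w j * y j ^ 2) := by
  induction n with
  | zero => simp
  | succ n ih =>
    have hm := measurable_sum_mul hK h y n
    simp only [sum_range_succ]
    rw [(h n).lintegral_eq (𝓕.le n) (f := fun ω k => ENNReal.ofReal
      ((∑ j ∈ range n, ((K j ω : ℝ) - Λ j ω) * y j + ((k : ℝ) - Λ n ω) * y n) ^ 2)) fun k =>
        (((hm.add ((measurable_const.sub (h n).measurable_rate.coe_nnreal_real).mul_const _)).pow_const
          2).ennreal_ofReal)]
    simp only [lintegral_poissonMeasure_quadratic]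
    rw [ENNReal.ofReal_add (sum_nonneg fun j _ => by positivity) (by positivity)]
    calc _ ≤ ∫⁻ ω, (ENNReal.ofReal ((∑ j ∈ range n, ((K j ω : ℝ) - Λ j ω) * y j) ^ 2) +
          ENNReal.ofReal (w n * y n ^ 2)) ∂P := by
          refine lintegral_mono_ae ?_
          filter_upwards [hw n] with ω hω
          rw [ENNReal.ofReal_add (sq_nonneg _) (by positivity)]
          gcongr
      _ ≤ _ := by
          rw [lintegral_add_right _ measurable_const, lintegral_const, measure_univ, mul_one]
          gcongr

/-- Bounded in L², hence in L¹, so Doob's convergence theorem applies. -/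
theorem ae_exists_tendsto_sum_mul (hK : ∀ n, Measurable[𝓕 (n + 1)] (K n))
    (h : ∀ n, IsCondPoisson (𝓕 n) P (K n) (Λ n)) (hw : ∀ n, ∀ᵐ ω ∂P, Λ n ω ≤ w n)
    (y : ℕ → ℝ) (hy : ∀ n, ∑ j ∈ range n, w j * y j ^ 2 ≤ 1) :
    ∀ᵐ ω ∂P, ∃ s, Tendsto (fun n => ∑ j ∈ range n, ((K j ω : ℝ) - Λ j ω) * y j) atTop (𝓝 s) := by
  have hM := martingale_sum_mul hK h hw y
  have hb : ∀ n, eLpNorm (fun ω => ∑ j ∈ range n, ((K j ω : ℝ) - Λ j ω) * y j) 1 P ≤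
      (1 : ℝ≥0) := fun n => by
    have hms : AEStronglyMeasurable (fun ω => ∑ j ∈ range n, ((K j ω : ℝ) - Λ j ω) * y j) P :=
      ((measurable_sum_mul hK h y n).mono (𝓕.le n) le_rfl).aestronglyMeasurable
    refine (eLpNorm_le_eLpNorm_of_exponent_le one_le_two hms).trans ?_
    have h2 := (lintegral_sum_mul_sq_le hK h hw y n).trans (ENNReal.ofReal_le_ofReal (hy n))
    rw [eLpNorm_eq_lintegral_rpow_enorm_toReal two_ne_zero ENNReal.ofNat_ne_top]
    refine (ENNReal.rpow_le_rpow (z := 1 / (2 : ℝ≥0∞).toReal) (le_trans (le_of_eq ?_) h2)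
      (by positivity)).trans (by simp)
    refine lintegral_congr fun ω => ?_
    rw [← sq_abs, ENNReal.ofReal_pow (abs_nonneg _), ← Real.enorm_eq_ofReal_abs]
    simp
  filter_upwards [hM.submartingale.ae_tendsto_limitProcess hb] with ω hω using ⟨_, hω⟩

/-- The strong law of large numbers for conditionally Poisson variables. -/
theorem ae_isLittleO_sum_sub (hK : ∀ n, Measurable[𝓕 (n + 1)] (K n))
    (h : ∀ n, IsCondPoisson (𝓕 n) P (K n) (Λ n)) (hw : ∀ n, ∀ᵐ ω ∂P, Λ n ω ≤ w n)
    (hw' : Tendsto (fun n => ∑ i ∈ range n, (w i : ℝ)) atTop atTop) :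
    ∀ᵐ ω ∂P, (fun n => ∑ j ∈ range n, ((K j ω : ℝ) - Λ j ω)) =o[atTop]
      fun n => ∑ j ∈ range n, (w j : ℝ) := by
  filter_upwards [ae_exists_tendsto_sum_mul hK h hw
    (fun i => 1 / (1 + ∑ j ∈ range (i + 1), (w j : ℝ)))
    (sum_div_sq_le_one fun i => (w i).coe_nonneg)] with ω ⟨s, hs⟩
  refine isLittleO_sum_of_tendsto_sum_div (fun i => (w i).coe_nonneg) hw' (s := s) ?_
  simpa only [mul_one_div] using hs

end LawOfLargeNumbers

/-! ### The exponential martingale -/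

section ExponentialMartingale

open Finset Complex

variable {Ω : Type v} {mΩ : MeasurableSpace Ω} {P : Measure Ω}
  {𝓕 : Filtration ℕ mΩ} {K : ℕ → Ω → ℕ} {Λ : ℕ → Ω → ℝ≥0} {w : ℕ → ℝ≥0}

/-- The exponential martingale of a sequence of conditionally Poisson variables. -/
noncomputable def poissonExp (K : ℕ → Ω → ℕ) (Λ : ℕ → Ω → ℝ≥0) (s : ℝ) (n : ℕ) (ω : Ω) : ℂ :=
  cexp (∑ j ∈ range n, (s * (K j ω : ℝ) * I - ((Λ j ω : ℝ) : ℂ) * (cexp (s * I) - 1)))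

theorem poissonExp_succ (s : ℝ) (n : ℕ) (ω : Ω) :
    poissonExp K Λ s (n + 1) ω = poissonExp K Λ s n ω *
      cexp (s * (K n ω : ℝ) * I - ((Λ n ω : ℝ) : ℂ) * (cexp (s * I) - 1)) := by
  rw [poissonExp, sum_range_succ, Complex.exp_add, poissonExp]

theorem norm_cexp_step (s x l : ℝ) :
    ‖cexp (s * (x : ℝ) * I - (l : ℂ) * (cexp (s * I) - 1))‖ = Real.exp (l * (1 - Real.cos s)) := by
  rw [Complex.norm_exp, Complex.exp_mul_I, ← Complex.ofReal_cos, ← Complex.ofReal_sin]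
  congr 1
  simp [Complex.cos_ofReal_re]
  ring

theorem norm_poissonExp (s : ℝ) (n : ℕ) (ω : Ω) :
    ‖poissonExp K Λ s n ω‖ = Real.exp ((∑ j ∈ range n, (Λ j ω : ℝ)) * (1 - Real.cos s)) := by
  induction n with
  | zero => simp [poissonExp]
  | succ n ih => rw [poissonExp_succ, norm_mul, ih, norm_cexp_step, ← Real.exp_add, sum_range_succ,
      add_mul]

theorem sum_rate_le (hw : ∀ n, ∀ᵐ ω ∂P, Λ n ω ≤ w n) :
    ∀ᵐ ω ∂P, ∀ n, ∑ j ∈ range n, (Λ j ω : ℝ) ≤ ∑ j ∈ range n, (w j : ℝ) := by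
  filter_upwards [ae_all_iff.2 hw] with ω hω n
  exact sum_le_sum fun j _ => by exact_mod_cast hω j

theorem norm_poissonExp_le (hw : ∀ n, ∀ᵐ ω ∂P, Λ n ω ≤ w n) :
    ∀ᵐ ω ∂P, ∀ n (s : ℝ), ‖poissonExp K Λ s n ω‖ ≤ Real.exp ((∑ j ∈ range n, (w j : ℝ)) * 2) := by
  filter_upwards [sum_rate_le hw] with ω hω n s
  rw [norm_poissonExp]
  refine Real.exp_le_exp.2 (mul_le_mul (hω n) (by linarith [Real.neg_one_le_cos s])
    (by linarith [Real.cos_le_one s]) (sum_nonneg fun j _ => (w j).coe_nonneg))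

theorem measurable_poissonExp (hK : ∀ n, Measurable[𝓕 (n + 1)] (K n))
    (h : ∀ n, IsCondPoisson (𝓕 n) P (K n) (Λ n)) (s : ℝ) (n : ℕ) :
    Measurable[𝓕 n] (poissonExp K Λ s n) := by
  refine Complex.measurable_exp.comp (Finset.measurable_fun_sum _ fun j hj => ?_)
  have hj' : j + 1 ≤ n := Finset.mem_range.1 hj
  have h1 : Measurable[𝓕 n] (K j) := (hK j).mono (𝓕.mono hj') le_rfl
  have h2 : Measurable[𝓕 n] (Λ j) :=
    (h j).measurable_rate.mono (𝓕.mono ((Nat.le_succ j).trans hj')) le_rfl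
  have h3 : Measurable[𝓕 n] fun ω => ((K j ω : ℝ) : ℂ) :=
    Complex.measurable_ofReal.comp (measurable_from_nat.comp h1)
  have h4 : Measurable[𝓕 n] fun ω => ((Λ j ω : ℝ) : ℂ) :=
    Complex.measurable_ofReal.comp h2.coe_nnreal_real
  exact ((h3.const_mul _).mul_const _).sub (h4.mul_const _)

/-- Each factor of `poissonExp` has conditional mean one, so the last one can be removed as long as
Z is known to the past. -/
theorem integral_mul_poissonExp (hK : ∀ n, Measurable[𝓕 (n + 1)] (K n))
    (h : ∀ n, IsCondPoisson (𝓕 n) P (K n) (Λ n)) (hw : ∀ n, ∀ᵐ ω ∂P, Λ n ω ≤ w n) (s : ℝ)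
    {k n : ℕ} (hkn : k ≤ n) {Z : Ω → ℝ} (hZ : StronglyMeasurable[𝓕 k] Z) (hZi : Integrable Z P) :
    ∫ ω, (Z ω : ℂ) * poissonExp K Λ s n ω ∂P = ∫ ω, (Z ω : ℂ) * poissonExp K Λ s k ω ∂P := by
  induction n, hkn using Nat.le_induction with
  | base => rfl
  | succ n hkn ih =>
    rw [← ih]
    set f : Ω → ℕ → ℂ := fun ω i => (Z ω : ℂ) * (poissonExp K Λ s n ω *
      cexp (s * (i : ℝ) * I - ((Λ n ω : ℝ) : ℂ) * (cexp (s * I) - 1))) with hf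
    have hfm : ∀ i, StronglyMeasurable[𝓕 n] fun ω => f ω i := fun i => by
      have h4 : Measurable[𝓕 n] fun ω => ((Λ n ω : ℝ) : ℂ) :=
        Complex.measurable_ofReal.comp (h n).measurable_rate.coe_nnreal_real
      exact (((Complex.measurable_ofReal.comp (hZ.measurable.mono (𝓕.mono hkn) le_rfl))).mul
        ((measurable_poissonExp hK h s n).mul (Complex.measurable_exp.comp
          (measurable_const.sub (h4.mul_const _))))).stronglyMeasurable
    have hfin : ∫⁻ ω, ∫⁻ i, ‖f ω i‖ₑ ∂(poissonMeasure (Λ n ω)) ∂P ≠ ∞ := by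
      -- All moduli are exponentials of rate sums times 1 - cos s ≤ 2, whence a non-random bound.
      set C := Real.exp ((∑ j ∈ range (n + 1), (w j : ℝ)) * 2) with hC
      refine ne_top_of_le_ne_top (b := ∫⁻ ω, ‖Z ω‖ₑ * ENNReal.ofReal C ∂P) ?_
        (lintegral_mono_ae ?_)
      · rw [lintegral_mul_const' _ _ ENNReal.ofReal_ne_top]
        exact ENNReal.mul_ne_top hZi.2.ne ENNReal.ofReal_ne_top
      · filter_upwards [sum_rate_le hw] with ω hω
        calc ∫⁻ i, ‖f ω i‖ₑ ∂(poissonMeasure (Λ n ω))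
            ≤ ∫⁻ i, ‖Z ω‖ₑ * ENNReal.ofReal C ∂(poissonMeasure (Λ n ω)) := by
              refine lintegral_mono fun i => ?_
              simp only [hf]
              rw [enorm_mul, ← ofReal_norm (_ * cexp _), norm_mul, norm_poissonExp, norm_cexp_step,
                ← Real.exp_add, ← add_mul, ← sum_range_succ fun j => (Λ j ω : ℝ)]
              have e1 : ‖(Z ω : ℂ)‖ₑ = ‖Z ω‖ₑ := by
                rw [← ofReal_norm, ← ofReal_norm, Complex.norm_real]
              rw [e1]
              gcongr
              refine Real.exp_le_exp.2 (mul_le_mul (hω _) (by linarith [Real.neg_one_le_cos s])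
                (by linarith [Real.cos_le_one s]) (sum_nonneg fun j _ => (w j).coe_nonneg))
          _ = ‖Z ω‖ₑ * ENNReal.ofReal C := by simp
    have key := (h n).integral_eq (𝓕.le n) hfm hfin
    simp only [poissonExp_succ]
    refine key.trans (integral_congr_ae (ae_of_all _ fun ω => ?_))
    simp only [hf]
    rw [integral_const_mul, integral_const_mul]
    congr 1
    have e : ∀ i : ℕ, cexp (s * (i : ℝ) * I - ((Λ n ω : ℝ) : ℂ) * (cexp (s * I) - 1)) =
        cexp (s * (i : ℝ) * I) * cexp (-(((Λ n ω : ℝ) : ℂ) * (cexp (s * I) - 1))) := fun i => by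
      rw [← Complex.exp_add, sub_eq_add_neg]
    simp only [e]
    rw [integral_mul_const, integral_cexp_poissonMeasure, ← Complex.exp_add]
    simp

/-- The parameter varies with n, so there is no single martingale. But for each n the integral can
be taken back to the fixed time k, where `poissonExp` tends to 1 as s n tends to 0. -/
theorem tendsto_integral_mul_poissonExp (hK : ∀ n, Measurable[𝓕 (n + 1)] (K n))
    (h : ∀ n, IsCondPoisson (𝓕 n) P (K n) (Λ n)) (hw : ∀ n, ∀ᵐ ω ∂P, Λ n ω ≤ w n) {s : ℕ → ℝ}
    (hs : Tendsto s atTop (𝓝 0)) (k : ℕ) {Z : Ω → ℝ} (hZ : StronglyMeasurable[𝓕 k] Z)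
    (hZi : Integrable Z P) :
    Tendsto (fun n => ∫ ω, (Z ω : ℂ) * poissonExp K Λ (s n) n ω ∂P) atTop
      (𝓝 ((∫ ω, Z ω ∂P : ℝ) : ℂ)) := by
  have h1 : Tendsto (fun n => ∫ ω, (Z ω : ℂ) * poissonExp K Λ (s n) k ω ∂P) atTop
      (𝓝 (∫ ω, (Z ω : ℂ) ∂P)) := by
    refine tendsto_integral_of_dominated_convergence
      (fun ω => ‖Z ω‖ * Real.exp ((∑ j ∈ range k, (w j : ℝ)) * 2)) (fun n => ?_)
      (hZi.norm.mul_const _) (fun n => ?_) (ae_of_all _ fun ω => ?_)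
    · exact (Complex.measurable_ofReal.comp_aemeasurable hZi.aemeasurable).aestronglyMeasurable.mul
        ((measurable_poissonExp hK h (s n) k).mono (𝓕.le k) le_rfl).aestronglyMeasurable
    · filter_upwards [norm_poissonExp_le (K := K) hw] with ω hω
      rw [norm_mul, Complex.norm_real]
      gcongr
      exact hω k (s n)
    · have hc : Continuous fun s : ℝ => (Z ω : ℂ) * poissonExp K Λ s k ω := by
        unfold poissonExp
        fun_prop
      have := (hc.tendsto 0).comp hs
      simpa [poissonExp, Function.comp_def] using this
  rw [integral_complex_ofReal] at h1
  refine h1.congr' ?_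
  filter_upwards [eventually_ge_atTop k] with n hn
  exact (integral_mul_poissonExp hK h hw (s n) hn hZ hZi).symm

end ExponentialMartingale

/-! ### A stable central limit theorem for conditionally Poisson variables -/

section StableConvergence

open Finset Complex

/-- Second order Taylor expansion: with s = t / √a one has a s² = t², so the quadratic term is the
limit and the remainder is at most a |s|³ e^{|s|} = t² |s| e^{|s|}. -/
theorem tendsto_mul_cexp_sub {a : ℕ → ℝ} (ha : Tendsto a atTop atTop) (t : ℝ) :
    Tendsto (fun n => (a n : ℂ) * (cexp ((t / √(a n) : ℝ) * I) - 1 - (t / √(a n) : ℝ) * I)) atTop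
      (𝓝 (-(t ^ 2 / 2 : ℝ))) := by
  set s : ℕ → ℝ := fun n => t / √(a n) with hs
  have hs0 : Tendsto s atTop (𝓝 0) :=
    tendsto_const_nhds.div_atTop (Real.tendsto_sqrt_atTop.comp ha)
  have hsq : ∀ᶠ n in atTop, a n * s n ^ 2 = t ^ 2 := by
    filter_upwards [ha.eventually_gt_atTop 0] with n hn
    simp only [hs]
    rw [div_pow, Real.sq_sqrt hn.le]
    field_simp
  rw [tendsto_iff_norm_sub_tendsto_zero]
  have hb : Tendsto (fun n => t ^ 2 * |s n| * Real.exp |s n|) atTop (𝓝 0) := by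
    have hc : Continuous fun x : ℝ => t ^ 2 * |x| * Real.exp |x| := by fun_prop
    simpa [Function.comp_def] using (hc.tendsto 0).comp hs0
  refine squeeze_zero' (Eventually.of_forall fun n => norm_nonneg _) ?_ hb
  filter_upwards [hsq, ha.eventually_gt_atTop 0] with n hn hpos
  have h3 := norm_exp_sub_sum_le_norm_mul_exp ((s n : ℂ) * I) 3
  have hnorm : ‖(s n : ℂ) * I‖ = |s n| := by simp
  have e : (a n : ℂ) * (cexp (s n * I) - 1 - s n * I) - -(t ^ 2 / 2 : ℝ) =
      (a n : ℂ) * (cexp (s n * I) - ∑ m ∈ range 3, ((s n : ℂ) * I) ^ m / (m ! : ℂ)) := by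
    rw [← hn]
    simp only [sum_range_succ, sum_range_zero, Nat.factorial, mul_pow, I_sq]
    push_cast
    ring
  rw [e, norm_mul, Complex.norm_real, Real.norm_of_nonneg hpos.le]
  rw [hnorm] at h3
  calc a n * ‖cexp (s n * I) - ∑ m ∈ range 3, ((s n : ℂ) * I) ^ m / (m ! : ℂ)‖
      ≤ a n * (|s n| ^ 3 * Real.exp |s n|) := by gcongr
    _ = (a n * s n ^ 2) * |s n| * Real.exp |s n| := by rw [← sq_abs (s n)]; ring
    _ = t ^ 2 * |s n| * Real.exp |s n| := by rw [hn]

variable {Ω : Type v} {mΩ : MeasurableSpace Ω} {P : Measure Ω}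
  {𝓕 : Filtration ℕ mΩ} {K : ℕ → Ω → ℕ} {Λ : ℕ → Ω → ℝ≥0} {w : ℕ → ℝ≥0}

theorem measurable_sum_sub (hK : ∀ n, Measurable[𝓕 (n + 1)] (K n))
    (h : ∀ n, IsCondPoisson (𝓕 n) P (K n) (Λ n)) (n : ℕ) :
    Measurable[𝓕 n] fun ω => ∑ j ∈ range n, ((K j ω : ℝ) - Λ j ω) := by
  simpa using measurable_sum_mul hK h (fun _ => 1) n

theorem measurable_cexp_sum_sub (hK : ∀ n, Measurable[𝓕 (n + 1)] (K n))
    (h : ∀ n, IsCondPoisson (𝓕 n) P (K n) (Λ n)) (s : ℝ) (n : ℕ) :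
    Measurable[𝓕 n] fun ω => cexp ((s * ∑ j ∈ range n, ((K j ω : ℝ) - Λ j ω) : ℝ) * I) :=
  Complex.measurable_exp.comp ((Complex.measurable_ofReal.comp
    ((measurable_sum_sub hK h n).const_mul s)).mul_const I)

/-- `poissonExp` is ψ c, where ψ is the oscillating factor sought and c depends on the rates only.
Since c is bounded and converges to a non-random constant, that constant may replace it inside the
integral, and division by it leaves ψ. -/
theorem tendsto_integral_mul_cexp (hK : ∀ n, Measurable[𝓕 (n + 1)] (K n))
    (h : ∀ n, IsCondPoisson (𝓕 n) P (K n) (Λ n)) (hw : ∀ n, ∀ᵐ ω ∂P, Λ n ω ≤ w n) {a : ℕ → ℝ}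
    (ha : Tendsto a atTop atTop) {C : ℝ} (hC : ∀ᶠ n in atTop, ∑ j ∈ range n, (w j : ℝ) ≤ C * a n)
    {l : ℝ} (hl : ∀ᵐ ω ∂P, Tendsto (fun n => (∑ j ∈ range n, (Λ j ω : ℝ)) / a n) atTop (𝓝 l))
    (t : ℝ) (k : ℕ) {Z : Ω → ℝ} (hZ : StronglyMeasurable[𝓕 k] Z) (hZi : Integrable Z P) :
    Tendsto (fun n => ∫ ω, (Z ω : ℂ) *
        cexp ((t / √(a n) * ∑ j ∈ range n, ((K j ω : ℝ) - Λ j ω) : ℝ) * I) ∂P) atTop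
      (𝓝 ((∫ ω, Z ω ∂P : ℝ) * cexp (-(l * t ^ 2 / 2 : ℝ)))) := by
  set s : ℕ → ℝ := fun n => t / √(a n) with hs
  set ψ : ℕ → Ω → ℂ := fun n ω => cexp ((s n * ∑ j ∈ range n, ((K j ω : ℝ) - Λ j ω) : ℝ) * I)
    with hψ
  set c : ℕ → Ω → ℂ := fun n ω =>
    cexp (-((∑ j ∈ range n, (Λ j ω : ℝ) : ℝ) * (cexp (s n * I) - 1 - s n * I))) with hc
  have hs0 : Tendsto s atTop (𝓝 0) :=
    tendsto_const_nhds.div_atTop (Real.tendsto_sqrt_atTop.comp ha)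
  have hprod : ∀ n ω, poissonExp K Λ (s n) n ω = ψ n ω * c n ω := fun n ω => by
    simp only [hψ, hc, poissonExp]
    rw [← Complex.exp_add]
    congr 1
    push_cast
    rw [mul_sum, sum_mul, sum_mul, ← sum_neg_distrib, ← sum_add_distrib]
    exact sum_congr rfl fun j _ => by ring
  have hψn : ∀ n ω, ‖ψ n ω‖ = 1 := fun n ω => Complex.norm_exp_ofReal_mul_I _
  have hψm : ∀ n, Measurable (ψ n) := fun n =>
    (measurable_cexp_sum_sub hK h (s n) n).mono (𝓕.le n) le_rfl
  have hcm : ∀ n, Measurable (c n) := fun n => by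
    refine Complex.measurable_exp.comp (Measurable.neg ((Complex.measurable_ofReal.comp
      (Finset.measurable_fun_sum _ fun j _ => ?_)).mul_const _))
    exact ((h j).measurable_rate.mono (𝓕.le j) le_rfl).coe_nnreal_real
  -- As ψ has modulus one, c has the modulus of `poissonExp`; then 1 - cos s ≤ s² / 2 and a n * s n
  -- ^ 2 = t ^ 2.
  have hcn : ∀ᶠ n in atTop, ∀ᵐ ω ∂P, ‖c n ω‖ ≤ Real.exp (C * t ^ 2 / 2) := by
    filter_upwards [hC, ha.eventually_gt_atTop 0] with n hn hpos
    filter_upwards [sum_rate_le hw] with ω hω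
    have e : ‖c n ω‖ = ‖poissonExp K Λ (s n) n ω‖ := by rw [hprod, norm_mul, hψn, one_mul]
    rw [e, norm_poissonExp]
    refine Real.exp_le_exp.2 ?_
    have hθ : 0 ≤ ∑ j ∈ range n, (Λ j ω : ℝ) := sum_nonneg fun j _ => (Λ j ω).coe_nonneg
    calc (∑ j ∈ range n, (Λ j ω : ℝ)) * (1 - Real.cos (s n))
        ≤ (C * a n) * (s n ^ 2 / 2) :=
          mul_le_mul ((hω n).trans hn) (by linarith [Real.one_sub_sq_div_two_le_cos (x := s n)])
            (by linarith [Real.cos_le_one (s n)]) ((hθ.trans (hω n)).trans hn)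
      _ = C * t ^ 2 / 2 := by
          simp only [hs]
          rw [div_pow, Real.sq_sqrt hpos.le]
          field_simp
  have hclim : ∀ᵐ ω ∂P, Tendsto (fun n => c n ω) atTop (𝓝 (cexp (l * t ^ 2 / 2 : ℝ))) := by
    filter_upwards [hl] with ω hω
    have h1 := ((Complex.continuous_ofReal.tendsto l).comp hω).mul (tendsto_mul_cexp_sub ha t)
    have h2 : Tendsto (fun n => ((∑ j ∈ range n, (Λ j ω : ℝ) : ℝ) : ℂ) *
        (cexp (s n * I) - 1 - s n * I)) atTop (𝓝 ((l : ℂ) * (-(t ^ 2 / 2 : ℝ)))) := by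
      refine h1.congr' ?_
      filter_upwards [ha.eventually_gt_atTop 0] with n hpos
      have : (a n : ℂ) ≠ 0 := by exact_mod_cast hpos.ne'
      simp only [Function.comp, hs]
      push_cast
      field_simp
    have h3 := (Complex.continuous_exp.tendsto _).comp h2.neg
    refine h3.trans (le_of_eq ?_)
    congr 2
    push_cast
    ring
  have hZm : AEStronglyMeasurable (fun ω => (Z ω : ℂ)) P :=
    (Complex.measurable_ofReal.comp_aemeasurable hZi.aemeasurable).aestronglyMeasurable
  have hdiff : Tendsto (fun n => ∫ ω, (Z ω : ℂ) * ψ n ω * (c n ω - cexp (l * t ^ 2 / 2 : ℝ)) ∂P)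
      atTop (𝓝 0) := by
    rw [← integral_zero Ω ℂ (μ := P)]
    refine tendsto_integral_filter_of_dominated_convergence
      (fun ω => ‖Z ω‖ * (Real.exp (C * t ^ 2 / 2) + ‖cexp (l * t ^ 2 / 2 : ℝ)‖))
      (Eventually.of_forall fun n => ?_) ?_ (hZi.norm.mul_const _) ?_
    · exact (hZm.mul (hψm n).aestronglyMeasurable).mul
        ((hcm n).sub_const _).aestronglyMeasurable
    · filter_upwards [hcn] with n hn
      filter_upwards [hn] with ω hω
      rw [norm_mul, norm_mul, hψn, mul_one, Complex.norm_real]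
      gcongr
      exact (norm_sub_le _ _).trans (by gcongr)
    · filter_upwards [hclim] with ω hω
      rw [tendsto_zero_iff_norm_tendsto_zero]
      have h4 : Tendsto (fun n => ‖Z ω‖ * ‖c n ω - cexp (l * t ^ 2 / 2 : ℝ)‖) atTop (𝓝 0) := by
        have := (tendsto_iff_norm_sub_tendsto_zero.1 hω).const_mul ‖Z ω‖
        simpa using this
      refine h4.congr fun n => ?_
      rw [norm_mul, norm_mul, hψn, mul_one, Complex.norm_real]
  have hmain := (tendsto_integral_mul_poissonExp hK h hw hs0 k hZ hZi).sub hdiff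
  have hmain2 := hmain.mul_const (cexp (-(l * t ^ 2 / 2 : ℝ)))
  rw [sub_zero] at hmain2
  refine hmain2.congr' ?_
  filter_upwards [hcn] with n hn
  have hi1 : Integrable (fun ω => (Z ω : ℂ) * ψ n ω) P := by
    refine (hZi.ofReal (𝕜 := ℂ)).mono (hZm.mul (hψm n).aestronglyMeasurable) (ae_of_all _ fun ω => ?_)
    rw [norm_mul, hψn, mul_one]
    rfl
  have hi2 : Integrable (fun ω => (Z ω : ℂ) * ψ n ω * c n ω) P :=
    hi1.mul_bdd (c := Real.exp (C * t ^ 2 / 2)) (hcm n).aestronglyMeasurable hn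
  have e1 : ∫ ω, (Z ω : ℂ) * ψ n ω * (c n ω - cexp (l * t ^ 2 / 2 : ℝ)) ∂P =
      ∫ ω, (Z ω : ℂ) * poissonExp K Λ (s n) n ω ∂P -
        (∫ ω, (Z ω : ℂ) * ψ n ω ∂P) * cexp (l * t ^ 2 / 2 : ℝ) := by
    rw [← integral_mul_const, ← integral_sub _ (hi1.mul_const _)]
    · refine integral_congr_ae (ae_of_all _ fun ω => ?_)
      simp only [hprod]
      ring
    · simpa only [hprod, mul_assoc] using hi2
  rw [e1, sub_sub_cancel, mul_assoc, ← Complex.exp_add, add_neg_cancel, Complex.exp_zero, mul_one]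

variable [IsProbabilityMeasure P]

/-- The oscillating factor is measurable for the limit σ-field of the filtration, so the indicator
of H may be replaced by its conditional expectation there. By Lévy's upward theorem this is close in
L¹ to the conditional expectation given some 𝓕 k, to which the preceding result applies, uniformly
in n because the factor has modulus one. -/
theorem tendsto_setIntegral_cexp (hK : ∀ n, Measurable[𝓕 (n + 1)] (K n))
    (h : ∀ n, IsCondPoisson (𝓕 n) P (K n) (Λ n)) (hw : ∀ n, ∀ᵐ ω ∂P, Λ n ω ≤ w n) {a : ℕ → ℝ}
    (ha : Tendsto a atTop atTop) {C : ℝ} (hC : ∀ᶠ n in atTop, ∑ j ∈ range n, (w j : ℝ) ≤ C * a n)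
    {l : ℝ} (hl : ∀ᵐ ω ∂P, Tendsto (fun n => (∑ j ∈ range n, (Λ j ω : ℝ)) / a n) atTop (𝓝 l))
    (t : ℝ) {H : Set Ω} (hH : MeasurableSet H) :
    Tendsto (fun n => ∫ ω in H,
        cexp ((t / √(a n) * ∑ j ∈ range n, ((K j ω : ℝ) - Λ j ω) : ℝ) * I) ∂P) atTop
      (𝓝 ((P.real H : ℝ) * cexp (-(l * t ^ 2 / 2 : ℝ)))) := by
  set ψ : ℕ → Ω → ℂ := fun n ω =>
    cexp ((t / √(a n) * ∑ j ∈ range n, ((K j ω : ℝ) - Λ j ω) : ℝ) * I) with hψ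
  have hψn : ∀ n ω, ‖ψ n ω‖ = 1 := fun n ω => Complex.norm_exp_ofReal_mul_I _
  set χ : Ω → ℝ := H.indicator fun _ => 1 with hχ
  have hχi : Integrable χ P := (integrable_const 1).indicator hH
  set g : Ω → ℝ := P[χ | ⨆ n, 𝓕 n] with hg
  have hle : ⨆ n, 𝓕 n ≤ mΩ := iSup_le 𝓕.le
  have hψm : ∀ n, Measurable (ψ n) := fun n =>
    (measurable_cexp_sum_sub hK h _ n).mono (𝓕.le n) le_rfl
  have hint : ∀ (f : Ω → ℝ), Integrable f P → ∀ n, Integrable (f • ψ n) P := fun f hf n =>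
    hf.smul_bdd 1 (hψm n).aestronglyMeasurable (ae_of_all _ fun ω => (hψn n ω).le)
  have h1 : ∀ n, ∫ ω in H, ψ n ω ∂P = ∫ ω, (g • ψ n) ω ∂P := fun n => by
    have hψm' : AEStronglyMeasurable[⨆ n, 𝓕 n] (ψ n) P :=
      ((measurable_cexp_sum_sub hK h _ n).mono (le_iSup 𝓕 n)
        le_rfl).stronglyMeasurable.aestronglyMeasurable
    rw [← integral_congr_ae (condExp_smul_of_aestronglyMeasurable_right hχi (hint χ hχi n) hψm'),
      integral_condExp hle, ← integral_indicator hH]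
    refine integral_congr_ae (ae_of_all _ fun ω => ?_)
    by_cases hω : ω ∈ H <;> simp [hχ, hω]
  rw [Metric.tendsto_atTop]
  intro ε hε
  obtain ⟨k, hk⟩ : ∃ k, ∫ ω, ‖(P[χ | 𝓕 k] - g) ω‖ ∂P < ε / 2 := by
    have h2 := (ENNReal.tendsto_toReal ENNReal.zero_ne_top).comp
      (tendsto_eLpNorm_condExp (ℱ := 𝓕) (μ := P) χ)
    have h3 := (h2.eventually_lt_const (show (0 : ℝ≥0∞).toReal < ε / 2 by simpa using half_pos hε))
    obtain ⟨k, hk⟩ := h3.exists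
    refine ⟨k, lt_of_le_of_lt (le_of_eq ?_) hk⟩
    have hi : Integrable (P[χ | 𝓕 k] - g) P := integrable_condExp.sub integrable_condExp
    rw [integral_norm_eq_lintegral_enorm hi.aestronglyMeasurable, Function.comp,
      eLpNorm_one_eq_lintegral_enorm]
  have hlim := tendsto_integral_mul_cexp hK h hw ha hC hl t k
    (stronglyMeasurable_condExp (f := χ) (μ := P)) integrable_condExp
  rw [integral_condExp (𝓕.le k), hχ, integral_indicator_const _ hH, smul_eq_mul, mul_one,
    Metric.tendsto_atTop] at hlim
  obtain ⟨N, hN⟩ := hlim (ε / 2) (half_pos hε)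
  refine ⟨N, fun n hn => ?_⟩
  have hN' := hN n hn
  rw [dist_eq_norm] at hN' ⊢
  have h5 : ‖∫ ω in H, ψ n ω ∂P - ∫ ω, ((P[χ | 𝓕 k] ω : ℝ) : ℂ) * ψ n ω ∂P‖ ≤
      ∫ ω, ‖(P[χ | 𝓕 k] - g) ω‖ ∂P := by
    rw [h1 n, norm_sub_rev]
    have e : ∫ ω, ((P[χ | 𝓕 k] ω : ℝ) : ℂ) * ψ n ω ∂P = ∫ ω, (P[χ | 𝓕 k] • ψ n) ω ∂P := rfl
    rw [e, ← integral_sub (hint _ integrable_condExp n) (hint _ integrable_condExp n)]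
    refine (norm_integral_le_integral_norm _).trans (le_of_eq (integral_congr_ae
      (ae_of_all _ fun ω => ?_)))
    simp only [Pi.smul_apply', Pi.sub_apply]
    rw [← sub_smul, norm_smul, hψn, mul_one]
  calc ‖∫ ω in H, ψ n ω ∂P - (P.real H : ℝ) * cexp (-(l * t ^ 2 / 2 : ℝ))‖
      ≤ ‖∫ ω in H, ψ n ω ∂P - ∫ ω, ((P[χ | 𝓕 k] ω : ℝ) : ℂ) * ψ n ω ∂P‖ +
        ‖∫ ω, ((P[χ | 𝓕 k] ω : ℝ) : ℂ) * ψ n ω ∂P -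
          (P.real H : ℝ) * cexp (-(l * t ^ 2 / 2 : ℝ))‖ := norm_sub_le_norm_sub_add_norm_sub _ _ _
    _ < ε / 2 + ε / 2 := add_lt_add (h5.trans_lt hk) hN'
    _ = ε := add_halves ε

/-- Stable convergence to a centred normal law from the convergence of the characteristic
functions on each event. -/
theorem stablyConverges_gaussianReal {Y : ℕ → Ω → ℝ} (hY : ∀ n, AEMeasurable (Y n) P) {l : ℝ≥0}
    (hlim : ∀ (t : ℝ) (H : Set Ω), MeasurableSet H →
      Tendsto (fun n => ∫ ω in H, cexp ((t * Y n ω : ℝ) * I) ∂P) atTop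
        (𝓝 ((P.real H : ℝ) * cexp (-(l * t ^ 2 / 2 : ℝ))))) :
    StablyConverges P Y (Kernel.const Ω (gaussianReal 0 l)) := by
  refine ⟨hY, fun H hH hPH f => ?_⟩
  have hpr : IsProbabilityMeasure (ProbabilityTheory.cond P H) :=
    cond_isProbabilityMeasure hPH.ne'
  have hYc : ∀ n, AEMeasurable (Y n) (ProbabilityTheory.cond P H) := fun n =>
    (hY n).mono_ac (cond_absolutelyContinuous)
  have hprY : ∀ n, IsProbabilityMeasure ((ProbabilityTheory.cond P H).map (Y n)) := fun n =>
    Measure.isProbabilityMeasure_map (hYc n)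
  have hconv : Tendsto (β := ProbabilityMeasure ℝ)
      (fun n => ⟨(ProbabilityTheory.cond P H).map (Y n), hprY n⟩) atTop
      (𝓝 (⟨gaussianReal 0 l, inferInstance⟩ : ProbabilityMeasure ℝ)) := by
    refine ProbabilityMeasure.tendsto_iff_tendsto_charFun.2 fun t => ?_
    simp only [ProbabilityMeasure.coe_mk]
    rw [charFun_gaussianReal]
    have h1 := (hlim t H hH).const_mul ((P.real H : ℂ)⁻¹)
    have hne : (P.real H : ℂ) ≠ 0 := by
      exact_mod_cast (ENNReal.toReal_pos hPH.ne' (measure_ne_top P H)).ne'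
    rw [inv_mul_cancel_left₀ hne] at h1
    have e : cexp (-(l * t ^ 2 / 2 : ℝ)) = cexp (t * (0 : ℝ) * I - (l : ℝ) * t ^ 2 / 2) := by
      congr 1
      push_cast
      ring
    rw [e] at h1
    refine h1.congr fun n => ?_
    rw [charFun_apply_real, integral_map (hYc n) (by fun_prop), ProbabilityTheory.cond,
      integral_smul_measure, ENNReal.toReal_inv]
    rw [Complex.real_smul]
    push_cast
    rfl
  have h2 := (ProbabilityMeasure.tendsto_iff_forall_integral_tendsto.1 hconv) f
  simp only [Kernel.const_apply, integral_const, probReal_univ, one_smul]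
  refine h2.congr fun n => ?_
  simp only [ProbabilityMeasure.coe_mk]
  rw [integral_map (hYc n) f.continuous.aestronglyMeasurable]

/-- A stable central limit theorem for conditionally Poisson variables. -/
theorem stablyConverges_of_isCondPoisson (hK : ∀ n, Measurable[𝓕 (n + 1)] (K n))
    (h : ∀ n, IsCondPoisson (𝓕 n) P (K n) (Λ n)) (hw : ∀ n, ∀ᵐ ω ∂P, Λ n ω ≤ w n) {a : ℕ → ℝ}
    (ha : Tendsto a atTop atTop) {C : ℝ} (hC : ∀ᶠ n in atTop, ∑ j ∈ range n, (w j : ℝ) ≤ C * a n)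
    {l : ℝ≥0} (hl : ∀ᵐ ω ∂P, Tendsto (fun n => (∑ j ∈ range n, (Λ j ω : ℝ)) / a n) atTop (𝓝 l))
    {Y : ℕ → Ω → ℝ} (hYm : ∀ n, AEMeasurable (Y n) P)
    (hY : Tendsto (fun n => ∫⁻ ω, ENNReal.ofReal
      |Y n ω - (∑ j ∈ range n, ((K j ω : ℝ) - Λ j ω)) / √(a n)| ∂P) atTop (𝓝 0)) :
    StablyConverges P Y (Kernel.const Ω (gaussianReal 0 l)) := by
  refine stablyConverges_gaussianReal hYm fun t H hH => ?_
  have h1 := tendsto_setIntegral_cexp hK h hw ha hC hl t hH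
  -- The map x ↦ e^{itx} is Lipschitz with constant |t|, so the characteristic integrals differ by
  -- at most |t| times the L¹ distance.
  refine h1.congr_dist ?_
  have hb : Tendsto (fun n => |t| * (∫⁻ ω, ENNReal.ofReal
      |Y n ω - (∑ j ∈ range n, ((K j ω : ℝ) - Λ j ω)) / √(a n)| ∂P).toReal) atTop (𝓝 0) := by
    simpa using ((ENNReal.tendsto_toReal ENNReal.zero_ne_top).comp hY).const_mul |t|
  refine squeeze_zero' (Eventually.of_forall fun n => dist_nonneg) ?_ hb
  -- The L¹ distance may be infinite for small n; convergence to 0 makes it finite eventually, as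
  -- the Bochner integral requires.
  filter_upwards [hY.eventually_lt_const ENNReal.zero_lt_top] with n hn
  set D : Ω → ℝ := fun ω => ∑ j ∈ range n, ((K j ω : ℝ) - Λ j ω) with hD
  have hDm : Measurable D := (measurable_sum_sub hK h n).mono (𝓕.le n) le_rfl
  have hm1 : AEStronglyMeasurable (fun ω => cexp ((t / √(a n) * D ω : ℝ) * I)) P :=
    ((measurable_cexp_sum_sub hK h _ n).mono (𝓕.le n) le_rfl).aestronglyMeasurable
  have hm2 : AEStronglyMeasurable (fun ω => cexp ((t * Y n ω : ℝ) * I)) P :=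
    (Complex.measurable_exp.comp_aemeasurable ((Complex.measurable_ofReal.comp_aemeasurable
      ((hYm n).const_mul t)).mul_const I)).aestronglyMeasurable
  have hi : ∀ {f : Ω → ℝ}, AEStronglyMeasurable (fun ω => cexp ((f ω : ℝ) * I)) P →
      Integrable (fun ω => cexp ((f ω : ℝ) * I)) P := fun hf =>
    Integrable.of_bound hf 1 (ae_of_all _ fun ω => (Complex.norm_exp_ofReal_mul_I _).le)
  rw [dist_eq_norm, ← integral_sub (hi hm1).integrableOn (hi hm2).integrableOn]
  have hYi : Integrable (fun ω => Y n ω - D ω / √(a n)) P := by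
    refine ⟨((hYm n).sub (hDm.div_const _).aemeasurable).aestronglyMeasurable, ?_⟩
    rw [hasFiniteIntegral_iff_enorm]
    simpa only [Real.enorm_eq_ofReal_abs] using hn
  rw [← integral_eq_lintegral_of_nonneg_ae (ae_of_all _ fun ω => abs_nonneg _)
    hYi.abs.aestronglyMeasurable, ← integral_const_mul]
  refine (norm_integral_le_integral_norm _).trans ?_
  refine (setIntegral_le_integral ((hi hm1).sub (hi hm2)).norm
    (ae_of_all _ fun ω => norm_nonneg _)).trans ?_
  refine integral_mono ((hi hm1).sub (hi hm2)).norm (hYi.abs.const_mul _) fun ω => ?_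
  have e : cexp ((t / √(a n) * D ω : ℝ) * I) - cexp ((t * Y n ω : ℝ) * I) =
      cexp ((t / √(a n) * D ω : ℝ) * I) *
        (1 - cexp (I * (t * (Y n ω - D ω / √(a n)) : ℝ))) := by
    rw [mul_sub, mul_one, ← Complex.exp_add]
    congr 2
    push_cast
    ring
  change ‖cexp ((t / √(a n) * D ω : ℝ) * I) - cexp ((t * Y n ω : ℝ) * I)‖ ≤ _
  rw [e, norm_mul, Complex.norm_exp_ofReal_mul_I, one_mul, norm_sub_rev, ← abs_mul]
  exact Real.norm_exp_I_mul_ofReal_sub_one_le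

end StableConvergence

/-! ### Ratios of Gamma functions -/

section GammaRatio

open Real

/-- Log-convexity of the Gamma function between z and z + 1. -/
theorem Gamma_add_le_mul_rpow {z s : ℝ} (hz : 0 < z) (hs₀ : 0 ≤ s) (hs₁ : s ≤ 1) :
    Gamma (z + s) ≤ Gamma z * z ^ s := by
  rcases hs₀.eq_or_lt with rfl | hs
  · simp
  rcases hs₁.eq_or_lt with rfl | hs'
  · rw [Gamma_add_one hz.ne', rpow_one, mul_comm]
  have h := Gamma_mul_add_mul_le_rpow_Gamma_mul_rpow_Gamma hz (show 0 < z + 1 by linarith)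
    (show 0 < 1 - s by linarith) hs (by ring)
  have hΓ := Gamma_pos_of_pos hz
  have e : (1 - s) * z + s * (z + 1) = z + s := by ring
  rw [e, Gamma_add_one hz.ne', mul_rpow hz.le hΓ.le] at h
  refine h.trans (le_of_eq ?_)
  rw [mul_left_comm, ← rpow_add hΓ, sub_add_cancel, rpow_one, mul_comm]

/-- Wendel's inequalities. -/
theorem Gamma_div_Gamma_add_bounds {z s : ℝ} (hz : 0 < z) (hs₀ : 0 ≤ s) (hs₁ : s ≤ 1) :
    z ^ (-s) ≤ Gamma z / Gamma (z + s) ∧ Gamma z / Gamma (z + s) ≤ z ^ (-s) * (1 + s / z) := by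
  have hΓ := Gamma_pos_of_pos hz
  have hΓs := Gamma_pos_of_pos (show 0 < z + s by linarith)
  have hzs : 0 < z ^ s := rpow_pos_of_pos hz s
  constructor
  · rw [rpow_neg hz.le, le_div_iff₀ hΓs, inv_mul_le_iff₀ hzs, mul_comm]
    exact Gamma_add_le_mul_rpow hz hs₀ hs₁
  -- The same inequality started at z + s with exponent 1 - s ends at z + 1, where the functional
  -- equation brings back Γ(z).
  · have h := Gamma_add_le_mul_rpow (show 0 < z + s by linarith) (show 0 ≤ 1 - s by linarith)
      (by linarith)
    have e : z + s + (1 - s) = z + 1 := by ring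
    rw [e, Gamma_add_one hz.ne'] at h
    have h1 : 1 ≤ 1 + s / z := by
      have := div_nonneg hs₀ hz.le
      linarith
    have h2 : (z + s) ^ (1 - s) ≤ z ^ (1 - s) * (1 + s / z) := by
      have e2 : z + s = z * (1 + s / z) := by field_simp
      rw [e2, mul_rpow hz.le (by linarith)]
      gcongr
      exact rpow_le_self_of_one_le h1 (by linarith)
    rw [div_le_iff₀ hΓs]
    have h3 : z * Gamma z ≤ Gamma (z + s) * (z ^ (1 - s) * (1 + s / z)) :=
      h.trans (by gcongr)
    have e3 : z ^ (1 - s) = z * z ^ (-s) := by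
      rw [sub_eq_add_neg, rpow_add hz, rpow_one]
    rw [e3] at h3
    have h4 : z * Gamma z ≤ z * (z ^ (-s) * (1 + s / z) * Gamma (z + s)) := by
      linarith
    exact le_of_mul_le_mul_left h4 hz

/-- Wendel's bounds at z = d + T; replacing d + T by T costs a relative error d / T below, and the
factor 1 + q / (d + T) at most 1 / T above. -/
theorem abs_Gamma_div_Gamma_sub_le {d q T : ℝ} (hd : 0 < d) (hq₀ : 0 ≤ q) (hq₁ : q ≤ 1)
    (hT : 0 < T) :
    |Gamma (d + T) / Gamma (d + q + T) - T ^ (-q)| ≤ T ^ (-q) * ((d + 1) / T) := by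
  have hz : 0 < d + T := by linarith
  obtain ⟨h1, h2⟩ := Gamma_div_Gamma_add_bounds hz hq₀ hq₁
  have e : d + T + q = d + q + T := by ring
  rw [e] at h1 h2
  have hTq : 0 < T ^ (-q) := rpow_pos_of_pos hT _
  have h3 : T ^ (-q) * (1 - d / T) ≤ (d + T) ^ (-q) := by
    have e1 : d + T = T * (1 + d / T) := by field_simp; ring
    have hx : 0 < d / T := div_pos hd hT
    rw [e1, mul_rpow hT.le (by linarith)]
    gcongr
    calc 1 - d / T ≤ (1 + d / T)⁻¹ := by
          rw [← one_div, le_div_iff₀ (by linarith)]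
          nlinarith
      _ = (1 + d / T) ^ (-1 : ℝ) := (rpow_neg_one _).symm
      _ ≤ (1 + d / T) ^ (-q) := rpow_le_rpow_of_exponent_le (by linarith) (by linarith)
  have h4 : (d + T) ^ (-q) * (1 + q / (d + T)) ≤ T ^ (-q) * (1 + 1 / T) := by
    have h5 : (d + T) ^ (-q) ≤ T ^ (-q) :=
      rpow_le_rpow_of_nonpos hT (by linarith) (by linarith)
    gcongr
    linarith
  have e2 : (d + 1) / T = d / T + 1 / T := add_div _ _ _
  have hd' : 0 < T ^ (-q) * (d / T) := by positivity
  have h1' : 0 < T ^ (-q) * (1 / T) := by positivity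
  rw [abs_le, e2]
  constructor <;> linarith

theorem abs_rpow_neg_sub_le {q v x r : ℝ} (hv : 0 < v) (hq₀ : 0 ≤ q) (hx : v ≤ x)
    (hr : v ≤ r) : |x ^ (-q) - r ^ (-q)| ≤ q * v ^ (-q - 1) * |x - r| := by
  have h := Convex.norm_image_sub_le_of_norm_hasDerivWithin_le (s := Set.Ici v)
    (f := fun x : ℝ => x ^ (-q)) (f' := fun x => -q * x ^ (-q - 1)) (C := q * v ^ (-q - 1))
    (fun y hy => (Real.hasDerivAt_rpow_const
      (Or.inl (hv.trans_le hy).ne')).hasDerivWithinAt) (fun y hy => ?_) (convex_Ici v) hr hx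
  · simpa only [Real.norm_eq_abs] using h
  · have hy0 : 0 < y := hv.trans_le hy
    rw [norm_mul, norm_neg, Real.norm_of_nonneg hq₀,
      Real.norm_of_nonneg (rpow_nonneg hy0.le _)]
    exact mul_le_mul_of_nonneg_left
      (rpow_le_rpow_of_nonpos hv (Set.mem_Ici.1 hy) (by linarith : -q - 1 ≤ 0)) hq₀

end GammaRatio

/-! ### Power sums and the norming sequence -/

section PowerSums

open Finset

/-- Bernoulli's inequality for an exponent in [0, 1] bounds (x - 1)^β by x^β - β x^(β-1); the terms
then telescope. The reverse comparison below uses (x + 1)^β instead. -/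
theorem rpow_mul_sum_le (β : ℝ) (hβ₀ : 0 ≤ β) (hβ₁ : β ≤ 1) (n : ℕ) :
    β * ∑ j ∈ Icc 1 n, (j : ℝ) ^ (β - 1) ≤ (n : ℝ) ^ β := by
  induction n with
  | zero => simpa using Real.rpow_nonneg le_rfl β
  | succ n ih =>
    have hx : 0 < ((n + 1 : ℕ) : ℝ) := by positivity
    set x : ℝ := ((n + 1 : ℕ) : ℝ) with hxdef
    have hn : (n : ℝ) = x * (1 + -(1 / x)) := by
      field_simp
      simp [hxdef]
    have hx1 : 1 / x ≤ 1 := by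
      rw [div_le_one hx]
      simp [hxdef]
    have h1 : (n : ℝ) ^ β ≤ x ^ β * (1 + β * -(1 / x)) := by
      rw [hn, Real.mul_rpow hx.le (by linarith)]
      gcongr
      exact rpow_one_add_le_one_add_mul_self (by linarith) hβ₀ hβ₁
    have e : x ^ β = x ^ (β - 1) * x := by
      rw [← Real.rpow_add_one hx.ne', sub_add_cancel]
    have e2 : x ^ β * (1 + β * -(1 / x)) = x ^ β - β * x ^ (β - 1) := by
      rw [e]
      field_simp
      ring
    rw [sum_Icc_succ_top (by omega), mul_add]
    linarith

theorem rpow_le_one_add_mul_sum (β : ℝ) (hβ₀ : 0 ≤ β) (hβ₁ : β ≤ 1) (n : ℕ) :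
    ((n + 1 : ℕ) : ℝ) ^ β ≤ 1 + β * ∑ j ∈ Icc 1 n, (j : ℝ) ^ (β - 1) := by
  induction n with
  | zero => simp
  | succ n ih =>
    have hx : 0 < ((n + 1 : ℕ) : ℝ) := by positivity
    set x : ℝ := ((n + 1 : ℕ) : ℝ) with hxdef
    have hn : ((n + 1 + 1 : ℕ) : ℝ) = x * (1 + 1 / x) := by
      field_simp
      simp [hxdef]
    have hx1 : 0 < 1 / x := by positivity
    have h1 : ((n + 1 + 1 : ℕ) : ℝ) ^ β ≤ x ^ β * (1 + β * (1 / x)) := by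
      rw [hn, Real.mul_rpow hx.le (by linarith)]
      gcongr
      exact rpow_one_add_le_one_add_mul_self (by linarith) hβ₀ hβ₁
    have e : x ^ β = x ^ (β - 1) * x := by
      rw [← Real.rpow_add_one hx.ne', sub_add_cancel]
    have e2 : x ^ β * (1 + β * (1 / x)) = x ^ β + β * x ^ (β - 1) := by
      rw [e]
      field_simp
    rw [sum_Icc_succ_top (by omega), mul_add]
    linarith

/-- The factor treats the logarithmic and the power case together. A bounded error, not merely
o(a_n), is what survives division by √a_n. -/
theorem exists_abs_sum_rpow_sub_normSeq_le {β : ℝ} (hβ₀ : 0 ≤ β) (hβ₁ : β < 1) (n : ℕ) :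
    |(if β = 0 then 1 else β) * ∑ j ∈ Icc 1 n, (j : ℝ) ^ (β - 1) - normSeq β n| ≤ 1 := by
  rcases eq_or_ne β 0 with rfl | hβ
  · have e : ∑ j ∈ Icc 1 n, (j : ℝ) ^ ((0 : ℝ) - 1) = (harmonic n : ℝ) := by
      rw [harmonic_eq_sum_Icc]
      push_cast
      refine sum_congr rfl fun j _ => ?_
      rw [zero_sub, Real.rpow_neg_one]
    rw [if_pos rfl, one_mul, e, normSeq, if_pos rfl]
    have h1 := harmonic_le_one_add_log n
    have h2 := log_add_one_le_harmonic n
    have h3 : Real.log n ≤ Real.log ((n + 1 : ℕ) : ℝ) := by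
      rcases Nat.eq_zero_or_pos n with rfl | hn
      · simp
      · exact Real.log_le_log (by exact_mod_cast hn) (by push_cast; linarith)
    rw [abs_le]
    constructor <;> linarith
  · rw [if_neg hβ, normSeq, if_neg hβ]
    have h1 := rpow_mul_sum_le β hβ₀ hβ₁.le n
    have h2 := rpow_le_one_add_mul_sum β hβ₀ hβ₁.le n
    have h3 : (n : ℝ) ^ β ≤ ((n + 1 : ℕ) : ℝ) ^ β :=
      Real.rpow_le_rpow (Nat.cast_nonneg n) (by push_cast; linarith) hβ₀
    rw [abs_le]
    constructor <;> linarith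

theorem tendsto_normSeq {β : ℝ} (hβ₀ : 0 ≤ β) : Tendsto (normSeq β) atTop atTop := by
  rcases eq_or_ne β 0 with rfl | hβ
  · have e : normSeq 0 = fun n : ℕ => Real.log n := by
      funext n
      simp [normSeq]
    rw [e]
    exact Real.tendsto_log_atTop.comp tendsto_natCast_atTop_atTop
  · have e : normSeq β = fun n : ℕ => (n : ℝ) ^ β := by
      funext n
      simp [normSeq, hβ]
    rw [e]
    exact (tendsto_rpow_atTop (lt_of_le_of_ne hβ₀ hβ.symm)).comp tendsto_natCast_atTop_atTop

end PowerSums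

/-! ### Asymptotics of the mean number of new dishes -/

section RateAsymptotics

open Finset Asymptotics

/-- The mean number of new dishes as a function of the total weight. -/
noncomputable def weightRate (α β c T : ℝ) : ℝ :=
  α * (Real.Gamma (c + 1) * Real.Gamma (c + β + T) / (Real.Gamma (c + β) * Real.Gamma (c + 1 + T)))

variable {α β c u r : ℝ}

theorem weightRate_nonneg (hα : 0 < α) (hβ₁ : β < 1) (hc : -β < c) {T : ℝ} (hT : 0 ≤ T) :
    0 ≤ weightRate α β c T := by
  have h1 := Real.Gamma_pos_of_pos (show 0 < c + 1 by linarith)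
  have h2 := Real.Gamma_pos_of_pos (show 0 < c + β by linarith)
  have h3 := Real.Gamma_pos_of_pos (show 0 < c + 1 + T by linarith)
  have h4 := Real.Gamma_pos_of_pos (show 0 < c + β + T by linarith)
  unfold weightRate
  positivity

theorem continuousOn_weightRate (hβ₁ : β < 1) (hc : -β < c) :
    ContinuousOn (weightRate α β c) (Set.Ici 0) := by
  have hΓ : ∀ d : ℝ, 0 < d → ContinuousOn (fun T => Real.Gamma (d + T)) (Set.Ici 0) :=
    fun d hd T hT => by
      have hT' : 0 ≤ T := hT
      have : ContinuousAt Real.Gamma (d + T) :=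
        (Real.differentiableAt_Gamma fun m h => by
          have : (0 : ℝ) ≤ m := Nat.cast_nonneg m
          linarith).continuousAt
      exact (ContinuousAt.comp (f := fun T => d + T) this (by fun_prop)).continuousWithinAt
  refine continuousOn_const.mul (ContinuousOn.div (continuousOn_const.mul (hΓ _ (by linarith)))
    (continuousOn_const.mul (hΓ _ (by linarith))) fun T hT => ?_)
  have hT' : 0 ≤ T := hT
  exact (mul_pos (Real.Gamma_pos_of_pos (by linarith)) (Real.Gamma_pos_of_pos (by linarith))).ne'

/-- Two errors: the Gamma ratio against (j x)^(β-1), of order j^(β-2) and thus summable, and x^(β-1)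
against r^(β-1), by the mean value theorem on [u, ∞). The constant does not depend on x, so it
remains non-random when x is R̄_j. -/
theorem exists_weightRate_bounds (hα : 0 < α) (hβ₀ : 0 ≤ β) (hβ₁ : β < 1) (hc : -β < c)
    (hu : 0 < u) (hr : u ≤ r) :
    ∃ C : ℝ, 0 ≤ C ∧ ∀ (j : ℕ), 1 ≤ j → ∀ x : ℝ, u ≤ x →
      |weightRate α β c (j * x) -
        α * Real.Gamma (c + 1) / Real.Gamma (c + β) * r ^ (β - 1) * (j : ℝ) ^ (β - 1)| ≤
          C * ((j : ℝ) ^ (β - 2) + (j : ℝ) ^ (β - 1) * |x - r|) ∧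
      weightRate α β c (j * x) ≤ C * (j : ℝ) ^ (β - 1) := by
  set A : ℝ := α * Real.Gamma (c + 1) / Real.Gamma (c + β) with hA
  have h1 := Real.Gamma_pos_of_pos (show 0 < c + 1 by linarith)
  have h2 := Real.Gamma_pos_of_pos (show 0 < c + β by linarith)
  have hApos : 0 < A := by positivity
  set q : ℝ := 1 - β with hq
  have hq₀ : 0 ≤ q := by linarith
  have hd : 0 < c + β := by linarith
  set C₁ : ℝ := A * (u ^ (-q) * ((c + β + 1) / u)) with hC₁
  set C₂ : ℝ := A * (q * u ^ (-q - 1)) with hC₂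
  set C₃ : ℝ := A * u ^ (-q) with hC₃
  have hC₁' : 0 ≤ C₁ := by positivity
  have hC₂' : 0 ≤ C₂ := by positivity
  have hC₃' : 0 ≤ C₃ := by positivity
  refine ⟨C₁ + C₂ + C₃, by positivity, fun j hj x hx => ?_⟩
  have hj0 : (0 : ℝ) < j := by exact_mod_cast hj
  have hj1 : (1 : ℝ) ≤ j := by exact_mod_cast hj
  have hx0 : 0 < x := hu.trans_le hx
  have hT : 0 < (j : ℝ) * x := mul_pos hj0 hx0
  have eβ : β - 1 = -q := by ring
  have eβ2 : (j : ℝ) ^ (β - 2) = (j : ℝ) ^ (-q) * (1 / j) := by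
    have : β - 2 = -q - 1 := by ring
    rw [this, Real.rpow_sub_one hj0.ne', mul_one_div]
  have hjq : 0 < (j : ℝ) ^ (-q) := Real.rpow_pos_of_pos hj0 _
  have hT2 : ((j : ℝ) * x) ^ (-q) ≤ (j : ℝ) ^ (-q) * u ^ (-q) := by
    rw [Real.mul_rpow hj0.le hx0.le]
    exact mul_le_mul_of_nonneg_left (Real.rpow_le_rpow_of_nonpos hu hx (by linarith)) hjq.le
  have hT3 : (c + β + 1) / ((j : ℝ) * x) ≤ (c + β + 1) / u * (1 / j) := by
    rw [div_mul_div_comm, mul_one, mul_comm u]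
    gcongr
  have hΓ := abs_Gamma_div_Gamma_sub_le hd hq₀ (by linarith : q ≤ 1) hT
  have e1 : c + β + q = c + 1 := by ring
  rw [e1] at hΓ
  have e2 : weightRate α β c (j * x) = A * (Real.Gamma (c + β + j * x) /
      Real.Gamma (c + 1 + j * x)) := by
    rw [weightRate, hA]
    field_simp
  have hmain : |weightRate α β c (j * x) - A * ((j : ℝ) * x) ^ (-q)| ≤
      C₁ * (j : ℝ) ^ (β - 2) := by
    rw [e2, ← mul_sub, abs_mul, abs_of_pos hApos, eβ2]
    calc A * |Real.Gamma (c + β + j * x) / Real.Gamma (c + 1 + j * x) - (j * x) ^ (-q)|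
        ≤ A * (((j : ℝ) ^ (-q) * u ^ (-q)) * ((c + β + 1) / u * (1 / j))) := by
          refine mul_le_mul_of_nonneg_left (hΓ.trans ?_) hApos.le
          exact mul_le_mul hT2 hT3 (by positivity) (by positivity)
      _ = C₁ * ((j : ℝ) ^ (-q) * (1 / j)) := by rw [hC₁]; ring
  have hsecond : |A * ((j : ℝ) * x) ^ (-q) - A * r ^ (β - 1) * (j : ℝ) ^ (β - 1)| ≤
      C₂ * ((j : ℝ) ^ (β - 1) * |x - r|) := by
    rw [eβ, Real.mul_rpow hj0.le hx0.le]
    have e3 : A * ((j : ℝ) ^ (-q) * x ^ (-q)) - A * r ^ (-q) * (j : ℝ) ^ (-q) =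
        A * (j : ℝ) ^ (-q) * (x ^ (-q) - r ^ (-q)) := by ring
    rw [e3, abs_mul, abs_of_pos (by positivity)]
    calc A * (j : ℝ) ^ (-q) * |x ^ (-q) - r ^ (-q)|
        ≤ A * (j : ℝ) ^ (-q) * (q * u ^ (-q - 1) * |x - r|) := by
          gcongr
          exact abs_rpow_neg_sub_le hu hq₀ hx hr
      _ = C₂ * ((j : ℝ) ^ (-q) * |x - r|) := by rw [hC₂]; ring
  have hp2 : 0 ≤ (j : ℝ) ^ (β - 2) := Real.rpow_nonneg hj0.le _
  have hp1 : 0 ≤ (j : ℝ) ^ (β - 1) * |x - r| :=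
    mul_nonneg (Real.rpow_nonneg hj0.le _) (abs_nonneg _)
  constructor
  · refine (abs_sub_le _ (A * ((j : ℝ) * x) ^ (-q)) _).trans ?_
    refine (add_le_add hmain hsecond).trans ?_
    linarith [mul_nonneg hC₁' hp1, mul_nonneg hC₂' hp2, mul_nonneg hC₃' hp1, mul_nonneg hC₃' hp2]
  · have h5 := (abs_le.1 hmain).2
    have h6 : A * ((j : ℝ) * x) ^ (-q) ≤ C₃ * (j : ℝ) ^ (-q) := by
      refine (mul_le_mul_of_nonneg_left hT2 hApos.le).trans (le_of_eq ?_)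
      rw [hC₃]
      ring
    have h7 : (j : ℝ) ^ (β - 2) ≤ (j : ℝ) ^ (-q) := by
      rw [eβ2]
      exact mul_le_of_le_one_right hjq.le ((div_le_one hj0).2 hj1)
    rw [eβ]
    linarith [mul_le_mul_of_nonneg_left h7 hC₁', mul_nonneg hC₂' hjq.le]

theorem sum_Icc_one_eq_sum_range {E : Type*} [AddCommMonoid E] (f : ℕ → E) (n : ℕ) :
    ∑ j ∈ Icc 1 n, f j = ∑ j ∈ range n, f (j + 1) := by
  induction n with
  | zero => simp
  | succ n ih => rw [sum_Icc_succ_top (by omega), ih, sum_range_succ]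

theorem exists_weightRate_le (hα : 0 < α) (hβ₀ : 0 ≤ β) (hβ₁ : β < 1) (hc : -β < c)
    (hu : 0 < u) :
    ∃ C : ℝ, 0 < C ∧ ∀ (j : ℕ) (x : ℝ), (1 ≤ j → u ≤ x) →
      weightRate α β c (j * x) ≤ C * ((j : ℝ) + 1) ^ (β - 1) := by
  obtain ⟨C, hC, h⟩ := exists_weightRate_bounds hα hβ₀ hβ₁ hc hu le_rfl
  have h0 := weightRate_nonneg hα hβ₁ hc le_rfl
  -- The term 2 C pays for the passage from j to j + 1, since (j + 1) / 2 ≤ j and 2^(1-β) ≤ 2; the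
  -- second term covers j = 0, and 1 makes the constant positive.
  refine ⟨2 * C + weightRate α β c 0 + 1, by linarith, fun j x hx => ?_⟩
  rcases Nat.eq_zero_or_pos j with rfl | hj
  · simp
    linarith
  · have hj0 : (0 : ℝ) < j := by exact_mod_cast hj
    have hj1 : (1 : ℝ) ≤ j := by exact_mod_cast hj
    have hpos : 0 < ((j : ℝ) + 1) ^ (β - 1) := by positivity
    have h1 := (h j hj x (hx hj)).2
    have h2 : (j : ℝ) ^ (β - 1) ≤ 2 * ((j : ℝ) + 1) ^ (β - 1) := by
      calc (j : ℝ) ^ (β - 1) ≤ (((j : ℝ) + 1) * 2⁻¹) ^ (β - 1) :=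
            Real.rpow_le_rpow_of_nonpos (by positivity) (by linarith) (by linarith)
        _ = ((j : ℝ) + 1) ^ (β - 1) * 2 ^ (1 - β) := by
            rw [Real.mul_rpow (by positivity) (by positivity), Real.inv_rpow (by norm_num),
              ← Real.rpow_neg (by norm_num), neg_sub]
        _ ≤ ((j : ℝ) + 1) ^ (β - 1) * 2 := by
            gcongr
            exact Real.rpow_le_self_of_one_le (by norm_num) (by linarith)
        _ = 2 * ((j : ℝ) + 1) ^ (β - 1) := mul_comm _ _
    linarith [mul_le_mul_of_nonneg_left h2 hC, mul_nonneg h0 hpos.le]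

/-- Matches the constant per customer with the limit constant through the factor of the power sums;
for β = 0 this is Γ(c + 1) = c Γ(c). -/
theorem limitConst_mul (hβ₀ : 0 ≤ β) (hc : -β < c) (hr : 0 < r) :
    limitConst α β c r * (if β = 0 then 1 else β) =
      α * Real.Gamma (c + 1) / Real.Gamma (c + β) * r ^ (β - 1) := by
  rcases eq_or_ne β 0 with rfl | hβ
  · have hc0 : 0 < c := by linarith
    have hΓ := Real.Gamma_pos_of_pos hc0
    rw [limitConst, if_pos rfl, if_pos rfl, Real.Gamma_add_one hc0.ne', zero_sub,
      Real.rpow_neg_one, add_zero]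
    field_simp
  · rw [limitConst, if_neg hβ, if_neg hβ, ← neg_sub 1 β, Real.rpow_neg hr.le]
    field_simp

theorem limitConst_nonneg (hα : 0 < α) (hβ₀ : 0 ≤ β) (hβ₁ : β < 1) (hc : -β < c) (hr : 0 < r) :
    0 ≤ limitConst α β c r := by
  have h1 := Real.Gamma_pos_of_pos (show 0 < c + 1 by linarith)
  have h2 := Real.Gamma_pos_of_pos (show 0 < c + β by linarith)
  unfold limitConst
  split_ifs with hβ
  · have : 0 < c := by linarith
    positivity
  · have : 0 < r ^ (1 - β) := Real.rpow_pos_of_pos hr _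
    positivity

/-- The pathwise estimate behind both parts of the theorem. Its constant is the same for all
sequences x, so it may be integrated over Ω. -/
theorem exists_abs_sum_weightRate_sub_le (hα : 0 < α) (hβ₀ : 0 ≤ β) (hβ₁ : β < 1) (hc : -β < c)
    (hu : 0 < u) (hr : u ≤ r) :
    ∃ C : ℝ, 0 ≤ C ∧ ∀ x : ℕ → ℝ, (∀ j, 1 ≤ j → u ≤ x j) → ∀ n,
      |∑ j ∈ range n, weightRate α β c (j * x j) - limitConst α β c r * normSeq β n| ≤
        C * (1 + ∑ j ∈ Icc 1 n, (j : ℝ) ^ (β - 1) * |x j - r|) := by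
  obtain ⟨C, hC, h⟩ := exists_weightRate_bounds hα hβ₀ hβ₁ hc hu hr
  have hr0 : 0 < r := hu.trans_le hr
  set l := limitConst α β c r with hl
  have hl0 : 0 ≤ l := limitConst_nonneg hα hβ₀ hβ₁ hc hr0
  set A := α * Real.Gamma (c + 1) / Real.Gamma (c + β) * r ^ (β - 1) with hA
  have hA' : l * (if β = 0 then 1 else β) = A := limitConst_mul hβ₀ hc hr0
  have hA0 : 0 ≤ A := by
    rw [← hA']
    split_ifs <;> positivity
  have hα0 := weightRate_nonneg hα hβ₁ hc le_rfl
  have hsum : Summable fun j : ℕ => (j : ℝ) ^ (β - 2) :=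
    Real.summable_nat_rpow.2 (by linarith)
  set S := ∑' j : ℕ, (j : ℝ) ^ (β - 2) with hS
  have hS0 : 0 ≤ S := tsum_nonneg fun j => by positivity
  -- In order: the term j = 0, the extra last power in the sum over 1, …, n, the comparison with the
  -- norming sequence, the summable errors, and the deviations from r.
  refine ⟨weightRate α β c 0 + A + l + C * S + C, by positivity, fun x hx n => ?_⟩
  have key : ∀ k, |∑ j ∈ range (k + 1), weightRate α β c (j * x j) -
      A * ∑ j ∈ Icc 1 k, (j : ℝ) ^ (β - 1)| ≤ weightRate α β c 0 +
        C * ∑ j ∈ Icc 1 k, ((j : ℝ) ^ (β - 2) + (j : ℝ) ^ (β - 1) * |x j - r|) := by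
    intro k
    have e : ∑ j ∈ range (k + 1), weightRate α β c (j * x j) -
        A * ∑ j ∈ Icc 1 k, (j : ℝ) ^ (β - 1) = weightRate α β c 0 +
          ∑ j ∈ Icc 1 k, (weightRate α β c (j * x j) - A * (j : ℝ) ^ (β - 1)) := by
      rw [sum_sub_distrib, mul_sum, sum_Icc_one_eq_sum_range (fun j => weightRate α β c (j * x j)),
        sum_range_succ']
      simp
      ring
    rw [e]
    refine (abs_add_le _ _).trans (add_le_add (abs_of_nonneg hα0).le ?_)
    rw [mul_sum]
    refine (abs_sum_le_sum_abs _ _).trans (sum_le_sum fun j hj => ?_)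
    have hj1 := (mem_Icc.1 hj).1
    exact (h j hj1 (x j) (hx j hj1)).1
  have hD0 : ∀ k : ℕ, 0 ≤ ∑ j ∈ Icc 1 k, (j : ℝ) ^ (β - 1) * |x j - r| := fun k =>
    sum_nonneg fun j _ => by positivity
  have hmain : |∑ j ∈ range n, weightRate α β c (j * x j) -
      A * ∑ j ∈ Icc 1 n, (j : ℝ) ^ (β - 1)| ≤ weightRate α β c 0 + A +
        C * (S + ∑ j ∈ Icc 1 n, (j : ℝ) ^ (β - 1) * |x j - r|) := by
    rcases n with _ | k
    · simp
      positivity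
    · have h1 := key k
      have h2 : ((k + 1 : ℕ) : ℝ) ^ (β - 1) ≤ 1 :=
        Real.rpow_le_one_of_one_le_of_nonpos (by push_cast; linarith [Nat.cast_nonneg (α := ℝ) k])
          (by linarith)
      have h2' : 0 ≤ ((k + 1 : ℕ) : ℝ) ^ (β - 1) := by positivity
      have h3 : ∑ j ∈ Icc 1 k, (j : ℝ) ^ (β - 2) ≤ S :=
        hsum.sum_le_tsum _ fun j _ => by positivity
      have h4 : ∑ j ∈ Icc 1 k, (j : ℝ) ^ (β - 1) * |x j - r| ≤
          ∑ j ∈ Icc 1 (k + 1), (j : ℝ) ^ (β - 1) * |x j - r| := by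
        rw [sum_Icc_succ_top (by omega)]
        exact le_add_of_nonneg_right (by positivity)
      rw [sum_add_distrib] at h1
      rw [sum_Icc_succ_top (by omega) fun j : ℕ => (j : ℝ) ^ (β - 1), mul_add, ← sub_sub]
      refine (abs_sub _ _).trans ?_
      have h5 : |A * ((k + 1 : ℕ) : ℝ) ^ (β - 1)| ≤ A := by
        rw [abs_of_nonneg (by positivity)]
        exact mul_le_of_le_one_right hA0 h2
      have h6 := mul_le_mul_of_nonneg_left (add_le_add h3 h4) hC
      linarith
  have hH := exists_abs_sum_rpow_sub_normSeq_le hβ₀ hβ₁ n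
  have hH' : |A * ∑ j ∈ Icc 1 n, (j : ℝ) ^ (β - 1) - l * normSeq β n| ≤ l := by
    rw [← hA', mul_assoc, ← mul_sub, abs_mul, abs_of_nonneg hl0]
    exact mul_le_of_le_one_right hl0 hH
  refine (abs_sub_le _ (A * ∑ j ∈ Icc 1 n, (j : ℝ) ^ (β - 1)) _).trans ?_
  have hDn := hD0 n
  set D := ∑ j ∈ Icc 1 n, (j : ℝ) ^ (β - 1) * |x j - r|
  have h7 : 0 ≤ (weightRate α β c 0 + A + l + C * S) * D := by positivity
  linarith

theorem isBigO_sum_rpow_normSeq (hβ₀ : 0 ≤ β) (hβ₁ : β < 1) :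
    (fun n : ℕ => ∑ j ∈ range n, ((j : ℝ) + 1) ^ (β - 1)) =O[atTop] normSeq β := by
  have hκ : (0 : ℝ) < if β = 0 then 1 else β := by
    split_ifs with h
    · exact one_pos
    · exact lt_of_le_of_ne hβ₀ (Ne.symm h)
  refine IsBigO.of_bound (2 / if β = 0 then 1 else β) ?_
  filter_upwards [(tendsto_normSeq hβ₀).eventually_ge_atTop 1] with n hn
  have h := exists_abs_sum_rpow_sub_normSeq_le hβ₀ hβ₁ n
  rw [sum_Icc_one_eq_sum_range] at h
  push_cast at h
  have hS : 0 ≤ ∑ j ∈ range n, ((j : ℝ) + 1) ^ (β - 1) := sum_nonneg fun j _ => by positivity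
  rw [Real.norm_of_nonneg hS, Real.norm_of_nonneg (by linarith), div_mul_eq_mul_div,
    le_div_iff₀ hκ]
  have := (abs_le.1 h).2
  linarith

theorem tendsto_sum_rpow (hβ₀ : 0 ≤ β) (hβ₁ : β < 1) :
    Tendsto (fun n : ℕ => ∑ j ∈ range n, ((j : ℝ) + 1) ^ (β - 1)) atTop atTop := by
  have hκ : (0 : ℝ) < if β = 0 then 1 else β := by
    split_ifs with h
    · exact one_pos
    · exact lt_of_le_of_ne hβ₀ (Ne.symm h)
  have h : Tendsto (fun n : ℕ => (if β = 0 then 1 else β) *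
      ∑ j ∈ range n, ((j : ℝ) + 1) ^ (β - 1)) atTop atTop := by
    refine tendsto_atTop_mono (fun n => ?_) (tendsto_atTop_add_const_right _ (-1)
      (tendsto_normSeq hβ₀))
    have h := exists_abs_sum_rpow_sub_normSeq_le hβ₀ hβ₁ n
    rw [sum_Icc_one_eq_sum_range] at h
    push_cast at h
    have := (abs_le.1 h).1
    linarith
  exact (tendsto_const_mul_atTop_of_pos hκ).1 h

/-- When x tends to r, the weighted deviations are o(∑ j^(β-1)) by a Cesàro argument, and the power
sums are O(a_n). -/
theorem tendsto_sum_weightRate_div (hα : 0 < α) (hβ₀ : 0 ≤ β) (hβ₁ : β < 1) (hc : -β < c)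
    (hu : 0 < u) (hr : u ≤ r) {x : ℕ → ℝ} (hx : ∀ j, 1 ≤ j → u ≤ x j)
    (hxr : Tendsto x atTop (𝓝 r)) :
    Tendsto (fun n => (∑ j ∈ range n, weightRate α β c (j * x j)) / normSeq β n) atTop
      (𝓝 (limitConst α β c r)) := by
  obtain ⟨C, hC, h⟩ := exists_abs_sum_weightRate_sub_le hα hβ₀ hβ₁ hc hu hr
  have ha := tendsto_normSeq (β := β) hβ₀
  have h1 : (fun n : ℕ => ∑ j ∈ range n, ((j : ℝ) + 1) ^ (β - 1) * |x (j + 1) - r|) =o[atTop]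
      normSeq β := by
    refine (IsLittleO.sum_range ?_ (fun j => by positivity)
      (tendsto_sum_rpow hβ₀ hβ₁)).trans_isBigO (isBigO_sum_rpow_normSeq hβ₀ hβ₁)
    have h2 : Tendsto (fun j => |x (j + 1) - r|) atTop (𝓝 0) := by
      simpa using (((tendsto_add_atTop_iff_nat 1).2 hxr).sub_const r).abs
    simpa using (isBigO_refl (fun j : ℕ => ((j : ℝ) + 1) ^ (β - 1)) atTop).mul_isLittleO
      ((isLittleO_one_iff ℝ).2 h2)
  have hone : (fun _ : ℕ => (1 : ℝ)) =o[atTop] normSeq β := by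
    rw [isLittleO_const_left]
    exact Or.inr (tendsto_norm_atTop_atTop.comp ha)
  have h3 : (fun n => ∑ j ∈ range n, weightRate α β c (j * x j) -
      limitConst α β c r * normSeq β n) =o[atTop] normSeq β := by
    refine IsBigO.trans_isLittleO (IsBigO.of_bound C (Eventually.of_forall fun n => ?_))
      (hone.add h1)
    have h4 := h x hx n
    rw [sum_Icc_one_eq_sum_range] at h4
    push_cast at h4
    exact h4.trans (mul_le_mul_of_nonneg_left (le_abs_self _) hC)
  have h5 := h3.tendsto_div_nhds_zero.add_const (limitConst α β c r)
  rw [zero_add] at h5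
  refine h5.congr' ?_
  filter_upwards [ha.eventually_gt_atTop 0] with n hn
  field_simp
  ring

end RateAsymptotics

/-! ### Simple point measures -/

section SimplePointMeasures

open MeasurableSpace

variable {X : Type u} [MeasurableSpace X] [CountablyGenerated X]

/-- A cell of level k is a union of cells of level k + 1. -/
theorem countablePartitionSet_succ_subset (k : ℕ) (x : X) :
    countablePartitionSet (k + 1) x ⊆ countablePartitionSet k x := by
  obtain ⟨S, hS, hSe⟩ := (measurableSet_generateFrom_countablePartition_iff (k + 1) _).1
    (measurableSet_succ_countablePartition k (countablePartitionSet_mem k x))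
  have hx := mem_countablePartitionSet k x
  rw [hSe] at hx
  obtain ⟨C, hC, hxC⟩ := hx
  rw [countablePartitionSet_of_mem (hS hC) hxC]
  intro y hy
  rw [hSe]
  exact ⟨C, hC, hy⟩

theorem antitone_countablePartitionSet (x : X) :
    Antitone fun k => countablePartitionSet k x :=
  antitone_nat_of_succ_le fun k => countablePartitionSet_succ_subset k x

/-- The cells of all levels generate the σ-field, which separates points, so they separate points
themselves. -/
theorem iInter_countablePartitionSet [MeasurableSingletonClass X] (x : X) :
    ⋂ k, countablePartitionSet k x = {x} := by
  refine Set.eq_singleton_iff_unique_mem.2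
    ⟨Set.mem_iInter.2 fun k => mem_countablePartitionSet k x, fun y hy => ?_⟩
  rw [Set.mem_iInter] at hy
  have hsep : @SeparatesPoints X (generateFrom (⋃ k, countablePartition X k)) := by
    rw [generateFrom_iUnion_countablePartition X]
    infer_instance
  refine @separating_of_generateFrom X (⋃ k, countablePartition X k) hsep y x fun s hs => ?_
  obtain ⟨k, hk⟩ := Set.mem_iUnion.1 hs
  rw [← countablePartitionSet_eq_iff y hk, ← countablePartitionSet_eq_iff x hk,
    countablePartitionSet_of_mem (countablePartitionSet_mem k x) (hy k)]

variable (X) in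
/-- The measures that are integer valued on the cells of the partitions and, for one of the
partitions, at most one on each cell. -/
def simpleMeasures : Set (Measure X) :=
  {μ | (∀ k, ∀ C ∈ countablePartition X k, μ C ∈ Set.range ((↑) : ℕ → ℝ≥0∞)) ∧
    ∃ k, ∀ C ∈ countablePartition X k, μ C ≤ 1}

/-- Countably many evaluations are involved; this is the reason to express simplicity through
partitions instead of atoms. -/
theorem measurableSet_simpleMeasures : MeasurableSet (simpleMeasures X) := by
  have hr : MeasurableSet (Set.range ((↑) : ℕ → ℝ≥0∞)) := (Set.countable_range _).measurableSet
  have e : simpleMeasures X =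
      (⋂ k, ⋂ C ∈ countablePartition X k, {μ | μ C ∈ Set.range ((↑) : ℕ → ℝ≥0∞)}) ∩
        ⋃ k, ⋂ C ∈ countablePartition X k, {μ | μ C ≤ 1} := by
    ext μ
    simp [simpleMeasures]
  rw [e]
  refine (MeasurableSet.iInter fun k => MeasurableSet.biInter
    (finite_countablePartition X k).countable fun C hC => ?_).inter
    (MeasurableSet.iUnion fun k => MeasurableSet.biInter
      (finite_countablePartition X k).countable fun C hC => ?_)
  · exact Measure.measurable_coe (measurableSet_countablePartition k hC) hr
  · exact measurableSet_le (Measure.measurable_coe (measurableSet_countablePartition k hC))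
      measurable_const

theorem finite_atoms {X : Type u} [MeasurableSpace X] [MeasurableSingletonClass X]
    (μ : Measure X) [IsFiniteMeasure μ] : {x | μ {x} = 1}.Finite := by
  have h := Measure.finite_const_le_meas_of_disjoint_iUnion (ι := X) μ (ε := 1) one_pos
    (As := fun x => {x}) (fun x => measurableSet_singleton x)
    (fun x y hxy => by simpa using hxy) (measure_ne_top μ _)
  exact h.subset fun x hx => (Set.mem_ofPred.1 hx).ge

variable [MeasurableSingletonClass X]

/-- Discard the null cells of all levels. The cells around any remaining point have mass exactly 1
from level k₀ on, and they decrease to the point. -/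
theorem measure_compl_atoms_eq_zero {μ : Measure X} (hμ : μ ∈ simpleMeasures X) :
    μ {x | μ {x} = 1}ᶜ = 0 := by
  obtain ⟨hint, k₀, hk₀⟩ := hμ
  have hnull : μ (⋃ k, ⋃ C ∈ {C ∈ countablePartition X k | μ C = 0}, C) = 0 := by
    refine measure_iUnion_null fun k => (measure_biUnion_null_iff
      ((finite_countablePartition X k).subset (Set.sep_subset _ _)).countable).2 fun C hC => hC.2
  refine measure_mono_null (fun x hx => ?_) hnull
  by_contra hxN
  have hpos : ∀ k, μ (countablePartitionSet k x) ≠ 0 := fun k h0 => hxN (Set.mem_iUnion.2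
    ⟨k, Set.mem_biUnion (⟨countablePartitionSet_mem k x, h0⟩ :
      countablePartitionSet k x ∈ {C ∈ countablePartition X k | μ C = 0})
        (mem_countablePartitionSet k x)⟩)
  have hle : ∀ k, k₀ ≤ k → μ (countablePartitionSet k x) = 1 := fun k hk => by
    have h1 : μ (countablePartitionSet k x) ≤ 1 :=
      (measure_mono (antitone_countablePartitionSet x hk)).trans
        (hk₀ _ (countablePartitionSet_mem k₀ x))
    obtain ⟨i, hi⟩ := hint k _ (countablePartitionSet_mem k x)
    have h0 := hpos k
    rw [← hi] at h0 h1 ⊢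
    have h0' : i ≠ 0 := by exact_mod_cast h0
    have h1' : i ≤ 1 := by exact_mod_cast h1
    have : i = 1 := by omega
    simp [this]
  have hlim := tendsto_measure_iInter_atTop (μ := μ)
    (fun k => (measurableSet_countablePartitionSet k x).nullMeasurableSet)
    (antitone_countablePartitionSet x) ⟨k₀, by rw [hle k₀ le_rfl]; exact ENNReal.one_ne_top⟩
  rw [iInter_countablePartitionSet] at hlim
  have hconst : Tendsto (μ ∘ fun k => countablePartitionSet k x) atTop (𝓝 1) :=
    tendsto_const_nhds.congr' (by
      filter_upwards [eventually_ge_atTop k₀] with k hk using (hle k hk).symm)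
  exact hx (tendsto_nhds_unique hlim hconst)

/-- The sum is the mass under ρ ⊗ ρ of the union of the squares C × C, which decreases to the
diagonal; the diagonal is null because ρ is diffuse. -/
theorem tendsto_prod_biUnion_countablePartition (ρ : Measure X) [IsFiniteMeasure ρ]
    (hρ : ∀ x, ρ {x} = 0) :
    Tendsto (fun k => ∑ C ∈ (finite_countablePartition X k).toFinset, ρ C ^ 2) atTop (𝓝 0) := by
  set E : ℕ → Set (X × X) := fun k => ⋃ C ∈ (finite_countablePartition X k).toFinset, C ×ˢ C
    with hE
  have hmem : ∀ k p, p ∈ E k ↔ p.2 ∈ countablePartitionSet k p.1 := fun k p => by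
    simp only [hE, Set.mem_iUnion, Set.Finite.mem_toFinset, Set.mem_prod, exists_prop]
    constructor
    · rintro ⟨C, hC, h1, h2⟩
      rwa [countablePartitionSet_of_mem hC h1]
    · exact fun h => ⟨_, countablePartitionSet_mem k p.1, mem_countablePartitionSet k p.1, h⟩
  have hEm : ∀ k, MeasurableSet (E k) := fun k =>
    Finset.measurableSet_biUnion _ fun C hC => by
      have := measurableSet_countablePartition k ((Set.Finite.mem_toFinset _).1 hC)
      exact this.prod this
  have hanti : Antitone E := antitone_nat_of_succ_le fun k p hp => by
    rw [hmem] at hp ⊢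
    exact countablePartitionSet_succ_subset k p.1 hp
  have hsum : ∀ k, (ρ.prod ρ) (E k) =
      ∑ C ∈ (finite_countablePartition X k).toFinset, ρ C ^ 2 := fun k => by
    rw [hE, measure_biUnion_finset]
    · exact Finset.sum_congr rfl fun C _ => by rw [Measure.prod_prod, sq]
    · intro C hC D hD hCD
      have hC' := (Set.Finite.mem_toFinset _).1 (Finset.mem_coe.1 hC)
      have hD' := (Set.Finite.mem_toFinset _).1 (Finset.mem_coe.1 hD)
      exact Set.Disjoint.set_prod_left (disjoint_countablePartition hC' hD' hCD) _ _
    · intro C hC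
      have := measurableSet_countablePartition k ((Set.Finite.mem_toFinset _).1 hC)
      exact this.prod this
  have hlim := tendsto_measure_iInter_atTop (μ := ρ.prod ρ)
    (fun k => (hEm k).nullMeasurableSet) hanti ⟨0, measure_ne_top _ _⟩
  have hzero : (ρ.prod ρ) (⋂ k, E k) = 0 := by
    rw [Measure.measure_prod_null (MeasurableSet.iInter hEm)]
    refine ae_of_all _ fun x => ?_
    have : Prod.mk x ⁻¹' (⋂ k, E k) = {x} := by
      rw [← iInter_countablePartitionSet x]
      ext y
      simp [hmem]
    change ρ (Prod.mk x ⁻¹' (⋂ k, E k)) = 0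
    rw [this, hρ x]
  rw [hzero] at hlim
  exact hlim.congr hsum

/-- A random measure with Poisson values and a diffuse intensity is almost surely a simple point
measure. -/
theorem ae_mem_simpleMeasures {Ω : Type v} [MeasurableSpace Ω] {P : Measure Ω}
    {M : Ω → Measure X} (hM : Measurable M) (ρ : Measure X) [IsFiniteMeasure ρ]
    (hρ : ∀ x, ρ {x} = 0)
    (hlaw : ∀ B : Set X, MeasurableSet B → P.map (fun ω => M ω B) =
      (poissonMeasure (ρ B).toNNReal).map (fun n : ℕ => (n : ℝ≥0∞))) :
    ∀ᵐ ω ∂P, M ω ∈ simpleMeasures X := by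
  have hMB : ∀ B : Set X, MeasurableSet B → Measurable fun ω => M ω B := fun B hB =>
    (Measure.measurable_coe hB).comp hM
  have hcast : Measurable fun n : ℕ => (n : ℝ≥0∞) := measurable_from_nat
  have hprob : ∀ B : Set X, MeasurableSet B → ∀ s : Set ℝ≥0∞, MeasurableSet s →
      P {ω | M ω B ∈ s} = poissonMeasure (ρ B).toNNReal {n | (n : ℝ≥0∞) ∈ s} :=
    fun B hB s hs => by
      have h := congrArg (fun μ => μ s) (hlaw B hB)
      simp only [Measure.map_apply (hMB B hB) hs, Measure.map_apply hcast hs] at h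
      exact h
  have hr : MeasurableSet (Set.range ((↑) : ℕ → ℝ≥0∞)) := (Set.countable_range _).measurableSet
  have hint : ∀ᵐ ω ∂P, ∀ k, ∀ C ∈ countablePartition X k,
      M ω C ∈ Set.range ((↑) : ℕ → ℝ≥0∞) := by
    refine ae_all_iff.2 fun k =>
      (ae_ball_iff (finite_countablePartition X k).countable).2 fun C hC => ?_
    have h := hprob C (measurableSet_countablePartition k hC) _ hr.compl
    rw [ae_iff]
    refine h.trans ?_
    simp
  have htwo : ∀ B : Set X, MeasurableSet B → P {ω | 2 ≤ M ω B} ≤ ρ B ^ 2 := fun B hB => by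
    have h := hprob B hB (Set.Ici 2) measurableSet_Ici
    have e : {n : ℕ | (n : ℝ≥0∞) ∈ Set.Ici 2} = {n | 2 ≤ n} := by
      ext n
      simp only [Set.mem_ofPred_eq, Set.mem_Ici]
      exact_mod_cast Iff.rfl
    rw [e] at h
    refine h.le.trans ((poissonMeasure_two_le _).trans (le_of_eq ?_))
    rw [ENNReal.coe_toNNReal (measure_ne_top ρ B)]
  -- A union bound at each level: some cell carries two points with probability at most the sum of ρ
  -- C ^ 2, which tends to 0.
  have hbad : P {ω | ∀ k, ∃ C ∈ countablePartition X k, 2 ≤ M ω C} = 0 := by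
    refine le_antisymm (ge_of_tendsto (tendsto_prod_biUnion_countablePartition ρ hρ)
      (Eventually.of_forall fun k => ?_)) zero_le
    calc P {ω | ∀ k, ∃ C ∈ countablePartition X k, 2 ≤ M ω C}
        ≤ P (⋃ C ∈ (finite_countablePartition X k).toFinset, {ω | 2 ≤ M ω C}) := by
          refine measure_mono fun ω hω => ?_
          obtain ⟨C, hC, h⟩ := hω k
          exact Set.mem_biUnion (Finset.mem_coe.2 ((Set.Finite.mem_toFinset _).2 hC)) h
      _ ≤ ∑ C ∈ (finite_countablePartition X k).toFinset, P {ω | 2 ≤ M ω C} :=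
          measure_biUnion_finset_le _ _
      _ ≤ _ := Finset.sum_le_sum fun C hC => htwo C
          (measurableSet_countablePartition k ((Set.Finite.mem_toFinset _).1 hC))
  have hbad' : ∀ᵐ ω ∂P, ¬ ∀ k, ∃ C ∈ countablePartition X k, 2 ≤ M ω C := by
    rw [ae_iff]
    simpa only [not_not] using hbad
  filter_upwards [hint, hbad'] with ω h1 h2
  refine ⟨h1, ?_⟩
  by_contra! h3
  refine h2 fun k => ?_
  obtain ⟨C, hC, h4⟩ := h3 k
  refine ⟨C, hC, ?_⟩
  obtain ⟨i, hi⟩ := h1 k C hC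
  rw [← hi] at h4 ⊢
  have h5 : 1 < i := by exact_mod_cast h4
  exact_mod_cast h5

end SimplePointMeasures

/-! ### Bernoulli random measures off their fixed atoms -/

section BernoulliLaw

open MeasurableSpace

variable {X : Type u} [MeasurableSpace X]

theorem IsBernoulliLaw.isProbabilityMeasure {ν : Measure X} {Q : Measure (Measure X)}
    (hQ : IsBernoulliLaw ν Q) : IsProbabilityMeasure Q := by
  obtain ⟨Ω', _, P', M, hP', ⟨M₁, M₂, V, h₁, h₂, -, -, -, -, -, hM⟩, rfl⟩ := hQ
  refine Measure.isProbabilityMeasure_map (Measurable.aemeasurable ?_)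
  refine Measure.measurable_of_measurable_coe _ fun s hs => ?_
  simp only [hM, Measure.add_apply]
  exact ((Measure.measurable_coe hs).comp h₁.measurable).add
    ((Measure.measurable_coe hs).comp h₂.measurable)

theorem measurable_restrict_measure {U : Set X} (hU : MeasurableSet U) :
    Measurable fun μ : Measure X => μ.restrict U := by
  refine Measure.measurable_of_measurable_coe _ fun s hs => ?_
  simp only [Measure.restrict_apply hs]
  exact Measure.measurable_coe (hs.inter hU)

/-- On a set without fixed atoms, a Bernoulli random measure is a Poisson random measure. -/
theorem IsBernoulliLaw.restrict [CountablyGenerated X] [MeasurableSingletonClass X]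
    {ν : Measure X} {Q : Measure (Measure X)} (hQ : IsBernoulliLaw ν Q) {U : Set X}
    (hU : MeasurableSet U) (ρ : Measure X) [IsFiniteMeasure ρ] (hρ : ∀ x, ρ {x} = 0)
    (hνρ : ∀ D ⊆ U, MeasurableSet D → ν D = ρ D) :
    Q {μ | μ.restrict U ∈ simpleMeasures X}ᶜ = 0 ∧
      ∀ D ⊆ U, MeasurableSet D → ∀ j : ℕ,
        Q {μ | μ D = j} = poissonMeasure (ρ D).toNNReal {j} := by
  obtain ⟨Ω', _, P', M, hP', ⟨M₁, M₂, V, h₁, h₂, -, -, -, hV, -, hM⟩, rfl⟩ := hQ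
  have hMm : Measurable M := by
    refine Measure.measurable_of_measurable_coe _ fun s hs => ?_
    simp only [hM, Measure.add_apply]
    exact ((Measure.measurable_coe hs).comp h₁.measurable).add
      ((Measure.measurable_coe hs).comp h₂.measurable)
  have hνU : ∀ x ∈ U, ν {x} = 0 := fun x hx => by
    rw [hνρ {x} (by simpa using hx) (measurableSet_singleton x), hρ x]
  -- The Bernoulli part charges atoms of ν only, and U contains none.
  have hM₂U : ∀ ω, M₂ ω U = 0 := fun ω => by
    rw [hV, Measure.sum_apply _ hU]
    refine ENNReal.tsum_eq_zero.2 fun x => ?_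
    by_cases hω : ω ∈ V x
    · rw [Set.indicator_of_mem hω, Measure.dirac_apply' _ hU,
        Set.indicator_of_notMem fun hx => x.2 (hνU x.1 hx)]
    · rw [Set.indicator_of_notMem hω]
      rfl
  have hMU : ∀ ω, ∀ D ⊆ U, M ω D = M₁ ω D := fun ω D hD => by
    rw [hM, Measure.add_apply, measure_mono_null hD (hM₂U ω), add_zero]
  have hdiff : ∀ D ⊆ U, MeasurableSet D → diffusePart ν D = ρ D := fun D hD hDm => by
    rw [diffusePart, Measure.restrict_apply hDm, ← hνρ D hD hDm]
    congr 1
    exact Set.inter_eq_left.2 fun x hx => hνU x (hD hx)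
  have hlaw : ∀ D ⊆ U, MeasurableSet D → P'.map (fun ω => M₁ ω D) =
      (poissonMeasure (ρ D).toNNReal).map (fun n : ℕ => (n : ℝ≥0∞)) := fun D hD hDm => by
    rw [h₁.law D hDm, hdiff D hD hDm]
  constructor
  · have hae := ae_mem_simpleMeasures (P := P') (M := fun ω => (M₁ ω).restrict U)
      ((measurable_restrict_measure hU).comp h₁.measurable) (ρ.restrict U)
      (fun x => le_antisymm ((Measure.restrict_le_self {x}).trans (hρ x).le) zero_le)
      fun B hB => by
        simp only [Measure.restrict_apply hB]
        exact hlaw _ Set.inter_subset_right (hB.inter hU)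
    have hms : MeasurableSet {μ : Measure X | μ.restrict U ∈ simpleMeasures X} :=
      (measurable_restrict_measure hU) measurableSet_simpleMeasures
    rw [Measure.map_apply hMm hms.compl]
    rw [ae_iff] at hae
    refine measure_mono_null (fun ω hω => ?_) hae
    have e : (M ω).restrict U = (M₁ ω).restrict U := by
      ext s hs
      rw [Measure.restrict_apply hs, Measure.restrict_apply hs, hMU ω _ Set.inter_subset_right]
    change ¬ (M₁ ω).restrict U ∈ simpleMeasures X
    rw [← e]
    exact hω
  · intro D hD hDm j
    have hD1 : Measurable fun ω => M₁ ω D := (Measure.measurable_coe hDm).comp h₁.measurable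
    have h := congrArg (fun μ => μ {(j : ℝ≥0∞)}) (hlaw D hD hDm)
    simp only [Measure.map_apply hD1 (measurableSet_singleton _),
      Measure.map_apply measurable_from_nat (measurableSet_singleton _)] at h
    have e1 : (fun n : ℕ => (n : ℝ≥0∞)) ⁻¹' {(j : ℝ≥0∞)} = {j} := by
      ext n
      simp
    rw [e1] at h
    have hset : MeasurableSet {μ : Measure X | μ D = j} :=
      Measure.measurable_coe hDm (measurableSet_singleton _)
    rw [← h, Measure.map_apply hMm hset]
    congr 1
    ext ω
    change M ω D = j ↔ M₁ ω D = j
    rw [hMU ω D hD]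

/-- It suffices to know the value on S of every law `BeP(ν ω)` with ω in A. The measurability of κ
on S comes from its agreement with a conditional expectation. -/
theorem CondBernoulli.measure_inter {Ω : Type v} {𝒢 mΩ : MeasurableSpace Ω} {P : Measure Ω}
    [IsProbabilityMeasure P] (h𝒢 : 𝒢 ≤ mΩ) {M ν : Ω → Measure X} (hM : Measurable M)
    (h : CondBernoulli P 𝒢 M ν) {A : Set Ω} (hA : MeasurableSet[𝒢] A) {S : Set (Measure X)}
    (hS : MeasurableSet S) {g : Ω → ℝ≥0∞}
    (hg : ∀ᵐ ω ∂P, ω ∈ A → ∀ Q, IsBernoulliLaw (ν ω) Q → Q S = g ω) :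
    P (A ∩ M ⁻¹' S) = ∫⁻ ω in A, g ω ∂P := by
  obtain ⟨κ, hκ, hcond⟩ := h
  have hMS := hM hS
  have hint : Integrable ((M ⁻¹' S).indicator fun _ => (1 : ℝ)) P :=
    (integrable_const 1).indicator hMS
  have hκi : Integrable (fun ω => (κ ω).real S) P := integrable_condExp.congr (hcond S hS)
  have h1 : P.real (A ∩ M ⁻¹' S) = ∫ ω in A, (κ ω).real S ∂P := by
    rw [← setIntegral_congr_ae (h𝒢 A hA) ((hcond S hS).mono fun ω hω _ => hω),
      setIntegral_condExp h𝒢 hint hA, setIntegral_indicator hMS]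
    simp
  rw [← ofReal_measureReal, h1, ofReal_integral_eq_lintegral_ofReal hκi.integrableOn
    (ae_of_all _ fun ω => measureReal_nonneg)]
  refine setLIntegral_congr_fun_ae (h𝒢 A hA) ?_
  filter_upwards [hκ, hg] with ω h2 h3 hω
  have := h2.isProbabilityMeasure
  rw [ofReal_measureReal, h3 hω _ h2]

end BernoulliLaw

/-! ### The filtration of the customers -/

section History

variable {Ω : Type v} {X : Type u} [MeasurableSpace X] {M : ℕ → Ω → Measure X} {R : ℕ → Ω → ℝ}

theorem history_mono : Monotone (history M R) := fun _ _ hnk =>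
  biSup_mono fun _ hi => Finset.Icc_subset_Icc_right hnk hi

theorem measurable_history_measure {n i : ℕ} (hi : i ∈ Finset.Icc 1 n) :
    Measurable[history M R n] (M i) :=
  measurable_iff_comap_le.2 (le_sup_left.trans (le_biSup (fun i =>
    MeasurableSpace.comap (M i) inferInstance ⊔ MeasurableSpace.comap (R i) inferInstance) hi))

theorem measurable_history_weight {n i : ℕ} (hi : i ∈ Finset.Icc 1 n) :
    Measurable[history M R n] (R i) :=
  measurable_iff_comap_le.2 (le_sup_right.trans (le_biSup (fun i =>
    MeasurableSpace.comap (M i) inferInstance ⊔ MeasurableSpace.comap (R i) inferInstance) hi))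

variable [mΩ : MeasurableSpace Ω] {P : Measure Ω} {m : Measure X} {α β c : ℝ}

theorem IsWeightedIBP.history_le (hMR : IsWeightedIBP P M R m α β c) (n : ℕ) :
    history M R n ≤ mΩ :=
  iSup₂_le fun i hi => sup_le
    (hMR.randomMeasure i (Finset.mem_Icc.1 hi).1).measurable.comap_le
    (hMR.measurable_weight i (Finset.mem_Icc.1 hi).1).comap_le

/-- The history of the customers as a filtration. -/
def IsWeightedIBP.filtration (hMR : IsWeightedIBP P M R m α β c) : Filtration ℕ mΩ where
  seq := history M R
  mono' := history_mono
  le' := hMR.history_le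

end History

/-! ### Counting atoms -/

section Counting

variable {X : Type u} [MeasurableSpace X] [MeasurableSingletonClass X]

theorem finite_dishes {Ω : Type v} {M : ℕ → Ω → Measure X} {n : ℕ} {ω : Ω}
    (hfin : ∀ i ∈ Finset.Icc 1 n, IsFiniteMeasure (M i ω)) : (dishes M n ω).Finite := by
  have e : dishes M n ω = ⋃ i ∈ Finset.Icc 1 n, {x | M i ω {x} = 1} := by
    ext x
    simp [dishes]
  rw [e]
  refine (Finset.finite_toSet _).biUnion fun i hi => ?_
  have := hfin i (Finset.mem_coe.1 hi)
  exact finite_atoms (M i ω)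

theorem measure_eq_ncard_atoms {μ : Measure X} [IsFiniteMeasure μ] {D : Set X}
    (h : μ (D \ {x | μ {x} = 1}) = 0) : μ D = ((D ∩ {x | μ {x} = 1}).ncard : ℝ≥0∞) := by
  have hfin : (D ∩ {x | μ {x} = 1}).Finite := (finite_atoms μ).subset Set.inter_subset_right
  have h1 : μ D = μ (D ∩ {x | μ {x} = 1}) := by
    rw [← measure_inter_add_sdiff D (finite_atoms μ).measurableSet, h, add_zero]
  rw [h1, Set.ncard_eq_toFinset_card _ hfin]
  have h2 := sum_measure_singleton (μ := μ) (s := hfin.toFinset)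
  rw [Set.Finite.coe_toFinset] at h2
  rw [← h2, Finset.sum_congr rfl fun x hx => ((Set.Finite.mem_toFinset _).1 hx).2]
  simp

end Counting

/-! ### Exhausting the untried dishes by vacant cells -/

section VacantCells

open MeasurableSpace

variable {Ω : Type v} {X : Type u} [MeasurableSpace X] [CountablyGenerated X]
  {M : ℕ → Ω → Measure X} {R : ℕ → Ω → ℝ}

variable (X) in
/-- The cells of the `k`-th partition. -/
noncomputable def cells (k : ℕ) : Finset (Set X) := (finite_countablePartition X k).toFinset

theorem mem_cells {k : ℕ} {C : Set X} : C ∈ cells X k ↔ C ∈ countablePartition X k :=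
  Set.Finite.mem_toFinset _

theorem measurableSet_of_mem_cells {k : ℕ} {C : Set X} (hC : C ∈ cells X k) : MeasurableSet C :=
  measurableSet_countablePartition k (mem_cells.1 hC)

/-- The cells of the `k`-th partition without any mass of the first `n` customers. -/
noncomputable def vacantCells (M : ℕ → Ω → Measure X) (n k : ℕ) (ω : Ω) : Finset (Set X) :=
  ((finite_countablePartition X k).subset
    (Set.sep_subset _ fun C => ∀ i ∈ Finset.Icc 1 n, M i ω C = 0)).toFinset

theorem mem_vacantCells {n k : ℕ} {ω : Ω} {C : Set X} :
    C ∈ vacantCells M n k ω ↔ C ∈ cells X k ∧ ∀ i ∈ Finset.Icc 1 n, M i ω C = 0 := by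
  rw [vacantCells, Set.Finite.mem_toFinset, mem_cells]
  rfl

/-- The union of the vacant cells. -/
def vacantSet (M : ℕ → Ω → Measure X) (n k : ℕ) (ω : Ω) : Set X :=
  ⋃ C ∈ vacantCells M n k ω, C

theorem vacantCells_mem_powerset (n k : ℕ) (ω : Ω) :
    vacantCells M n k ω ∈ (cells X k).powerset :=
  Finset.mem_powerset.2 fun _ hC => (mem_vacantCells.1 hC).1

theorem measurableSet_biUnion_cells {k : ℕ} {Q : Finset (Set X)} (hQ : Q ∈ (cells X k).powerset) :
    MeasurableSet (⋃ C ∈ Q, C) :=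
  Finset.measurableSet_biUnion _ fun _ hC =>
    measurableSet_of_mem_cells (Finset.mem_powerset.1 hQ hC)

theorem measurableSet_vacantSet (n k : ℕ) (ω : Ω) : MeasurableSet (vacantSet M n k ω) :=
  measurableSet_biUnion_cells (vacantCells_mem_powerset n k ω)

theorem mem_vacantSet {n k : ℕ} {ω : Ω} {x : X} :
    x ∈ vacantSet M n k ω ↔ ∀ i ∈ Finset.Icc 1 n, M i ω (countablePartitionSet k x) = 0 := by
  simp only [vacantSet, Set.mem_iUnion, mem_vacantCells, exists_prop, mem_cells]
  constructor
  · rintro ⟨C, ⟨hC, h⟩, hx⟩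
    rwa [countablePartitionSet_of_mem hC hx]
  · exact fun h => ⟨_, ⟨countablePartitionSet_mem k x, h⟩, mem_countablePartitionSet k x⟩

theorem vacantSet_mono (n : ℕ) (ω : Ω) : Monotone fun k => vacantSet M n k ω :=
  monotone_nat_of_le_succ fun k x hx => by
    rw [mem_vacantSet] at hx ⊢
    exact fun i hi => measure_mono_null (countablePartitionSet_succ_subset k x) (hx i hi)

theorem disjoint_vacantSet_dishes (n k : ℕ) (ω : Ω) :
    Disjoint (vacantSet M n k ω) (dishes M n ω) :=
  Set.disjoint_left.2 fun x hx ⟨i, hi, h1⟩ => by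
    have h0 := measure_mono_null (Set.singleton_subset_iff.2 (mem_countablePartitionSet k x))
      (mem_vacantSet.1 hx i hi)
    rw [h0] at h1
    exact zero_ne_one h1

/-- A point off the finite set of dishes is separated from it by a small enough cell, and that cell
is vacant since the measures live on the dishes. -/
theorem iUnion_vacantSet [MeasurableSingletonClass X] {n : ℕ} {ω : Ω}
    (hfin : (dishes M n ω).Finite) (h : ∀ i ∈ Finset.Icc 1 n, M i ω (dishes M n ω)ᶜ = 0) :
    ⋃ k, vacantSet M n k ω = (dishes M n ω)ᶜ := by
  refine Set.Subset.antisymm (Set.iUnion_subset fun k => Set.subset_compl_iff_disjoint_right.2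
    (disjoint_vacantSet_dishes n k ω)) fun x hx => ?_
  have hev : ∀ y ∈ dishes M n ω, ∀ᶠ k in atTop, y ∉ countablePartitionSet k x := fun y hy => by
    have hne : y ∉ ⋂ k, countablePartitionSet k x := by
      rw [iInter_countablePartitionSet]
      rintro rfl
      exact hx hy
    rw [Set.mem_iInter, not_forall] at hne
    obtain ⟨k₀, hk₀⟩ := hne
    filter_upwards [eventually_ge_atTop k₀] with k hk hy'
    exact hk₀ (antitone_countablePartitionSet x hk hy')
  obtain ⟨k, hk⟩ := ((eventually_all_finite hfin).2 hev).exists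
  refine Set.mem_iUnion.2 ⟨k, mem_vacantSet.2 fun i hi => measure_mono_null ?_ (h i hi)⟩
  exact fun y hy hy' => hk y hy' hy

/-- The vacant cells take finitely many values, each on an event of the history: statements about
the random set `vacantSet` reduce to finitely many deterministic sets. -/
theorem measurableSet_vacantCells_eq (n k : ℕ) (Q : Finset (Set X)) :
    MeasurableSet[history M R n] {ω | vacantCells M n k ω = Q} := by
  classical
  have e : {ω | vacantCells M n k ω = Q} = {_ω | Q ⊆ cells X k} ∩
      ⋂ C ∈ cells X k, {ω | C ∈ Q ↔ ∀ i ∈ Finset.Icc 1 n, M i ω C = 0} := by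
    ext ω
    simp only [Set.mem_ofPred_eq, Set.mem_inter_iff, Set.mem_iInter]
    constructor
    · rintro rfl
      exact ⟨fun C hC => (mem_vacantCells.1 hC).1, fun C hC => by simp [mem_vacantCells, hC]⟩
    · rintro ⟨h1, h2⟩
      ext C
      rw [mem_vacantCells]
      exact ⟨fun h => (h2 C h.1).2 h.2, fun h => ⟨h1 h, (h2 C (h1 h)).1 h⟩⟩
  rw [e]
  refine (MeasurableSet.const _).inter (Finset.measurableSet_biInter _ fun C hC => ?_)
  have hE : MeasurableSet[history M R n] {ω | ∀ i ∈ Finset.Icc 1 n, M i ω C = 0} := by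
    have e2 : {ω | ∀ i ∈ Finset.Icc 1 n, M i ω C = 0} =
        ⋂ i ∈ Finset.Icc 1 n, (fun ω => M i ω C) ⁻¹' {0} := by
      ext ω
      simp
    rw [e2]
    exact Finset.measurableSet_biInter _ fun i hi =>
      ((Measure.measurable_coe (measurableSet_of_mem_cells hC)).comp
        (measurable_history_measure hi)) (measurableSet_singleton 0)
  by_cases hCQ : C ∈ Q
  · simpa only [hCQ, true_iff] using hE
  · simp only [hCQ, false_iff]
    exact hE.compl

theorem measurable_comp_vacantCells {𝒢 : MeasurableSpace Ω} {E : Type*} [MeasurableSpace E]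
    {n k : ℕ} (h𝒢 : history M R n ≤ 𝒢) {f : Finset (Set X) → Ω → E}
    (hf : ∀ Q ∈ (cells X k).powerset, Measurable[𝒢] (f Q)) :
    Measurable[𝒢] fun ω => f (vacantCells M n k ω) ω := fun s hs => by
  have e : (fun ω => f (vacantCells M n k ω) ω) ⁻¹' s = ⋃ Q ∈ (cells X k).powerset,
      ({ω | vacantCells M n k ω = Q} ∩ f Q ⁻¹' s) := by
    ext ω
    simp only [Set.mem_preimage, Set.mem_iUnion, exists_prop, Set.mem_inter_iff,
      Set.mem_ofPred_eq]
    constructor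
    · exact fun h => ⟨_, vacantCells_mem_powerset n k ω, rfl, h⟩
    · rintro ⟨Q, -, rfl, h⟩
      exact h
  rw [e]
  exact Finset.measurableSet_biUnion _ fun Q hQ =>
    (h𝒢 _ (measurableSet_vacantCells_eq n k Q)).inter (hf Q hQ hs)

end VacantCells

/-! ### Finiteness of the set of dishes -/

section FiniteDishes

variable {Ω : Type v} {X : Type u} [MeasurableSpace X] {M : ℕ → Ω → Measure X} {R : ℕ → Ω → ℝ}
  {m : Measure X} {α β c : ℝ} [mΩ : MeasurableSpace Ω] {P : Measure Ω}

theorem IsWeightedIBP.isFiniteMeasure (hMR : IsWeightedIBP P M R m α β c) {n i : ℕ}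
    (hi : i ∈ Finset.Icc 1 n) (ω : Ω) : IsFiniteMeasure (M i ω) :=
  (hMR.randomMeasure i (Finset.mem_Icc.1 hi).1).finite ω

theorem IsWeightedIBP.finite_dishes [MeasurableSingletonClass X]
    (hMR : IsWeightedIBP P M R m α β c) (n : ℕ) (ω : Ω) : (dishes M n ω).Finite :=
  WeightedIBP.finite_dishes fun _ hi => hMR.isFiniteMeasure hi ω

end FiniteDishes

/-! ### Conditional law of the next customer on the vacant cells -/

section OneStep

open MeasurableSpace

variable {Ω : Type v} {X : Type u} [MeasurableSpace X] {M : ℕ → Ω → Measure X} {R : ℕ → Ω → ℝ}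
  {m : Measure X} {α β c : ℝ}

/-- The Dirac masses of the hazard sit at dishes already tried, so only the multiple of m is seen by
D. -/
theorem hazard_apply_of_disjoint {n : ℕ} {ω : Ω} {D : Set X} (hD : MeasurableSet D)
    (hdisj : Disjoint D (dishes M n ω)) :
    hazard M R m α β c n ω D = (ENNReal.ofReal (newDishRate R α β c n ω) • m) D := by
  rw [hazard, Measure.add_apply, Measure.sum_apply _ hD, ENNReal.tsum_eq_zero.2, zero_add]
  intro x
  rw [Measure.smul_apply, Measure.dirac_apply' _ hD,
    Set.indicator_of_notMem fun hx => Set.disjoint_left.1 hdisj hx x.2, smul_zero]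

variable [CountablyGenerated X] [MeasurableSingletonClass X] [IsProbabilityMeasure m]

theorem hazard_bernoulliLaw (hm : ∀ x, m {x} = 0) {n k : ℕ} {ω : Ω} {Q : Measure (Measure X)}
    (hQ : IsBernoulliLaw (hazard M R m α β c n ω) Q) :
    Q {μ | μ.restrict (vacantSet M n k ω) ∈ simpleMeasures X}ᶜ = 0 ∧
      ∀ D ⊆ vacantSet M n k ω, MeasurableSet D → ∀ j : ℕ, Q {μ | μ D = j} =
        poissonMeasure ((ENNReal.ofReal (newDishRate R α β c n ω) • m) D).toNNReal {j} :=
  have : IsFiniteMeasure (ENNReal.ofReal (newDishRate R α β c n ω) • m) :=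
    m.smul_finite ENNReal.ofReal_ne_top
  hQ.restrict (measurableSet_vacantSet n k ω) _ (fun x => by simp [hm x])
    fun _ hD hDm => hazard_apply_of_disjoint hDm
      ((disjoint_vacantSet_dishes n k ω).mono_left hD)

variable [mΩ : MeasurableSpace Ω] {P : Measure Ω} [IsProbabilityMeasure P]

namespace IsWeightedIBP

theorem ae_restrict_vacantSet_mem (hMR : IsWeightedIBP P M R m α β c) (hm : ∀ x, m {x} = 0)
    (n k : ℕ) : ∀ᵐ ω ∂P, (M (n + 1) ω).restrict (vacantSet M n k ω) ∈ simpleMeasures X := by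
  have hM := (hMR.randomMeasure (n + 1) (Nat.le_add_left 1 n)).measurable
  have hQ : ∀ Q ∈ (cells X k).powerset, P ({ω | vacantCells M n k ω = Q} ∩
      M (n + 1) ⁻¹' {μ | μ.restrict (⋃ C ∈ Q, C) ∈ simpleMeasures X}ᶜ) = 0 := fun Q hQ => by
    have hms : MeasurableSet {μ : Measure X | μ.restrict (⋃ C ∈ Q, C) ∈ simpleMeasures X} :=
      (measurable_restrict_measure (measurableSet_biUnion_cells hQ)) measurableSet_simpleMeasures
    have hzero : ∀ ω, ω ∈ {ω | vacantCells M n k ω = Q} → ∀ Q',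
        IsBernoulliLaw (hazard M R m α β c n ω) Q' →
          Q' {μ | μ.restrict (⋃ C ∈ Q, C) ∈ simpleMeasures X}ᶜ = 0 := fun ω hω Q' hQ' => by
      have h := (hazard_bernoulliLaw (k := k) hm hQ').1
      have hω' : vacantCells M n k ω = Q := hω
      rw [vacantSet, hω'] at h
      exact h
    have h := (hMR.condLaw n).measure_inter (hMR.history_le n) hM
      (measurableSet_vacantCells_eq n k Q) hms.compl (g := fun _ => 0) (ae_of_all _ hzero)
    rw [h, lintegral_zero]
  rw [ae_iff]
  refine measure_mono_null (fun ω hω => ?_)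
    ((measure_biUnion_null_iff (Finset.countable_toSet _)).2 hQ)
  have hω' : (M (n + 1) ω).restrict (⋃ C ∈ vacantCells M n k ω, C) ∉ simpleMeasures X := hω
  simp only [Set.mem_iUnion, exists_prop]
  exact ⟨_, Finset.mem_coe.2 (vacantCells_mem_powerset n k ω), rfl, hω'⟩

/-- The conditional Poisson law at partition level k: on each event where the vacant cells equal Q,
the set is deterministic and the Bernoulli law is Poisson there. -/
theorem measure_inter_vacantSet_eq (hMR : IsWeightedIBP P M R m α β c) (hm : ∀ x, m {x} = 0)
    {B : Set X} (hB : MeasurableSet B) (n k j : ℕ) {A : Set Ω}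
    (hA : MeasurableSet[history M R n] A) :
    P (A ∩ {ω | M (n + 1) ω (B ∩ vacantSet M n k ω) = j}) =
      ∫⁻ ω in A, poissonMeasure ((ENNReal.ofReal (newDishRate R α β c n ω) • m)
        (B ∩ vacantSet M n k ω)).toNNReal {j} ∂P := by
  have hM := (hMR.randomMeasure (n + 1) (Nat.le_add_left 1 n)).measurable
  set A' : Finset (Set X) → Set Ω := fun Q => A ∩ {ω | vacantCells M n k ω = Q} with hA'
  set S : Finset (Set X) → Set (Measure X) := fun Q => {μ | μ (B ∩ ⋃ C ∈ Q, C) = j} with hS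
  have hAm : ∀ Q, MeasurableSet[history M R n] (A' Q) := fun Q =>
    hA.inter (measurableSet_vacantCells_eq n k Q)
  have hSm : ∀ Q ∈ (cells X k).powerset, MeasurableSet (S Q) := fun Q hQ =>
    Measure.measurable_coe (hB.inter (measurableSet_biUnion_cells hQ)) (measurableSet_singleton _)
  have hdisj : ∀ s : Set (Finset (Set X)), s.PairwiseDisjoint A' := fun s Q _ Q' _ hne =>
    Set.disjoint_left.2 fun ω h1 h2 => hne (h1.2.symm.trans h2.2)
  have e1 : A ∩ {ω | M (n + 1) ω (B ∩ vacantSet M n k ω) = j} =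
      ⋃ Q ∈ (cells X k).powerset, (A' Q ∩ M (n + 1) ⁻¹' S Q) := by
    ext ω
    simp only [Set.mem_iUnion, exists_prop]
    constructor
    · exact fun h => ⟨_, vacantCells_mem_powerset n k ω, ⟨h.1, rfl⟩, h.2⟩
    · rintro ⟨Q, -, ⟨h1, h2⟩, h3⟩
      have h2' : vacantCells M n k ω = Q := h2
      refine ⟨h1, ?_⟩
      change M (n + 1) ω (B ∩ vacantSet M n k ω) = j
      rw [vacantSet, h2']
      exact h3
  have e2 : A = ⋃ Q ∈ (cells X k).powerset, A' Q := by
    ext ω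
    simp only [Set.mem_iUnion, exists_prop]
    exact ⟨fun h => ⟨_, vacantCells_mem_powerset n k ω, h, rfl⟩, fun ⟨Q, _, h⟩ => h.1⟩
  rw [e1, measure_biUnion_finset (fun Q hQ Q' hQ' hne => (hdisj Set.univ trivial trivial hne).mono
    Set.inter_subset_left Set.inter_subset_left)
    fun Q hQ => (hMR.history_le n _ (hAm Q)).inter (hM (hSm Q hQ))]
  conv_rhs => rw [e2]
  rw [lintegral_biUnion_finset (hdisj _) fun Q _ => hMR.history_le n _ (hAm Q)]
  refine Finset.sum_congr rfl fun Q hQ => ?_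
  refine (hMR.condLaw n).measure_inter (hMR.history_le n) hM (hAm Q) (hSm Q hQ)
    (ae_of_all _ fun ω hω Q' hQ' => ?_)
  have h := (hazard_bernoulliLaw (k := k) hm hQ').2 (B ∩ vacantSet M n k ω) Set.inter_subset_right
    (hB.inter (measurableSet_vacantSet n k ω)) j
  have hω' : vacantCells M n k ω = Q := hω.2
  rw [← h]
  simp only [hS, vacantSet, hω']

end IsWeightedIBP


end OneStep

/-! ### Conditional law of the number of new dishes -/

section NewDishes

variable {Ω : Type v} {X : Type u} [MeasurableSpace X] {M : ℕ → Ω → Measure X} {R : ℕ → Ω → ℝ}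
  {m : Measure X} {α β c : ℝ}

/-- The number of the new dishes in `B` of customer `n + 1`. -/
noncomputable def newDishCount (M : ℕ → Ω → Measure X) (B : Set X) (n : ℕ) (ω : Ω) : ℕ :=
  ((B \ dishes M n ω) ∩ {x | M (n + 1) ω {x} = 1}).ncard

theorem dishes_succ (n : ℕ) (ω : Ω) :
    dishes M (n + 1) ω = dishes M n ω ∪ {x | M (n + 1) ω {x} = 1} := by
  ext x
  simp only [dishes, Set.mem_ofPred_eq, Set.mem_union, Finset.mem_Icc]
  constructor
  · rintro ⟨i, ⟨h1, h2⟩, h⟩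
    rcases Nat.lt_or_ge n i with hi | hi
    · obtain rfl : i = n + 1 := by omega
      exact Or.inr h
    · exact Or.inl ⟨i, ⟨h1, hi⟩, h⟩
  · rintro (⟨i, ⟨h1, h2⟩, h⟩ | h)
    · exact ⟨i, ⟨h1, by omega⟩, h⟩
    · exact ⟨n + 1, ⟨by omega, le_rfl⟩, h⟩

theorem dishCount_eq_sum {B : Set X} {ω : Ω} (hfin : ∀ n, (dishes M n ω).Finite) (n : ℕ) :
    dishCount M B n ω = ∑ j ∈ Finset.range n, newDishCount M B j ω := by
  induction n with
  | zero =>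
    have : dishes M 0 ω = ∅ := by
      ext x
      simp [dishes]
    simp [dishCount, this]
  | succ n ih =>
    rw [Finset.sum_range_succ, ← ih, dishCount, dishCount, newDishCount]
    have e : B ∩ dishes M (n + 1) ω = (B ∩ dishes M n ω) ∪
        ((B \ dishes M n ω) ∩ {x | M (n + 1) ω {x} = 1}) := by
      rw [dishes_succ]
      ext x
      simp only [Set.mem_inter_iff, Set.mem_union, Set.mem_sdiff]
      tauto
    rw [e]
    refine Set.ncard_union_eq (Set.disjoint_left.2 fun x h1 h2 => h2.1.2 h1.2)
      ((hfin n).subset Set.inter_subset_right) ((hfin (n + 1)).subset fun x hx => ?_)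
    rw [dishes_succ]
    exact Or.inr hx.2

/-- The mean number of the new dishes in `B` of customer `n + 1`. -/
noncomputable def dishRate (R : ℕ → Ω → ℝ) (m : Measure X) (α β c : ℝ) (B : Set X) (n : ℕ)
    (ω : Ω) : ℝ≥0 :=
  Real.toNNReal (weightRate α β c (max (totalWeight R n ω) 0)) * (m B).toNNReal

/-- The total weight is nonnegative only almost surely; its truncation at 0 keeps the arguments of
the Gamma functions positive, so the rate is everywhere a continuous function of the weight. -/
theorem measurable_dishRate (hβ₁ : β < 1) (hc : -β < c) (B : Set X) (n : ℕ) :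
    Measurable[history M R n] (dishRate R m α β c B n) := by
  have h1 : Measurable[history M R n] (totalWeight R n) :=
    Finset.measurable_fun_sum _ fun i hi => measurable_history_weight hi
  have h2 : Continuous fun T : ℝ => weightRate α β c (max T 0) :=
    (continuousOn_weightRate hβ₁ hc).comp_continuous (by fun_prop) fun T => le_max_right T 0
  exact ((h2.measurable.comp h1).real_toNNReal).mul_const _

variable [MeasurableSpace.CountablyGenerated X]

theorem measurable_measure_inter_vacantSet {𝒢 : MeasurableSpace Ω} {B : Set X}
    (hB : MeasurableSet B) {n : ℕ} (h𝒢 : history M R n ≤ 𝒢) {κ : Ω → Measure X}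
    (hκ : Measurable[𝒢] κ) (k : ℕ) : Measurable[𝒢] fun ω => κ ω (B ∩ vacantSet M n k ω) :=
  measurable_comp_vacantCells h𝒢 (f := fun Q ω => κ ω (B ∩ ⋃ C ∈ Q, C)) fun _ hQ =>
    (Measure.measurable_coe (hB.inter (measurableSet_biUnion_cells hQ))).comp hκ

/-- A version of the number of the new dishes that is adapted to the history. -/
noncomputable def adaptedDishCount (M : ℕ → Ω → Measure X) (B : Set X) (n : ℕ) (ω : Ω) : ℕ :=
  ⌊(⨆ k, M (n + 1) ω (B ∩ vacantSet M n k ω)).toReal⌋₊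

/-- Counting atoms involves uncountably many evaluations, whereas the supremum over partition levels
is a countable operation on measurable functions. -/
theorem measurable_adaptedDishCount {B : Set X} (hB : MeasurableSet B) (n : ℕ) :
    Measurable[history M R (n + 1)] (adaptedDishCount M B n) :=
  Nat.measurable_floor.comp (Measurable.ennreal_toReal (Measurable.iSup fun k =>
    measurable_measure_inter_vacantSet hB (history_mono (R := R) n.le_succ)
      (measurable_history_measure (Finset.mem_Icc.2 ⟨by omega, le_rfl⟩)) k))

variable [MeasurableSingletonClass X]

theorem measure_vacantSet_diff_atoms_eq_zero {n k : ℕ} {ω : Ω} {μ : Measure X}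
    (h : μ.restrict (vacantSet M n k ω) ∈ simpleMeasures X) :
    μ (vacantSet M n k ω \ {x | μ {x} = 1}) = 0 := by
  have h1 := measure_compl_atoms_eq_zero h
  rw [Measure.restrict_apply' (measurableSet_vacantSet n k ω)] at h1
  suffices hsub : vacantSet M n k ω \ {x | μ {x} = 1} ⊆
      {x | μ.restrict (vacantSet M n k ω) {x} = 1}ᶜ ∩ vacantSet M n k ω from
    measure_mono_null hsub h1
  refine fun x hx => ⟨fun hx1 => hx.2 ?_, hx.1⟩
  have hx1' : μ.restrict (vacantSet M n k ω) {x} = 1 := hx1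
  rwa [Measure.restrict_apply (measurableSet_singleton x),
    Set.inter_eq_left.2 (Set.singleton_subset_iff.2 hx.1)] at hx1'

/-- By induction: if the first n measures live on the dishes, the vacant sets exhaust the complement
of the dishes, and there the next measure consists of unit atoms, which are dishes of the next
stage. -/
theorem measure_compl_dishes_eq_zero {ω : Ω}
    (hfin : ∀ n, (dishes M n ω).Finite)
    (h : ∀ n k, (M (n + 1) ω).restrict (vacantSet M n k ω) ∈ simpleMeasures X) (n : ℕ) :
    ∀ i ∈ Finset.Icc 1 n, M i ω (dishes M n ω)ᶜ = 0 := by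
  induction n with
  | zero => simp
  | succ n ih =>
    intro i hi
    rw [Finset.mem_Icc] at hi
    rcases Nat.lt_or_ge n i with hni | hni
    · obtain rfl : i = n + 1 := by omega
      rw [dishes_succ, Set.compl_union, ← iUnion_vacantSet (hfin n) ih, Set.iUnion_inter]
      exact measure_iUnion_null fun k => measure_vacantSet_diff_atoms_eq_zero (h n k)
    · refine measure_mono_null (Set.compl_subset_compl.2 ?_) (ih i (Finset.mem_Icc.2 ⟨hi.1, hni⟩))
      rw [dishes_succ]
      exact Set.subset_union_left

theorem tendsto_measure_inter_vacantSet {ω : Ω} (hfin : ∀ n, (dishes M n ω).Finite)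
    (h : ∀ n k, (M (n + 1) ω).restrict (vacantSet M n k ω) ∈ simpleMeasures X) (B : Set X)
    (n : ℕ) (μ : Measure X) :
    Tendsto (fun k => μ (B ∩ vacantSet M n k ω)) atTop (𝓝 (μ (B \ dishes M n ω))) := by
  have e : B \ dishes M n ω = ⋃ k, B ∩ vacantSet M n k ω := by
    rw [← Set.inter_iUnion, iUnion_vacantSet (hfin n) (measure_compl_dishes_eq_zero hfin h n)]
    rfl
  rw [e]
  exact tendsto_measure_iUnion_atTop fun k l hkl =>
    Set.inter_subset_inter_right _ (vacantSet_mono n ω hkl)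

theorem measure_diff_dishes_eq_newDishCount {ω : Ω} (hfin : ∀ n, (dishes M n ω).Finite)
    (hfm : ∀ n, IsFiniteMeasure (M (n + 1) ω))
    (h : ∀ n k, (M (n + 1) ω).restrict (vacantSet M n k ω) ∈ simpleMeasures X) (B : Set X)
    (n : ℕ) : M (n + 1) ω (B \ dishes M n ω) = newDishCount M B n ω := by
  have := hfm n
  refine measure_eq_ncard_atoms (measure_mono_null ?_ (measure_compl_dishes_eq_zero hfin h (n + 1)
    (n + 1) (Finset.mem_Icc.2 ⟨by omega, le_rfl⟩)))
  intro x hx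
  rw [dishes_succ]
  exact fun hx' => hx'.elim hx.1.2 hx.2

/-- The masses are integers at most equal to their integer limit, hence eventually equal to it. -/
theorem eventually_measure_inter_vacantSet_eq {ω : Ω} (hfin : ∀ n, (dishes M n ω).Finite)
    (hfm : ∀ n, IsFiniteMeasure (M (n + 1) ω))
    (h : ∀ n k, (M (n + 1) ω).restrict (vacantSet M n k ω) ∈ simpleMeasures X) (B : Set X)
    (n : ℕ) : ∀ᶠ k in atTop, M (n + 1) ω (B ∩ vacantSet M n k ω) = newDishCount M B n ω := by
  have := hfm n
  have hlim := tendsto_measure_inter_vacantSet hfin h B n (M (n + 1) ω)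
  rw [measure_diff_dishes_eq_newDishCount hfin hfm h] at hlim
  have hlt : (newDishCount M B n ω : ℝ≥0∞) < newDishCount M B n ω + 1 := by
    exact_mod_cast Nat.lt_succ_self _
  filter_upwards [(hlim.add_const 1).eventually_const_lt hlt] with k hk
  have hle : M (n + 1) ω (B ∩ vacantSet M n k ω) ≤ newDishCount M B n ω := by
    rw [← measure_diff_dishes_eq_newDishCount hfin hfm h]
    exact measure_mono fun x hx => ⟨hx.1, Set.disjoint_left.1 (disjoint_vacantSet_dishes n k ω) hx.2⟩
  have hsub : (B ∩ vacantSet M n k ω) \ {x | M (n + 1) ω {x} = 1} ⊆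
      vacantSet M n k ω \ {x | M (n + 1) ω {x} = 1} := fun x hx => ⟨hx.1.2, hx.2⟩
  have hN := measure_eq_ncard_atoms
    (measure_mono_null hsub (measure_vacantSet_diff_atoms_eq_zero (h n k)))
  rw [hN] at hk hle ⊢
  have h1 : newDishCount M B n ω <
      (B ∩ vacantSet M n k ω ∩ {x | M (n + 1) ω {x} = 1}).ncard + 1 := by exact_mod_cast hk
  rw [le_antisymm (Nat.cast_le.1 hle) (Nat.lt_succ_iff.1 h1)]

variable [IsProbabilityMeasure m] [mΩ : MeasurableSpace Ω] {P : Measure Ω} [IsProbabilityMeasure P]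

theorem IsWeightedIBP.ae_simple (hMR : IsWeightedIBP P M R m α β c) (hm : ∀ x, m {x} = 0) :
    ∀ᵐ ω ∂P, ∀ n k, (M (n + 1) ω).restrict (vacantSet M n k ω) ∈ simpleMeasures X :=
  ae_all_iff.2 fun n => ae_all_iff.2 fun k => hMR.ae_restrict_vacantSet_mem hm n k

theorem IsWeightedIBP.ae_adaptedDishCount_eq (hMR : IsWeightedIBP P M R m α β c)
    (hm : ∀ x, m {x} = 0) (B : Set X) :
    ∀ᵐ ω ∂P, ∀ n, adaptedDishCount M B n ω = newDishCount M B n ω := by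
  filter_upwards [hMR.ae_simple hm] with ω h n
  have hfm : ∀ n, IsFiniteMeasure (M (n + 1) ω) := fun n =>
    (hMR.randomMeasure (n + 1) (by omega)).finite ω
  have hlim := tendsto_measure_inter_vacantSet (fun n => hMR.finite_dishes n ω) h B n (M (n + 1) ω)
  rw [measure_diff_dishes_eq_newDishCount (fun n => hMR.finite_dishes n ω) hfm h] at hlim
  have hsup := tendsto_atTop_iSup (f := fun k => M (n + 1) ω (B ∩ vacantSet M n k ω))
    fun k l hkl => measure_mono (Set.inter_subset_inter_right _ (vacantSet_mono n ω hkl))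
  rw [adaptedDishCount, tendsto_nhds_unique hsup hlim]
  simp

/-- Limit of the level k laws. On the left the events stabilise almost surely; on the right
dominated convergence applies, the masses under m tending to m(B \ S_n) = m(B) because S_n is finite
and m diffuse. -/
theorem IsWeightedIBP.isCondPoisson (hMR : IsWeightedIBP P M R m α β c) (hm : ∀ x, m {x} = 0)
    (hβ₁ : β < 1) (hc : -β < c) (hT : ∀ᵐ ω ∂P, ∀ n, 0 ≤ totalWeight R n ω) {B : Set X}
    (hB : MeasurableSet B) (n : ℕ) :
    IsCondPoisson (history M R n) P (adaptedDishCount M B n) (dishRate R m α β c B n) where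
  measurable := (measurable_adaptedDishCount (R := R) hB n).mono (hMR.history_le (n + 1)) le_rfl
  measurable_rate := measurable_dishRate hβ₁ hc B n
  law A hA j := by
    have hAm := hMR.history_le n A hA
    have hKm : Measurable (adaptedDishCount M B n) :=
      (measurable_adaptedDishCount (R := R) hB n).mono (hMR.history_le (n + 1)) le_rfl
    have hvm : ∀ k, Measurable fun ω => M (n + 1) ω (B ∩ vacantSet M n k ω) := fun k =>
      measurable_measure_inter_vacantSet hB (hMR.history_le n)
        (hMR.randomMeasure (n + 1) (by omega)).measurable k
    have hleft : Tendsto (fun k => P (A ∩ {ω | M (n + 1) ω (B ∩ vacantSet M n k ω) = j})) atTop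
        (𝓝 (P (A ∩ adaptedDishCount M B n ⁻¹' {j}))) := by
      refine tendsto_measure_of_ae_tendsto_indicator_of_isFiniteMeasure atTop
        (hAm.inter (hKm (measurableSet_singleton j)))
        (fun k => hAm.inter (hvm k (measurableSet_singleton _))) ?_
      filter_upwards [hMR.ae_simple hm, hMR.ae_adaptedDishCount_eq hm B] with ω h hK
      filter_upwards [eventually_measure_inter_vacantSet_eq (fun n => hMR.finite_dishes n ω)
        (fun n => (hMR.randomMeasure (n + 1) (by omega)).finite ω) h B n] with k hk
      simp only [Set.mem_inter_iff, Set.mem_ofPred_eq, hk, Set.mem_preimage, hK n,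
        Set.mem_singleton_iff, Nat.cast_inj]
    have hright : Tendsto (fun k => ∫⁻ ω in A, poissonMeasure
        ((ENNReal.ofReal (newDishRate R α β c n ω) • m) (B ∩ vacantSet M n k ω)).toNNReal {j} ∂P)
        atTop (𝓝 (∫⁻ ω in A, poissonMeasure (dishRate R m α β c B n ω) {j} ∂P)) := by
      have e : ∀ k, ∫⁻ ω in A, poissonMeasure ((ENNReal.ofReal (newDishRate R α β c n ω) • m)
          (B ∩ vacantSet M n k ω)).toNNReal {j} ∂P = ∫⁻ ω in A, poissonMeasure
          (Real.toNNReal (weightRate α β c (max (totalWeight R n ω) 0)) *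
            (m (B ∩ vacantSet M n k ω)).toNNReal) {j} ∂P := fun k => by
        refine lintegral_congr_ae (ae_restrict_of_ae ?_)
        filter_upwards [hT] with ω hω
        rw [max_eq_left (hω n), Measure.smul_apply, smul_eq_mul, ENNReal.toNNReal_mul]
        rfl
      simp only [e]
      refine tendsto_lintegral_of_dominated_convergence (fun _ => 1) (fun k => ?_)
        (fun k => ae_of_all _ fun ω => prob_le_one) (by simp) (ae_restrict_of_ae ?_)
      · have h1 : Measurable (totalWeight R n) :=
          Finset.measurable_fun_sum _ fun i hi =>
            hMR.measurable_weight i (Finset.mem_Icc.1 hi).1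
        have h2 : Continuous fun T : ℝ => weightRate α β c (max T 0) :=
          (continuousOn_weightRate hβ₁ hc).comp_continuous (by fun_prop) fun T => le_max_right T 0
        exact (measurable_poissonMeasure_singleton j).comp
          (((h2.measurable.comp h1).real_toNNReal).mul (measurable_measure_inter_vacantSet hB
            (hMR.history_le n) (measurable_const (a := m)) k).ennreal_toNNReal)
      · filter_upwards [hMR.ae_simple hm] with ω h
        have hlim := tendsto_measure_inter_vacantSet (fun n => hMR.finite_dishes n ω) h B n m
        have hmB : m (B \ dishes M n ω) = m B := by
          refine measure_sdiff_null ?_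
          rw [← Set.biUnion_of_singleton (dishes M n ω)]
          exact (measure_biUnion_null_iff (hMR.finite_dishes n ω).countable).2 fun x _ => hm x
        rw [hmB] at hlim
        have h3 := (ENNReal.tendsto_toNNReal (measure_ne_top m B)).comp hlim
        exact ((continuous_poissonMeasure_singleton j).tendsto _).comp (h3.const_mul _)
    refine tendsto_nhds_unique hleft (hright.congr fun k => ?_)
    exact (hMR.measure_inter_vacantSet_eq hm hB n k j hA).symm

end NewDishes

/-! ### Proof of the two limit theorems -/

section Asymptotics

open Finset Asymptotics

variable {Ω : Type v} {X : Type u} [MeasurableSpace X] {M : ℕ → Ω → Measure X} {R : ℕ → Ω → ℝ}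
  {m : Measure X} {α β c r u : ℝ} {B : Set X}

theorem totalWeight_eq_mul_meanWeight (n : ℕ) (ω : Ω) :
    totalWeight R n ω = n * meanWeight R n ω := by
  rcases Nat.eq_zero_or_pos n with rfl | hn
  · simp [totalWeight]
  · have : (n : ℝ) ≠ 0 := by positivity
    rw [meanWeight, mul_div_cancel₀ _ this]

theorem le_meanWeight {ω : Ω} (hR : ∀ n, 1 ≤ n → u ≤ R n ω) {n : ℕ} (hn : 1 ≤ n) :
    u ≤ meanWeight R n ω := by
  have hn' : (0 : ℝ) < n := by exact_mod_cast hn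
  rw [meanWeight, le_div_iff₀ hn', totalWeight]
  have h := Finset.card_nsmul_le_sum (Icc 1 n) (fun i => R i ω) u
    fun i hi => hR i (Finset.mem_Icc.1 hi).1
  rw [Nat.card_Icc, nsmul_eq_mul, Nat.add_sub_cancel] at h
  linarith

theorem totalWeight_nonneg (hu : 0 ≤ u) {ω : Ω} (hR : ∀ n, 1 ≤ n → u ≤ R n ω) (n : ℕ) :
    0 ≤ totalWeight R n ω :=
  sum_nonneg fun i hi => hu.trans (hR i (Finset.mem_Icc.1 hi).1)

theorem coe_dishRate (hα : 0 < α) (hβ₁ : β < 1) (hc : -β < c) (hu : 0 ≤ u) {ω : Ω}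
    (hR : ∀ n, 1 ≤ n → u ≤ R n ω) (n : ℕ) :
    (dishRate R m α β c B n ω : ℝ) = m.real B * weightRate α β c (n * meanWeight R n ω) := by
  have hT := totalWeight_nonneg hu hR n
  rw [dishRate, max_eq_left hT, ← totalWeight_eq_mul_meanWeight, NNReal.coe_mul,
    Real.coe_toNNReal _ (weightRate_nonneg hα hβ₁ hc hT), mul_comm]
  rfl

/-- Non-random majorants of the rates, with sums diverging but of the order of the norming sequence,
as the strong law and the central limit theorem demand. -/
theorem exists_dishRate_le [IsProbabilityMeasure m] (hα : 0 < α) (hβ₀ : 0 ≤ β) (hβ₁ : β < 1)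
    (hc : -β < c) (hu : 0 < u) (R : ℕ → Ω → ℝ) (B : Set X) :
    ∃ w : ℕ → ℝ≥0, (∀ ω, (∀ n, 1 ≤ n → u ≤ R n ω) → ∀ n, dishRate R m α β c B n ω ≤ w n) ∧
      Tendsto (fun n => ∑ j ∈ range n, (w j : ℝ)) atTop atTop ∧
      (fun n => ∑ j ∈ range n, (w j : ℝ)) =O[atTop] normSeq β := by
  obtain ⟨C, hC, h⟩ := exists_weightRate_le hα hβ₀ hβ₁ hc hu
  have hw : ∀ n : ℕ, 0 ≤ C * ((n : ℝ) + 1) ^ (β - 1) := fun n => by positivity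
  refine ⟨fun n => (C * ((n : ℝ) + 1) ^ (β - 1)).toNNReal, fun ω hR n => ?_, ?_, ?_⟩
  · rw [← NNReal.coe_le_coe, coe_dishRate hα hβ₁ hc hu.le hR, Real.coe_toNNReal _ (hw n)]
    have h1 : 0 ≤ weightRate α β c (n * meanWeight R n ω) := by
      rw [← totalWeight_eq_mul_meanWeight]
      exact weightRate_nonneg hα hβ₁ hc (totalWeight_nonneg hu.le hR n)
    exact (mul_le_of_le_one_left h1 measureReal_le_one).trans
      (h n _ fun hn => le_meanWeight hR hn)
  · simp only [Real.coe_toNNReal _ (hw _), ← mul_sum]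
    exact (tendsto_sum_rpow hβ₀ hβ₁).const_mul_atTop hC
  · simp only [Real.coe_toNNReal _ (hw _), ← mul_sum]
    exact (isBigO_sum_rpow_normSeq hβ₀ hβ₁).const_mul_left C

theorem tendsto_sum_dishRate_div (hα : 0 < α) (hβ₀ : 0 ≤ β) (hβ₁ : β < 1) (hc : -β < c)
    (hu : 0 < u) (hr : u ≤ r) {ω : Ω} (hR : ∀ n, 1 ≤ n → u ≤ R n ω)
    (hω : Tendsto (fun n => meanWeight R n ω) atTop (𝓝 r)) :
    Tendsto (fun n => (∑ j ∈ range n, (dishRate R m α β c B j ω : ℝ)) / normSeq β n) atTop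
      (𝓝 (m.real B * limitConst α β c r)) := by
  simp only [coe_dishRate hα hβ₁ hc hu.le hR, ← mul_sum, mul_div_assoc]
  exact (tendsto_sum_weightRate_div hα hβ₀ hβ₁ hc hu hr (fun j hj => le_meanWeight hR hj)
    hω).const_mul _

variable [mΩ : MeasurableSpace Ω] {P : Measure Ω}

theorem IsWeightedIBP.exists_ae_le (hMR : IsWeightedIBP P M R m α β c) :
    ∃ u : ℝ, 0 < u ∧ ∀ᵐ ω ∂P, ∀ n, 1 ≤ n → u ≤ R n ω := by
  obtain ⟨u, hu, h⟩ := hMR.weight_bound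
  refine ⟨u, (le_max_right _ _).trans_lt hu, ae_all_iff.2 fun n => ?_⟩
  by_cases hn : 1 ≤ n
  · filter_upwards [h n hn] with ω hω _ using hω
  · exact ae_of_all _ fun ω h => absurd h hn

variable [IsProbabilityMeasure P]

/-- One ω from the almost sure events suffices. It makes r positive and a legitimate point of [u, ∞)
in the rate estimates. -/
theorem MeanWeightTendsto.le (hr : MeanWeightTendsto P R r)
    (hu : ∀ᵐ ω ∂P, ∀ n, 1 ≤ n → u ≤ R n ω) : u ≤ r := by
  obtain ⟨ω, h1, h2⟩ := (hr.and hu).exists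
  exact ge_of_tendsto h1 ((eventually_ge_atTop 1).mono fun n hn => le_meanWeight h2 hn)

/-- Tonelli turns the integral into the rate condition plus a multiple of 1 / √a_n, which vanishes
as a_n diverges. -/
theorem MeanWeightRate.tendsto_lintegral (hβ₀ : 0 ≤ β)
    (hRm : ∀ n, 1 ≤ n → Measurable (R n)) (h : MeanWeightRate P R β r) (C : ℝ) :
    Tendsto (fun n : ℕ => ∫⁻ ω, ENNReal.ofReal (C *
      (1 + ∑ j ∈ Icc 1 n, (j : ℝ) ^ (β - 1) * |meanWeight R j ω - r|) / √(normSeq β n)) ∂P)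
      atTop (𝓝 0) := by
  have hmean : ∀ n, Measurable (meanWeight R n) := fun n =>
    (Finset.measurable_fun_sum _ fun i hi => hRm i (Finset.mem_Icc.1 hi).1).div_const _
  have hs : Tendsto (fun n => √(normSeq β n)) atTop atTop :=
    Real.tendsto_sqrt_atTop.comp (tendsto_normSeq hβ₀)
  have h0 : Tendsto (fun n => (ENNReal.ofReal √(normSeq β n))⁻¹) atTop (𝓝 0) := by
    simpa using (ENNReal.tendsto_ofReal_atTop.comp hs).inv
  have h1 := (ENNReal.Tendsto.const_mul (h0.add h) (a := ENNReal.ofReal C)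
    (Or.inr ENNReal.ofReal_ne_top))
  rw [add_zero, mul_zero] at h1
  refine h1.congr' ?_
  filter_upwards [hs.eventually_gt_atTop 0] with n hn
  have hj : ∀ (j : ℕ) (ω : Ω), 0 ≤ (j : ℝ) ^ (β - 1) * |meanWeight R j ω - r| :=
    fun j ω => by positivity
  have e : ∀ ω, ENNReal.ofReal (C *
      (1 + ∑ j ∈ Icc 1 n, (j : ℝ) ^ (β - 1) * |meanWeight R j ω - r|) / √(normSeq β n)) =
      ENNReal.ofReal C * (ENNReal.ofReal √(normSeq β n))⁻¹ * (1 + ∑ j ∈ Icc 1 n,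
        ENNReal.ofReal ((j : ℝ) ^ (β - 1)) * ENNReal.ofReal |meanWeight R j ω - r|) := fun ω => by
    rw [ENNReal.ofReal_div_of_pos hn, ENNReal.ofReal_mul' (by
      have := sum_nonneg fun j (_ : j ∈ Icc 1 n) => hj j ω
      linarith), ENNReal.ofReal_add zero_le_one (sum_nonneg fun j _ => hj j ω),
      ENNReal.ofReal_sum_of_nonneg fun j _ => hj j ω, ENNReal.ofReal_one, div_eq_mul_inv]
    simp only [ENNReal.ofReal_mul (Real.rpow_nonneg (Nat.cast_nonneg _) _)]
    ring
  have hmeas : ∀ j : ℕ, Measurable fun ω => ENNReal.ofReal ((j : ℝ) ^ (β - 1)) *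
      ENNReal.ofReal |meanWeight R j ω - r| := fun j =>
    (((hmean j).sub_const r).abs.ennreal_ofReal).const_mul _
  simp only [e]
  rw [lintegral_const_mul' _ _ (ENNReal.mul_ne_top ENNReal.ofReal_ne_top (by simpa using hn)),
    lintegral_add_left measurable_const, lintegral_finsetSum _ fun j _ => hmeas j]
  simp only [lintegral_const_mul _ ((hmean _).sub_const r).abs.ennreal_ofReal]
  simp only [lintegral_const, measure_univ, mul_one, div_eq_mul_inv]
  ring

variable [MeasurableSpace.CountablyGenerated X] [MeasurableSingletonClass X]
  [IsProbabilityMeasure m]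

theorem IsWeightedIBP.ae_dishCount_eq (hMR : IsWeightedIBP P M R m α β c)
    (hm : ∀ x, m {x} = 0) (B : Set X) :
    ∀ᵐ ω ∂P, ∀ n, dishCount M B n ω = ∑ j ∈ range n, adaptedDishCount M B j ω := by
  filter_upwards [hMR.ae_adaptedDishCount_eq hm B] with ω h n
  simp only [h, dishCount_eq_sum fun n => hMR.finite_dishes n ω]

/-- The count is the martingale, negligible by the strong law, plus the sum of the rates. -/
theorem IsWeightedIBP.tendsto_dishCount_div (hMR : IsWeightedIBP P M R m α β c)
    (hm : ∀ x, m {x} = 0) (hα : 0 < α) (hβ₀ : 0 ≤ β) (hβ₁ : β < 1) (hc : -β < c)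
    (hB : MeasurableSet B) (hr : MeanWeightTendsto P R r) :
    ∀ᵐ ω ∂P, Tendsto (fun n => (dishCount M B n ω : ℝ) / normSeq β n) atTop
        (𝓝 (m.real B * limitConst α β c r)) := by
  obtain ⟨u, hu, hR⟩ := hMR.exists_ae_le
  obtain ⟨w, hw, hw₁, hw₂⟩ := exists_dishRate_le (m := m) hα hβ₀ hβ₁ hc hu R B
  have hT := hR.mono fun ω h => totalWeight_nonneg hu.le h
  filter_upwards [hR, hr, hMR.ae_dishCount_eq hm B, ae_isLittleO_sum_sub (𝓕 := hMR.filtration)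
    (fun n => measurable_adaptedDishCount hB n) (hMR.isCondPoisson hm hβ₁ hc hT hB)
    (fun n => hR.mono fun ω h => hw ω h n) hw₁] with ω h1 h2 h3 h4
  have h5 := ((h4.trans_isBigO hw₂).tendsto_div_nhds_zero).add
    (tendsto_sum_dishRate_div (m := m) (B := B) hα hβ₀ hβ₁ hc hu (hr.le hR) h1 h2)
  rw [zero_add] at h5
  refine h5.congr fun n => ?_
  rw [← add_div, sum_sub_distrib, sub_add_cancel, h3 n]
  push_cast
  rfl

theorem IsWeightedIBP.stablyConverges_dishCount (hMR : IsWeightedIBP P M R m α β c)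
    (hm : ∀ x, m {x} = 0) (hα : 0 < α) (hβ₀ : 0 ≤ β) (hβ₁ : β < 1) (hc : -β < c)
    (hB : MeasurableSet B) (hr : MeanWeightTendsto P R r) (hr' : MeanWeightRate P R β r) :
    StablyConverges P
      (fun n ω => √(normSeq β n) *
        ((dishCount M B n ω : ℝ) / normSeq β n - m.real B * limitConst α β c r))
      (Kernel.const Ω (gaussianReal 0 (m.real B * limitConst α β c r).toNNReal)) := by
  obtain ⟨u, hu, hR⟩ := hMR.exists_ae_le
  have hur := hr.le hR
  obtain ⟨w, hw, -, hw₂⟩ := exists_dishRate_le (m := m) hα hβ₀ hβ₁ hc hu R B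
  obtain ⟨C', hC'⟩ := hw₂.bound
  obtain ⟨C, hC, hCb⟩ := exists_abs_sum_weightRate_sub_le hα hβ₀ hβ₁ hc hu hur
  have hT := hR.mono fun ω h => totalWeight_nonneg hu.le h
  have ha := tendsto_normSeq (β := β) hβ₀
  have hK := fun n => measurable_adaptedDishCount (M := M) (R := R) hB n
  have hl : 0 ≤ m.real B * limitConst α β c r :=
    mul_nonneg measureReal_nonneg (limitConst_nonneg hα hβ₀ hβ₁ hc (hu.trans_le hur))
  refine stablyConverges_of_isCondPoisson (𝓕 := hMR.filtration) hK
    (hMR.isCondPoisson hm hβ₁ hc hT hB) (fun n => hR.mono fun ω h => hw ω h n) ha (C := C') ?_ ?_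
    (fun n => ?_) ?_
  · filter_upwards [hC', ha.eventually_ge_atTop 0] with n hn hn'
    rw [Real.norm_of_nonneg hn'] at hn
    exact (le_abs_self _).trans hn
  · rw [Real.coe_toNNReal _ hl]
    filter_upwards [hR, hr] with ω h1 h2 using
      tendsto_sum_dishRate_div hα hβ₀ hβ₁ hc hu hur h1 h2
  · have h1 : AEMeasurable (fun ω => (dishCount M B n ω : ℝ)) P := by
      refine ⟨fun ω => ∑ j ∈ range n, (adaptedDishCount M B j ω : ℝ),
        Finset.measurable_fun_sum _ fun j _ => measurable_from_nat.comp
          ((hK j).mono (hMR.history_le (j + 1)) le_rfl), ?_⟩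
      filter_upwards [hMR.ae_dishCount_eq hm B] with ω h
      rw [h n]
      push_cast
      rfl
    exact ((h1.div_const _).sub_const _).const_mul _
  · refine tendsto_of_tendsto_of_tendsto_of_le_of_le' tendsto_const_nhds
      (MeanWeightRate.tendsto_lintegral hβ₀ hMR.measurable_weight hr' C) (Eventually.of_forall fun n => zero_le)
      ?_
    filter_upwards [ha.eventually_gt_atTop 0] with n hn
    refine lintegral_mono_ae ?_
    filter_upwards [hR, hMR.ae_dishCount_eq hm B] with ω h1 h2
    have hs : 0 < √(normSeq β n) := Real.sqrt_pos.2 hn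
    have hsq : √(normSeq β n) * √(normSeq β n) = normSeq β n := Real.mul_self_sqrt hn.le
    have hx := hCb (fun j => meanWeight R j ω) (fun j hj => le_meanWeight h1 hj) n
    -- The martingale part cancels: what separates the normalised count from the normalised
    -- martingale is the error of the summed rates, controlled by hx.
    have e : √(normSeq β n) * ((dishCount M B n ω : ℝ) / normSeq β n -
        m.real B * limitConst α β c r) - (∑ j ∈ range n, ((adaptedDishCount M B j ω : ℝ) -
          dishRate R m α β c B j ω)) / √(normSeq β n) =
        m.real B * (∑ j ∈ range n, weightRate α β c (j * meanWeight R j ω) -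
          limitConst α β c r * normSeq β n) / √(normSeq β n) := by
      simp only [coe_dishRate hα hβ₁ hc hu.le h1]
      rw [sum_sub_distrib, ← mul_sum, h2 n]
      push_cast
      have h3 : ∀ {s a : ℝ} (D b l S : ℝ), 0 < s → s * s = a →
          s * (D / a - b * l) - (D - b * S) / s = b * (S - l * a) / s := by
        rintro s _ D b l S hs rfl
        field_simp
        ring
      exact h3 _ _ _ _ hs hsq
    rw [e, abs_div, abs_of_pos hs, abs_mul, abs_of_nonneg measureReal_nonneg]
    refine ENNReal.ofReal_le_ofReal (div_le_div_of_nonneg_right ?_ hs.le)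
    exact (mul_le_of_le_one_left (abs_nonneg _) measureReal_le_one).trans hx

end Asymptotics

end WeightedIBP

theorem mainTheorem4 {Ω : Type v} [MeasurableSpace Ω] (P : Measure Ω) [IsProbabilityMeasure P]
    {X : Type u} [MetricSpace X] [TopologicalSpace.SeparableSpace X] [MeasurableSpace X]
    [BorelSpace X] (m : Measure X) [IsProbabilityMeasure m] (hm : ∀ x, m {x} = 0)
    (α β c : ℝ) (hα : 0 < α) (hβ₀ : 0 ≤ β) (hβ₁ : β < 1) (hc : -β < c)
    (M : ℕ → Ω → Measure X) (R : ℕ → Ω → ℝ) (hMR : IsWeightedIBP P M R m α β c)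
    (B : Set X) (hB : MeasurableSet B) (r : ℝ) :
    (MeanWeightTendsto P R r →
      ∀ᵐ ω ∂P, Tendsto (fun n => (dishCount M B n ω : ℝ) / normSeq β n) atTop
        (𝓝 (m.real B * limitConst α β c r))) ∧
    (MeanWeightTendsto P R r → MeanWeightRate P R β r →
      StablyConverges P
        (fun n ω => Real.sqrt (normSeq β n) *
          ((dishCount M B n ω : ℝ) / normSeq β n - m.real B * limitConst α β c r))
        (Kernel.const Ω (gaussianReal 0 (m.real B * limitConst α β c r).toNNReal))) := by
  -- Second countability makes the Borel σ-field countably generated, which provides the partitions.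
  have := UniformSpace.secondCountable_of_separable X
  exact ⟨hMR.tendsto_dishCount_div hm hα hβ₀ hβ₁ hc hB,
    hMR.stablyConverges_dishCount hm hα hβ₀ hβ₁ hc hB⟩
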